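/- Fix the model of a randomized real RAM: it has words (integers in $[0,2^w)$, where $w$ is the word size) with machine arithmetic, real numbers with exact $+,-,\times,/$ and comparisons (but no rounding of reals to integers), arrays addressed by words, and an operation that draws a uniformly random word from $\{0,\dots,m-1\}$ for a given word $m\ge 1$; every elementary command takes one step. A box in $\mathbb R^d$ is a set $\prod_{j=1}^d[\alpha_j,\beta_j]$. **Theorem.** There is an absolute constant $C$ such that for every $d\ge 1$ and every $q\in\mathbb N$ there are a program of this machine and constants $c,K$ (depending only on $d$ and $q$) with the following property. Let $P$ consist of $n\ge 1$ points of $\mathbb R^d$ (repetitions are allowed and counted), let $\varepsilon\in(0,1)$, and let the word size satisfy $2^w\ge(n+1/\varepsilon)^c$. On input $(P,\varepsilon)$ the program always halts after at most $$K\Bigl(n+\tfrac1\varepsilon\,\bigl(\max\{1,\log\tfrac1\varepsilon\}\bigr)^{C d^2}\Bigr)$$ steps and always outputs a set $N\subset\mathbb R^d$ (not necessarily contained in $P$) of at most $$K\cdot\tfrac1\varepsilon\,\max\{1,\log\log\tfrac1\varepsilon\}$$ points, and with probability at least $1-(\varepsilon/2)^q$ over its random choices, $N$ is a weak $\varepsilon$-net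 of $P$ for boxes: $N\cap B\ne\emptyset$ for every box $B$ that contains at least $\varepsilon n$ of the points of $P$. -/

import Mathlib

/-! ## A randomized real RAM with a step count

The machine holds words (integers in `[0, 2 ^ w)` for a word size `w`) and real numbers, each kind in
finitely many variables and finitely many arrays addressed by words (a program is a finite object, so
it names only finitely many of them). Words carry the usual machine arithmetic, reals carry exact
`+ - * /` and comparisons; a real is never rounded to a word. A program can draw a uniformly random
word from a given range. -/

namespace RealRAM

/-- Expressions with a word as value. -/
inductive WExp : Type
  | const (c : ℕ)
  | var (x : ℕ)
  | get (a : ℕ) (i : WExp)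
  | add (e f : WExp)
  | sub (e f : WExp)
  | mul (e f : WExp)
  | div (e f : WExp)
  | mod (e f : WExp)

/-- Expressions with a real number as value. -/
inductive RExp : Type
  | ofWord (e : WExp)
  | var (x : ℕ)
  | get (a : ℕ) (i : WExp)
  | add (e f : RExp)
  | sub (e f : RExp)
  | mul (e f : RExp)
  | div (e f : RExp)

/-- Tests. -/
inductive Test : Type
  | wlt (e f : WExp)
  | rlt (e f : RExp)
  | not (b : Test)
  | and (b c : Test)

/-- Programs. -/
inductive Cmd : Type
  | skip
  | wset (x : ℕ) (e : WExp)
  | rset (x : ℕ) (e : RExp)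
  | wput (a : ℕ) (i : WExp) (e : WExp)
  | rput (a : ℕ) (i : WExp) (e : RExp)
  | rand (x : ℕ) (e : WExp)
  | seq (c₁ c₂ : Cmd)
  | ite (b : Test) (c₁ c₂ : Cmd)
  | loop (b : Test) (c : Cmd)

/-- The memory: word variables, real variables, word arrays and real arrays
(first the name of the array, then the address). -/
structure Store : Type where
  wvar : ℕ → ℕ
  rvar : ℕ → ℝ
  warr : ℕ → ℕ → ℕ
  rarr : ℕ → ℕ → ℝ

/-- Value of a word expression at word size `w`: sums and products wrap around modulo `2 ^ w`,
subtraction is cut off at `0`, and division is integer division (`e / 0 = 0`, `e % 0 = e`). -/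
def WExp.eval (w : ℕ) (s : Store) : WExp → ℕ
  | .const c => c % 2 ^ w
  | .var x => s.wvar x
  | .get a i => s.warr a (i.eval w s)
  | .add e f => (e.eval w s + f.eval w s) % 2 ^ w
  | .sub e f => e.eval w s - f.eval w s
  | .mul e f => (e.eval w s * f.eval w s) % 2 ^ w
  | .div e f => e.eval w s / f.eval w s
  | .mod e f => e.eval w s % f.eval w s

/-- Value of a real expression. -/
noncomputable def RExp.eval (w : ℕ) (s : Store) : RExp → ℝ
  | .ofWord e => (e.eval w s : ℝ)
  | .var x => s.rvar x
  | .get a i => s.rarr a (i.eval w s)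
  | .add e f => e.eval w s + f.eval w s
  | .sub e f => e.eval w s - f.eval w s
  | .mul e f => e.eval w s * f.eval w s
  | .div e f => e.eval w s / f.eval w s

/-- Truth of a test. -/
def Test.holds (w : ℕ) (s : Store) : Test → Prop
  | .wlt e f => e.eval w s < f.eval w s
  | .rlt e f => e.eval w s < f.eval w s
  | .not b => ¬ b.holds w s
  | .and b c => b.holds w s ∧ c.holds w s

/-- Assignment to a word variable. -/
def Store.setW (s : Store) (x v : ℕ) : Store :=
  { s with wvar := Function.update s.wvar x v }

/-- Assignment to a real variable. -/
noncomputable def Store.setR (s : Store) (x : ℕ) (v : ℝ) : Store :=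
  { s with rvar := Function.update s.rvar x v }

/-- Assignment to a cell of a word array. -/
def Store.putW (s : Store) (a i v : ℕ) : Store :=
  { s with warr := Function.update s.warr a (Function.update (s.warr a) i v) }

/-- Assignment to a cell of a real array. -/
noncomputable def Store.putR (s : Store) (a i : ℕ) (v : ℝ) : Store :=
  { s with rarr := Function.update s.rarr a (Function.update (s.rarr a) i v) }

/-- A configuration: the commands that are still to be executed, in this order, and the memory. -/
abbrev Config : Type := List Cmd × Store

open Classical in
/-- One step of the machine at word size `w`, as a probability distribution over configurations.
`rand x e` puts a uniformly random element of `{0, …, m - 1}` into the word variable `x`, where `m` is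
the value of `e` (and puts `0` there if `m = 0`). A configuration with nothing left to execute has
halted and does not change any more. -/
noncomputable def step (w : ℕ) : Config → PMF Config
  | ([], s) => PMF.pure ([], s)
  | (.skip :: k, s) => PMF.pure (k, s)
  | (.wset x e :: k, s) => PMF.pure (k, s.setW x (e.eval w s))
  | (.rset x e :: k, s) => PMF.pure (k, s.setR x (e.eval w s))
  | (.wput a i e :: k, s) => PMF.pure (k, s.putW a (i.eval w s) (e.eval w s))
  | (.rput a i e :: k, s) => PMF.pure (k, s.putR a (i.eval w s) (e.eval w s))
  | (.rand x e :: k, s) =>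
      (PMF.uniformOfFintype (Fin (e.eval w s - 1 + 1))).map fun r => (k, s.setW x r)
  | (.seq c₁ c₂ :: k, s) => PMF.pure (c₁ :: c₂ :: k, s)
  | (.ite b c₁ c₂ :: k, s) => PMF.pure ((if b.holds w s then c₁ else c₂) :: k, s)
  | (.loop b c :: k, s) => PMF.pure (if b.holds w s then c :: .loop b c :: k else k, s)

/-- The distribution of the configuration after `t` steps. -/
noncomputable def run (w : ℕ) : ℕ → Config → PMF Config
  | 0, c => PMF.pure c
  | t + 1, c => (step w c).bind (run w t)

/-- The input format: the number `n` of points is in word variable `0`, the parameter `ε` in real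
variable `0`, and coordinate `j < d` of point `i < n` in cell `i` of real array `j`. All the other
memory is `0`. -/
noncomputable def input {d n : ℕ} (P : Fin n → Fin d → ℝ) (ε : ℝ) : Store where
  wvar x := if x = 0 then n else 0
  rvar x := if x = 0 then ε else 0
  warr _ _ := 0
  rarr a i := if h : a < d ∧ i < n then P ⟨i, h.2⟩ ⟨a, h.1⟩ else 0

/-- The number of points in the output: the value of word variable `1`. -/
def outputSize (s : Store) : ℕ := s.wvar 1

/-- The points in the output: coordinate `j < d` of output point `i < outputSize s` is in cell `i` of
real array `d + j`. -/
def output (d : ℕ) (s : Store) : Set (Fin d → ℝ) :=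
  {x | ∃ i < outputSize s, ∀ j : Fin d, x j = s.rarr (d + j) i}

end RealRAM

/-- The axis-parallel closed box `∏ j, [a j, b j]`. -/
def Box {d : ℕ} (a b : Fin d → ℝ) : Set (Fin d → ℝ) := {x | ∀ j, a j ≤ x j ∧ x j ≤ b j}

/-- `N` is a weak `ε`-net for the `n` points `P` with respect to boxes: it meets every box that contains
at least `ε n` of the points. -/
def IsWeakNet {d n : ℕ} (P : Fin n → Fin d → ℝ) (ε : ℝ) (N : Set (Fin d → ℝ)) : Prop :=
  ∀ a b : Fin d → ℝ, ε * (n : ℝ) ≤ (({i : Fin n | P i ∈ Box a b}.ncard : ℕ) : ℝ) →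
    (N ∩ Box a b).Nonempty

/-! ### Composing runs of the machine -/

namespace RealRAM

/-! Let `k` be least with `1 ≤ 2 ^ k * ε` and `j` least with `k ≤ 2 ^ j`. Up to constants, `2 ^ k`
is `1/ε`, `2 ^ j` is `log (1/ε)` and `j` is `log log (1/ε)`. Draw `m = 16 * 2 ^ k * h` random
points, where `h = 2 ^ (a + j)` and `a` depends on `d` and `q` only. With the required probability
every box with at least `ε n` points of `P` receives at least `h` sample points
(`samp_not_good_le`): after rounding to a grid of ranks only polynomially many boxes in `1/ε`
matter, and each of them fails with probability at most `2 ^ (-3h)`. The rest is deterministic: hit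
every box that contains at least `h` of the `m` sample points, using `O((m/h) * j)` points.

Replace coordinates by ranks in the sample. For every tuple of levels, cut the rank axes into dyadic
intervals of the corresponding lengths; the products of these intervals are the cells. A sample
point lies in one cell for each of the `D` tuples, and `D` is polylogarithmic. Given a box with at
least two sample points, take in each coordinate the shortest dyadic interval with the ranks of all
its points. The middle of that interval separates the smallest rank from the largest
(`exists_level`). Hence the points of the box lie in a common cell, and the centre of this cell, the
point whose coordinates have the middle ranks, lies in the box.

If this cell has more than `T0 = h * D` points, its centre is put into the net. There are only `m *
D` incidences between points and cells, so there are at most `m / h` such centres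
(`card_heavy_mul_le`); they need not belong to `P`. If the cell has at most `T0` points, the box may
be replaced by the one spanned by its extreme points, which is coded by `2d` positions in the list
of the cell. A sample point then lies in at most `D * T0 ^ (2d) = 2 ^ I` coded boxes, with `I =
O(j)`, and every box to be hit has at least `h` points. A greedy cover whose thresholds halve from
`2 ^ I` to `1` takes at most `2m / h` points in each of its `I + 1` passes (`greedy_bounds`,
`greedy_hits`). The dichotomy is `exists_center_or_hit`; this part of the program is treated in
`runs_netCmd`.

On the machine, `Runs` is a total correctness statement with a step bound for commands without
randomness, and what a command leaves unchanged is read off its syntax. Only the sampling loop is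
random, and it is described exactly by the distribution `samp`. The address spaces, such as the `D *
m ^ d` possible cells, are much larger than the time bound. They cost nothing, because memory starts
at zero and a word of `O(log (1/ε))` bits can address them. The program looks only at the sampled
points, so its running time does not depend on `n`. -/

theorem run_add (w a b : ℕ) (c : Config) : run w (a + b) c = (run w a c).bind (run w b) := by
  induction a generalizing c with
  | zero => simp [run]
  | succ a ih =>
    rw [show a + 1 + b = a + b + 1 by omega]
    simp only [run, PMF.bind_bind]
    congr 1
    funext c'
    exact ih c'

theorem run_halted (w t : ℕ) (s : Store) : run w t ([], s) = PMF.pure ([], s) := by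
  induction t with
  | zero => rfl
  | succ t ih => simp [run, step, ih]

theorem run_succ_of_step {w : ℕ} {c c' : Config} (h : step w c = PMF.pure c') (t : ℕ) :
    run w (t + 1) c = run w t c' := by
  simp [run, h]

theorem run_one_add_of_step {w : ℕ} {c c' : Config} (h : step w c = PMF.pure c') (t : ℕ) :
    run w (1 + t) c = run w t c' := by
  rw [add_comm, run_succ_of_step h]

theorem run_one_of_step {w : ℕ} {c c' : Config} (h : step w c = PMF.pure c') :
    run w 1 c = PMF.pure c' := by
  rw [show (1 : ℕ) = 0 + 1 from rfl, run_succ_of_step h]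
  rfl

theorem run_add_of_run {w a : ℕ} {c c' : Config} (h : run w a c = PMF.pure c') (b : ℕ) :
    run w (a + b) c = run w b c' := by
  simp [run_add, h]

/-- Started in `s`, the command `c` halts after at most `T` steps, without using randomness, in a
store that satisfies `Q`. -/
def Runs (w : ℕ) (c : Cmd) (s : Store) (T : ℕ) (Q : Store → Prop) : Prop :=
  ∃ t ≤ T, ∃ s', Q s' ∧ ∀ k, run w t (c :: k, s) = PMF.pure (k, s')

/-- `c` contains an assignment to the word variable `x`. -/
def Cmd.WV : Cmd → ℕ → Prop
  | .wset x _, y => y = x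
  | .rand x _, y => y = x
  | .seq a b, y => a.WV y ∨ b.WV y
  | .ite _ a b, y => a.WV y ∨ b.WV y
  | .loop _ a, y => a.WV y
  | _, _ => False

/-- `c` contains an assignment to a cell of the word array `x`. -/
def Cmd.WA : Cmd → ℕ → Prop
  | .wput x _ _, y => y = x
  | .seq a b, y => a.WA y ∨ b.WA y
  | .ite _ a b, y => a.WA y ∨ b.WA y
  | .loop _ a, y => a.WA y
  | _, _ => False

/-- `c` contains an assignment to a cell of the real array `x`. -/
def Cmd.RA : Cmd → ℕ → Prop
  | .rput x _ _, y => y = x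
  | .seq a b, y => a.RA y ∨ b.RA y
  | .ite _ a b, y => a.RA y ∨ b.RA y
  | .loop _ a, y => a.RA y
  | _, _ => False

/-- The stores `s` and `s'` agree on everything that `c` does not write. -/
structure Frame (c : Cmd) (s s' : Store) : Prop where
  wv : ∀ x, ¬ c.WV x → s'.wvar x = s.wvar x
  wa : ∀ a, ¬ c.WA a → s'.warr a = s.warr a
  ra : ∀ a, ¬ c.RA a → s'.rarr a = s.rarr a

theorem Frame.refl (c : Cmd) (s : Store) : Frame c s s :=
  ⟨fun _ _ => rfl, fun _ _ => rfl, fun _ _ => rfl⟩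

theorem Frame.trans {c : Cmd} {s s' s'' : Store} (h : Frame c s s') (h' : Frame c s' s'') :
    Frame c s s'' :=
  ⟨fun x hx => (h'.wv x hx).trans (h.wv x hx), fun x hx => (h'.wa x hx).trans (h.wa x hx),
    fun x hx => (h'.ra x hx).trans (h.ra x hx)⟩

theorem Frame.mono {c c' : Cmd} {s s' : Store} (h : Frame c s s') (hv : ∀ x, c.WV x → c'.WV x)
    (ha : ∀ x, c.WA x → c'.WA x) (hr : ∀ x, c.RA x → c'.RA x) : Frame c' s s' :=
  ⟨fun x hx => h.wv x fun h' => hx (hv x h'), fun x hx => h.wa x fun h' => hx (ha x h'),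
    fun x hx => h.ra x fun h' => hx (hr x h')⟩

theorem step_preserves_wvar {w x : ℕ} {cs cs' : List Cmd} {s s' : Store}
    (h : (cs', s') ∈ (step w (cs, s)).support) (hc : ∀ c ∈ cs, ¬ c.WV x) :
    (∀ c ∈ cs', ¬ c.WV x) ∧ s'.wvar x = s.wvar x := by
  rcases cs with _ | ⟨c, k⟩
  · simp [step] at h; simp [h]
  · have hk : ∀ c ∈ k, ¬ c.WV x := fun c hc' => hc c (List.mem_cons_of_mem _ hc')
    have h0 := hc c List.mem_cons_self
    rcases c with _ | ⟨y, e⟩ | ⟨y, e⟩ | ⟨y, i, e⟩ | ⟨y, i, e⟩ | ⟨y, e⟩ | ⟨c₁, c₂⟩ | ⟨b, c₁, c₂⟩ | ⟨b, c₁⟩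
    all_goals simp only [step, PMF.support_pure, PMF.support_map, Set.mem_singleton_iff,
      Prod.mk.injEq, Set.mem_image] at h
    all_goals simp only [Cmd.WV, not_or] at h0
    case rand =>
      obtain ⟨r, -, rfl, rfl⟩ := h
      exact ⟨hk, by simp [Store.setW, Function.update_of_ne h0]⟩
    case wset =>
      obtain ⟨rfl, rfl⟩ := h
      exact ⟨hk, by simp [Store.setW, Function.update_of_ne h0]⟩
    case seq =>
      obtain ⟨rfl, rfl⟩ := h
      refine ⟨?_, rfl⟩
      simpa [h0] using hk
    case ite =>
      obtain ⟨rfl, rfl⟩ := h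
      refine ⟨?_, rfl⟩
      by_cases hb : b.holds w s' <;> simpa [h0, hb] using hk
    case loop =>
      obtain ⟨rfl, rfl⟩ := h
      refine ⟨?_, rfl⟩
      by_cases hb : b.holds w s' <;> simpa [h0, hb, Cmd.WV] using hk
    all_goals
      obtain ⟨rfl, rfl⟩ := h
      exact ⟨hk, rfl⟩

theorem step_preserves_warr {w x : ℕ} {cs cs' : List Cmd} {s s' : Store}
    (h : (cs', s') ∈ (step w (cs, s)).support) (hc : ∀ c ∈ cs, ¬ c.WA x) :
    (∀ c ∈ cs', ¬ c.WA x) ∧ s'.warr x = s.warr x := by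
  rcases cs with _ | ⟨c, k⟩
  · simp [step] at h; simp [h]
  · have hk : ∀ c ∈ k, ¬ c.WA x := fun c hc' => hc c (List.mem_cons_of_mem _ hc')
    have h0 := hc c List.mem_cons_self
    rcases c with _ | ⟨y, e⟩ | ⟨y, e⟩ | ⟨y, i, e⟩ | ⟨y, i, e⟩ | ⟨y, e⟩ | ⟨c₁, c₂⟩ | ⟨b, c₁, c₂⟩ | ⟨b, c₁⟩
    all_goals simp only [step, PMF.support_pure, PMF.support_map, Set.mem_singleton_iff,
      Prod.mk.injEq, Set.mem_image] at h
    all_goals simp only [Cmd.WA, not_or] at h0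
    case rand =>
      obtain ⟨r, -, rfl, rfl⟩ := h
      exact ⟨hk, rfl⟩
    case wput =>
      obtain ⟨rfl, rfl⟩ := h
      exact ⟨hk, by simp [Store.putW, Function.update_of_ne h0]⟩
    case seq =>
      obtain ⟨rfl, rfl⟩ := h
      refine ⟨?_, rfl⟩
      simpa [h0] using hk
    case ite =>
      obtain ⟨rfl, rfl⟩ := h
      refine ⟨?_, rfl⟩
      by_cases hb : b.holds w s' <;> simpa [h0, hb] using hk
    case loop =>
      obtain ⟨rfl, rfl⟩ := h
      refine ⟨?_, rfl⟩
      by_cases hb : b.holds w s' <;> simpa [h0, hb, Cmd.WA] using hk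
    all_goals
      obtain ⟨rfl, rfl⟩ := h
      exact ⟨hk, rfl⟩

theorem step_preserves_rarr {w x : ℕ} {cs cs' : List Cmd} {s s' : Store}
    (h : (cs', s') ∈ (step w (cs, s)).support) (hc : ∀ c ∈ cs, ¬ c.RA x) :
    (∀ c ∈ cs', ¬ c.RA x) ∧ s'.rarr x = s.rarr x := by
  rcases cs with _ | ⟨c, k⟩
  · simp [step] at h; simp [h]
  · have hk : ∀ c ∈ k, ¬ c.RA x := fun c hc' => hc c (List.mem_cons_of_mem _ hc')
    have h0 := hc c List.mem_cons_self
    rcases c with _ | ⟨y, e⟩ | ⟨y, e⟩ | ⟨y, i, e⟩ | ⟨y, i, e⟩ | ⟨y, e⟩ | ⟨c₁, c₂⟩ | ⟨b, c₁, c₂⟩ | ⟨b, c₁⟩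
    all_goals simp only [step, PMF.support_pure, PMF.support_map, Set.mem_singleton_iff,
      Prod.mk.injEq, Set.mem_image] at h
    all_goals simp only [Cmd.RA, not_or] at h0
    case rand =>
      obtain ⟨r, -, rfl, rfl⟩ := h
      exact ⟨hk, rfl⟩
    case rput =>
      obtain ⟨rfl, rfl⟩ := h
      exact ⟨hk, by simp [Store.putR, Function.update_of_ne h0]⟩
    case seq =>
      obtain ⟨rfl, rfl⟩ := h
      refine ⟨?_, rfl⟩
      simpa [h0] using hk
    case ite =>
      obtain ⟨rfl, rfl⟩ := h
      refine ⟨?_, rfl⟩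
      by_cases hb : b.holds w s' <;> simpa [h0, hb] using hk
    case loop =>
      obtain ⟨rfl, rfl⟩ := h
      refine ⟨?_, rfl⟩
      by_cases hb : b.holds w s' <;> simpa [h0, hb, Cmd.RA] using hk
    all_goals
      obtain ⟨rfl, rfl⟩ := h
      exact ⟨hk, rfl⟩

/-- One induction serves all three kinds of memory. Here `B` means "may change the part of the store
that `F` reads"; the pending commands are always parts of the original ones, so none of them ever
acquires the property `B`. -/
theorem run_preserves {w : ℕ} {α : Type*} (F : Store → α) (B : Cmd → Prop)
    (hstep : ∀ {cs cs' : List Cmd} {s s' : Store}, (cs', s') ∈ (step w (cs, s)).support →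
      (∀ c ∈ cs, ¬ B c) → (∀ c ∈ cs', ¬ B c) ∧ F s' = F s)
    (t : ℕ) {cs cs' : List Cmd} {s s' : Store} (h : (cs', s') ∈ (run w t (cs, s)).support)
    (hc : ∀ c ∈ cs, ¬ B c) : F s' = F s := by
  induction t generalizing cs s with
  | zero =>
    simp only [run, PMF.support_pure, Set.mem_singleton_iff, Prod.mk.injEq] at h
    rw [h.2]
  | succ t ih =>
    simp only [run, PMF.support_bind, Set.mem_iUnion, exists_prop] at h
    obtain ⟨⟨cs₁, s₁⟩, h₁, h₂⟩ := h
    obtain ⟨h₃, h₄⟩ := hstep h₁ hc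
    rw [ih h₂ h₃, h₄]

/-- A deterministic run has its final configuration in the support, so the syntactic invariance
applies to the final store. -/
theorem frame_of_run {w t : ℕ} {c : Cmd} {s s' : Store}
    (h : run w t ([c], s) = PMF.pure ([], s')) : Frame c s s' := by
  have hs : (([] : List Cmd), s') ∈ (run w t ([c], s)).support := by simp [h]
  exact ⟨fun x hx => run_preserves (fun s => s.wvar x) (fun c => c.WV x) step_preserves_wvar t hs
      (by simpa using hx),
    fun x hx => run_preserves (fun s => s.warr x) (fun c => c.WA x) step_preserves_warr t hs
      (by simpa using hx),
    fun x hx => run_preserves (fun s => s.rarr x) (fun c => c.RA x) step_preserves_rarr t hs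
      (by simpa using hx)⟩

/-! ### Proof rules with step counts -/

section Rules

variable {w T T' T₁ T₂ : ℕ} {c c₁ c₂ : Cmd} {s : Store} {Q Q' : Store → Prop}

/-- The frame is available whenever a postcondition is weakened, so invariants need to mention only
what a command changes. -/
theorem Runs.mono (h : Runs w c s T Q) (hT : T ≤ T') (hQ : ∀ s', Frame c s s' → Q s' → Q' s') :
    Runs w c s T' Q' := by
  obtain ⟨t, ht, s', hQs, hr⟩ := h
  exact ⟨t, ht.trans hT, s', hQ s' (frame_of_run (hr [])) hQs, hr⟩

theorem Runs.of_step {s' : Store} (h : ∀ k, step w (c :: k, s) = PMF.pure (k, s')) (hT : 1 ≤ T)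
    (hQ : Q s') : Runs w c s T Q :=
  ⟨1, hT, s', hQ, fun k => run_one_of_step (h k)⟩

theorem Runs.skip (hT : 1 ≤ T) (hQ : Q s) : Runs w .skip s T Q :=
  Runs.of_step (fun _ => rfl) hT hQ

theorem Runs.wset {x : ℕ} {e : WExp} (v : ℕ) (he : e.eval w s = v) (hT : 1 ≤ T)
    (hQ : Q (s.setW x v)) : Runs w (.wset x e) s T Q :=
  Runs.of_step (fun _ => by simp [step, he]) hT hQ

theorem Runs.wput {a : ℕ} {i e : WExp} (u v : ℕ) (hi : i.eval w s = u) (he : e.eval w s = v)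
    (hT : 1 ≤ T) (hQ : Q (s.putW a u v)) : Runs w (.wput a i e) s T Q :=
  Runs.of_step (fun _ => by simp [step, hi, he]) hT hQ

theorem Runs.rput {a : ℕ} {i : WExp} {e : RExp} (u : ℕ) (v : ℝ) (hi : i.eval w s = u)
    (he : e.eval w s = v) (hT : 1 ≤ T) (hQ : Q (s.putR a u v)) : Runs w (.rput a i e) s T Q :=
  Runs.of_step (fun _ => by simp [step, hi, he]) hT hQ

theorem Runs.seq (T₁ T₂ : ℕ) (h : Runs w c₁ s T₁ fun s' => Runs w c₂ s' T₂ Q)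
    (hT : T₁ + T₂ + 1 ≤ T) : Runs w (.seq c₁ c₂) s T Q := by
  obtain ⟨t₁, ht₁, s₁, ⟨t₂, ht₂, s₂, hQ, h₂⟩, h₁⟩ := h
  refine ⟨1 + (t₁ + t₂), by omega, s₂, hQ, fun k => ?_⟩
  rw [run_one_add_of_step rfl, run_add_of_run (h₁ _), h₂]

theorem Runs.seq_wset {x : ℕ} {e : WExp} (v : ℕ) (he : e.eval w s = v)
    (h : Runs w c (s.setW x v) T Q) : Runs w (.seq (.wset x e) c) s (T + 2) Q :=
  Runs.seq 1 T (Runs.wset v he le_rfl h) (by omega)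

theorem Runs.ite {b : Test} (h₁ : b.holds w s → Runs w c₁ s T Q)
    (h₂ : ¬ b.holds w s → Runs w c₂ s T Q) (hT : T + 1 ≤ T') : Runs w (.ite b c₁ c₂) s T' Q := by
  by_cases hb : b.holds w s
  · obtain ⟨t, ht, s', hQ, h⟩ := h₁ hb
    refine ⟨1 + t, by omega, s', hQ, fun k => ?_⟩
    rw [run_one_add_of_step (c' := (c₁ :: k, s)) (by simp [step, hb]), h]
  · obtain ⟨t, ht, s', hQ, h⟩ := h₂ hb
    refine ⟨1 + t, by omega, s', hQ, fun k => ?_⟩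
    rw [run_one_add_of_step (c' := (c₂ :: k, s)) (by simp [step, hb]), h]

theorem Runs.loop_succ {b : Test} (hb : b.holds w s)
    (h : Runs w c s T₁ fun s' => Runs w (.loop b c) s' T₂ Q) :
    Runs w (.loop b c) s (T₁ + T₂ + 1) Q := by
  obtain ⟨t₁, ht₁, s₁, ⟨t₂, ht₂, s₂, hQ, h₂⟩, h₁⟩ := h
  refine ⟨1 + (t₁ + t₂), by omega, s₂, hQ, fun k => ?_⟩
  rw [run_one_add_of_step (c' := (c :: .loop b c :: k, s)) (by simp [step, hb]),
    run_add_of_run (h₁ _), h₂]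

theorem Runs.loop_zero {b : Test} (hb : ¬ b.holds w s) (hT : 1 ≤ T) (hQ : Q s) :
    Runs w (.loop b c) s T Q :=
  Runs.of_step (fun _ => by simp [step, hb]) hT hQ

end Rules

/-- The loop in which the word variable `x` counts from `0` to the value of `e`. -/
def Cmd.times (x : ℕ) (e : WExp) (c : Cmd) : Cmd :=
  .seq (.wset x (.const 0))
    (.loop (.wlt (.var x) e) (.seq c (.wset x (.add (.var x) (.const 1)))))

@[simp] theorem Cmd.WV_times (x : ℕ) (e : WExp) (c : Cmd) (y : ℕ) :
    (Cmd.times x e c).WV y ↔ y = x ∨ c.WV y := by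
  simp only [Cmd.times, Cmd.WV]; tauto

@[simp] theorem Cmd.WA_times (x : ℕ) (e : WExp) (c : Cmd) (y : ℕ) :
    (Cmd.times x e c).WA y ↔ c.WA y := by
  simp only [Cmd.times, Cmd.WA]; tauto

@[simp] theorem Cmd.RA_times (x : ℕ) (e : WExp) (c : Cmd) (y : ℕ) :
    (Cmd.times x e c).RA y ↔ c.RA y := by
  simp only [Cmd.times, Cmd.RA]; tauto

theorem Frame.setW {c : Cmd} {s s' : Store} (h : Frame c s s') {x : ℕ} (hx : c.WV x) (v : ℕ) :
    Frame c s (s'.setW x v) := by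
  refine ⟨fun y hy => ?_, h.wa, h.ra⟩
  rw [← h.wv y hy]
  exact Function.update_of_ne (by rintro rfl; exact hy hx) _ _

/-- The bound `e` is evaluated anew before every round, hence the requirement that its value is `N`
in every store that the loop can reach. The invariant must survive assignments to the counter, which
happen outside the body. A round costs three steps more than its body: the test, the sequencing and
the increment. -/
theorem Runs.times {w x N Tb T : ℕ} {e : WExp} {c : Cmd} {s₀ : Store} (I : ℕ → Store → Prop)
    (hN : N < 2 ^ w) (hx : ¬ c.WV x)
    (hI : ∀ i s v, I i s → I i (s.setW x v))
    (he : ∀ s, Frame (.times x e c) s₀ s → e.eval w s = N)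
    (h0 : I 0 s₀)
    (hb : ∀ i < N, ∀ s, s.wvar x = i → Frame (.times x e c) s₀ s → I i s → Runs w c s Tb (I (i + 1)))
    (hT : N * (Tb + 3) + 3 ≤ T) :
    Runs w (.times x e c) s₀ T (I N) := by
  have key : ∀ r i, i + r = N → ∀ s, s.wvar x = i → Frame (.times x e c) s₀ s → I i s →
      Runs w (.loop (.wlt (.var x) e) (.seq c (.wset x (.add (.var x) (.const 1))))) s
        (r * (Tb + 3) + 1) (I N) := by
    intro r
    induction r with
    | zero =>
      intro i hi s hs hf hIs
      refine Runs.loop_zero ?_ (by omega) ?_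
      · simp only [Test.holds, WExp.eval, he s hf, hs]; omega
      · rwa [show N = i by omega]
    | succ r ih =>
      intro i hi s hs hf hIs
      have hbd : Runs w (.seq c (.wset x (.add (.var x) (.const 1)))) s (Tb + 2) fun s' =>
          Runs w (.loop (.wlt (.var x) e) (.seq c (.wset x (.add (.var x) (.const 1))))) s'
            (r * (Tb + 3) + 1) (I N) := by
        refine Runs.seq Tb 1 ?_ (by omega)
        refine Runs.mono (hb i (by omega) s hs hf hIs) le_rfl fun s' hf' hI' => ?_
        have hx' : s'.wvar x = i := by rw [hf'.wv x hx, hs]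
        refine Runs.wset (i + 1) ?_ le_rfl ?_
        · simp only [WExp.eval, hx', Nat.add_mod_mod]
          exact Nat.mod_eq_of_lt (by omega)
        · refine ih (i + 1) (by omega) _ (by simp [Store.setW]) ?_ (hI _ _ _ hI')
          refine Frame.setW (hf.trans (hf'.mono ?_ ?_ ?_)) (by simp) _
          all_goals intro y hy; simp [hy]
      refine Runs.mono (Runs.loop_succ ?_ hbd) (by ring_nf; omega) fun _ _ h => h
      simp only [Test.holds, WExp.eval, he s hf, hs]; omega
  refine Runs.seq 1 (N * (Tb + 3) + 1) (Runs.wset 0 (by simp [WExp.eval]) le_rfl ?_) (by omega)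
  exact key N 0 (by omega) _ (by simp [Store.setW]) ((Frame.refl _ _).setW (by simp) _) (hI _ _ _ h0)

/-- The commands `f 0, …, f (n - 1)` in this order. -/
def Cmd.all (f : ℕ → Cmd) : ℕ → Cmd
  | 0 => .skip
  | n + 1 => .seq (Cmd.all f n) (f n)

theorem Cmd.WV_all (f : ℕ → Cmd) (n y : ℕ) : (Cmd.all f n).WV y ↔ ∃ i < n, (f i).WV y := by
  induction n with
  | zero => simp [Cmd.all, Cmd.WV]
  | succ n ih => simp only [Cmd.all, Cmd.WV, ih, Nat.lt_succ_iff_lt_or_eq, or_and_right, exists_or, exists_eq_left]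

theorem Cmd.WA_all (f : ℕ → Cmd) (n y : ℕ) : (Cmd.all f n).WA y ↔ ∃ i < n, (f i).WA y := by
  induction n with
  | zero => simp [Cmd.all, Cmd.WA]
  | succ n ih => simp only [Cmd.all, Cmd.WA, ih, Nat.lt_succ_iff_lt_or_eq, or_and_right, exists_or, exists_eq_left]

theorem Cmd.RA_all (f : ℕ → Cmd) (n y : ℕ) : (Cmd.all f n).RA y ↔ ∃ i < n, (f i).RA y := by
  induction n with
  | zero => simp [Cmd.all, Cmd.RA]
  | succ n ih => simp only [Cmd.all, Cmd.RA, ih, Nat.lt_succ_iff_lt_or_eq, or_and_right, exists_or, exists_eq_left]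

theorem Runs.all {w Tb : ℕ} {f : ℕ → Cmd} {s₀ : Store} (I : ℕ → Store → Prop) (n : ℕ) (h0 : I 0 s₀)
    (hb : ∀ i < n, ∀ s, Frame (.all f n) s₀ s → I i s → Runs w (f i) s Tb (I (i + 1))) :
    Runs w (.all f n) s₀ (n * (Tb + 1) + 1) (I n) := by
  suffices h : ∀ r ≤ n, Runs w (.all f r) s₀ (r * (Tb + 1) + 1) (I r) from h n le_rfl
  intro r
  induction r with
  | zero => exact fun _ => Runs.skip (by omega) h0
  | succ r ih =>
    intro hr
    refine Runs.seq _ Tb (Runs.mono (ih (by omega)) le_rfl fun s hf hI => ?_) (by ring_nf; omega)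
    refine hb r (by omega) s (hf.mono ?_ ?_ ?_) hI
    · simp only [Cmd.WV_all]; exact fun x ⟨i, hi, h⟩ => ⟨i, by omega, h⟩
    · simp only [Cmd.WA_all]; exact fun x ⟨i, hi, h⟩ => ⟨i, by omega, h⟩
    · simp only [Cmd.RA_all]; exact fun x ⟨i, hi, h⟩ => ⟨i, by omega, h⟩

end RealRAM


/-! ## Ranks -/

/-- The order by the value of `X`, ties broken by the index. -/
def Prec (X : ℕ → ℝ) (p q : ℕ) : Prop := X p < X q ∨ (X p = X q ∧ p < q)

theorem Prec.irrefl (X : ℕ → ℝ) (p : ℕ) : ¬ Prec X p p := by simp [Prec]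

theorem Prec.trans {X : ℕ → ℝ} {p q r : ℕ} (h : Prec X p q) (h' : Prec X q r) : Prec X p r := by
  rcases h with h | ⟨h, h₁⟩ <;> rcases h' with h' | ⟨h', h₂⟩
  · exact .inl (h.trans h')
  · exact .inl (h' ▸ h)
  · exact .inl (h ▸ h')
  · exact .inr ⟨h.trans h', h₁.trans h₂⟩

theorem Prec.of_ne {X : ℕ → ℝ} {p q : ℕ} (h : p ≠ q) (h' : ¬ Prec X p q) : Prec X q p := by
  simp only [Prec, not_or, not_and, not_lt] at h' ⊢
  rcases h'.1.lt_or_eq with h₁ | h₁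
  · exact .inl h₁
  · exact .inr ⟨h₁, lt_of_le_of_ne (h'.2 h₁.symm) h.symm⟩

theorem Prec.le {X : ℕ → ℝ} {p q : ℕ} (h : Prec X p q) : X p ≤ X q := by
  rcases h with h | h
  exacts [h.le, h.1.le]

open Classical in
/-- The number of elements of `S` that precede `p`. -/
noncomputable def rk (X : ℕ → ℝ) (S : Finset ℕ) (p : ℕ) : ℕ := (S.filter fun q => Prec X q p).card

section Rank

variable {X : ℕ → ℝ} {S : Finset ℕ} {p q : ℕ}

open Classical in
theorem rk_mono (h : Prec X p q) : rk X S p ≤ rk X S q :=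
  Finset.card_le_card fun _ hr => by
    simp only [Finset.mem_filter] at hr ⊢
    exact ⟨hr.1, hr.2.trans h⟩

open Classical in
theorem rk_lt_rk (hp : p ∈ S) (h : Prec X p q) : rk X S p < rk X S q := by
  refine Finset.card_lt_card (Finset.ssubset_iff_subset_ne.2 ⟨fun r hr => ?_, fun he => ?_⟩)
  · simp only [Finset.mem_filter] at hr ⊢
    exact ⟨hr.1, hr.2.trans h⟩
  · have : p ∈ S.filter fun r => Prec X r q := by simp [hp, h]
    rw [← he] at this
    exact Prec.irrefl X p (Finset.mem_filter.1 this).2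

/-- Breaking ties by the index makes `Prec` a strict total order, so repeated points, and points
that share a coordinate, still get different ranks. -/
theorem rk_injOn : Set.InjOn (rk X S) S := by
  intro p hp q hq h
  by_contra hne
  by_cases h' : Prec X p q
  · exact (rk_lt_rk hp h').ne h
  · exact (rk_lt_rk hq (Prec.of_ne hne h')).ne' h

open Classical in
theorem rk_lt_card (hp : p ∈ S) : rk X S p < S.card := by
  refine Finset.card_lt_card (Finset.ssubset_iff_subset_ne.2 ⟨Finset.filter_subset _ _, fun he => ?_⟩)
  rw [← he] at hp
  exact Prec.irrefl X p (Finset.mem_filter.1 hp).2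

open Classical in
theorem rk_le_card : rk X S p ≤ S.card := Finset.card_filter_le _ _

theorem prec_of_rk_lt (h : rk X S p < rk X S q) : Prec X p q := by
  by_contra h'
  by_cases hpq : p = q
  · exact absurd h (by simp [hpq])
  · exact absurd (rk_mono (S := S) (Prec.of_ne hpq h')) (by omega)

theorem le_of_rk_le (hp : p ∈ S) (hq : q ∈ S) (h : rk X S p ≤ rk X S q) : X p ≤ X q := by
  rcases h.lt_or_eq with h | h
  · exact (prec_of_rk_lt h).le
  · rw [rk_injOn hp hq h]

theorem exists_rk_eq {r : ℕ} (hr : r < S.card) : ∃ p ∈ S, rk X S p = r := by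
  have := Finset.surjOn_of_injOn_of_card_le (s := S) (t := Finset.range S.card) (rk X S)
    (fun p hp => by simpa using rk_lt_card hp) rk_injOn (by simp)
  exact this (by simpa using hr)

theorem prec_iff_rk_lt (hp : p ∈ S) : Prec X p q ↔ rk X S p < rk X S q :=
  ⟨rk_lt_rk hp, prec_of_rk_lt⟩

end Rank

/-- The `β`-th block of `2 ^ l` consecutive indices. -/
def block (l β : ℕ) : Finset ℕ := Finset.Ico (β * 2 ^ l) ((β + 1) * 2 ^ l)

theorem mem_block {l β p : ℕ} : p ∈ block l β ↔ p / 2 ^ l = β := by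
  rw [block, Finset.mem_Ico, Nat.div_eq_iff (by positivity)]
  have : 0 < 2 ^ l := by positivity
  constructor
  · rintro ⟨h, h'⟩; exact ⟨h, by rw [add_one_mul] at h'; omega⟩
  · rintro ⟨h, h'⟩; exact ⟨h, by rw [add_one_mul]; omega⟩

theorem card_block (l β : ℕ) : (block l β).card = 2 ^ l := by
  simp [block, add_one_mul]

/-- The position of `p` after every block of length `2 ^ l` has been sorted. -/
noncomputable def sortPos (X : ℕ → ℝ) (l p : ℕ) : ℕ := p / 2 ^ l * 2 ^ l + rk X (block l (p / 2 ^ l)) p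

/-- The index of the block that is merged with block `β`. -/
def sibling (β : ℕ) : ℕ := β + 1 - 2 * (β % 2)

theorem rk_block_lt (X : ℕ → ℝ) (l p : ℕ) : rk X (block l (p / 2 ^ l)) p < 2 ^ l :=
  (rk_lt_card (mem_block.2 rfl)).trans_eq (card_block _ _)

theorem sortPos_div (X : ℕ → ℝ) (l p : ℕ) : sortPos X l p / 2 ^ l = p / 2 ^ l := by
  rw [sortPos, mul_comm, Nat.mul_add_div (by positivity), Nat.div_eq_of_lt (rk_block_lt X l p)]
  rfl

theorem sortPos_mod (X : ℕ → ℝ) (l p : ℕ) : sortPos X l p % 2 ^ l = rk X (block l (p / 2 ^ l)) p := by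
  rw [sortPos, mul_comm, Nat.mul_add_mod, Nat.mod_eq_of_lt (rk_block_lt X l p)]

theorem sortPos_injective (X : ℕ → ℝ) (l : ℕ) : Function.Injective (sortPos X l) := by
  intro p q h
  have h₁ : p / 2 ^ l = q / 2 ^ l := by rw [← sortPos_div X l p, ← sortPos_div X l q, h]
  have h₂ : rk X (block l (p / 2 ^ l)) p = rk X (block l (q / 2 ^ l)) q := by
    rw [← sortPos_mod X l p, ← sortPos_mod X l q, h]
  rw [h₁] at h₂
  exact rk_injOn (mem_block.2 h₁) (mem_block.2 rfl) h₂

theorem sortPos_zero (X : ℕ → ℝ) (p : ℕ) : sortPos X 0 p = p := by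
  have := rk_block_lt X 0 p
  simp [sortPos] at this ⊢; omega

theorem exists_sortPos_eq (X : ℕ → ℝ) (l β : ℕ) {r : ℕ} (hr : r < 2 ^ l) :
    ∃ p ∈ block l β, sortPos X l p = β * 2 ^ l + r ∧ rk X (block l β) p = r := by
  obtain ⟨p, hp, h⟩ := exists_rk_eq (X := X) (S := block l β) (by rwa [card_block])
  exact ⟨p, hp, by rw [sortPos, mem_block.1 hp, h], h⟩

/-- Merge step: the rank in the union of two sibling blocks is the sum of the ranks in the two
blocks. The first is known from the previous round, the second is found by binary search, so every
point can be moved independently of the others. -/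
theorem sortPos_succ (X : ℕ → ℝ) (l p : ℕ) :
    sortPos X (l + 1) p = p / 2 ^ l / 2 * (2 * 2 ^ l) + sortPos X l p % 2 ^ l +
      rk X (block l (sibling (p / 2 ^ l))) p := by
  have hdiv : p / 2 ^ (l + 1) = p / 2 ^ l / 2 := by rw [pow_succ, Nat.div_div_eq_div_mul]
  have hU : block (l + 1) (p / 2 ^ (l + 1)) =
      block l (p / 2 ^ l) ∪ block l (sibling (p / 2 ^ l)) := by
    ext q
    rw [Finset.mem_union, mem_block, mem_block, mem_block, hdiv, pow_succ,
      ← Nat.div_div_eq_div_mul, sibling]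
    generalize p / 2 ^ l = x
    generalize q / 2 ^ l = y
    omega
  have hD : Disjoint (block l (p / 2 ^ l)) (block l (sibling (p / 2 ^ l))) := by
    rw [Finset.disjoint_left]
    intro q h h'
    rw [mem_block] at h h'
    rw [h, sibling] at h'
    omega
  rw [sortPos_mod, sortPos, hU, hdiv, add_assoc, pow_succ, mul_comm (2 ^ l) 2]
  congr 1
  classical
  rw [rk, Finset.filter_union, Finset.card_union_of_disjoint]
  · rfl
  · exact Finset.disjoint_filter_filter hD

theorem sortPos_eq_rk (X : ℕ → ℝ) {L p : ℕ} (hp : p < 2 ^ L) :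
    sortPos X L p = rk X (Finset.range (2 ^ L)) p := by
  have : block L 0 = Finset.range (2 ^ L) := by simp [block]
  simp [sortPos, Nat.div_eq_of_lt hp, this]

theorem sortPos_lt (X : ℕ → ℝ) {l L p : ℕ} (hl : l ≤ L) (hp : p < 2 ^ L) : sortPos X l p < 2 ^ L := by
  obtain ⟨e, rfl⟩ := Nat.exists_eq_add_of_le hl
  have h : p / 2 ^ l < 2 ^ e := by
    rw [Nat.div_lt_iff_lt_mul (by positivity), ← pow_add, add_comm]; exact hp
  calc sortPos X l p < p / 2 ^ l * 2 ^ l + 2 ^ l := by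
        rw [sortPos]; exact Nat.add_lt_add_left (rk_block_lt X l p) _
    _ = (p / 2 ^ l + 1) * 2 ^ l := by ring
    _ ≤ 2 ^ e * 2 ^ l := Nat.mul_le_mul_right _ h
    _ = 2 ^ (l + e) := by rw [← pow_add, add_comm]

theorem sibling_lt {l L p : ℕ} (hl : l < L) (hp : p < 2 ^ L) : sibling (p / 2 ^ l) < 2 ^ (L - l) := by
  obtain ⟨e, rfl⟩ := Nat.exists_eq_add_of_lt hl
  have h : p / 2 ^ l < 2 ^ (e + 1) := by
    rw [Nat.div_lt_iff_lt_mul (by positivity), ← pow_add]; convert hp using 2; omega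
  rw [show l + e + 1 - l = e + 1 by omega]
  rw [pow_succ] at h ⊢
  rw [sibling]
  generalize p / 2 ^ l = x at *
  omega

/-! ## Digits and keys -/

/-- The `t`-th digit of `v` in base `B`. -/
def digit (B v t : ℕ) : ℕ := v / B ^ t % B

theorem exists_digits (B d : ℕ) (f : ℕ → ℕ) (hf : ∀ t < d, f t < B) :
    ∃ v < B ^ d, ∀ t < d, digit B v t = f t := by
  induction d generalizing f with
  | zero => exact ⟨0, by simp, by simp⟩
  | succ d ih =>
    obtain ⟨v, hv, h⟩ := ih (fun t => f (t + 1)) fun t ht => hf _ (by omega)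
    have h0 := hf 0 (by omega)
    refine ⟨f 0 + B * v, ?_, ?_⟩
    · calc f 0 + B * v < B + B * v := by omega
        _ = B * (v + 1) := by ring
        _ ≤ B * B ^ d := Nat.mul_le_mul_left _ hv
        _ = B ^ (d + 1) := by ring
    · rintro (_ | t) ht
      · simp [digit, Nat.mod_eq_of_lt h0]
      · rw [← h t (by omega), digit, digit, pow_succ', ← Nat.div_div_eq_div_mul, Nat.add_mul_div_left _ _ (by omega),
          Nat.div_eq_of_lt h0, zero_add]

/-- Code of the cell of `p` at the levels `lam`, restricted to the first `t` coordinates. -/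
def cellKey (rank : ℕ → ℕ → ℕ) (Lam m lam p : ℕ) : ℕ → ℕ
  | 0 => lam
  | t + 1 => cellKey rank Lam m lam p t * m + rank t p / 2 ^ digit Lam lam t

section Key

variable {rank : ℕ → ℕ → ℕ} {Lam m lam lam' p p' : ℕ}

theorem cellKey_lt {D d : ℕ} (hr : ∀ t < d, rank t p < m) (hl : lam < D) :
    cellKey rank Lam m lam p d < D * m ^ d := by
  induction d with
  | zero => simpa [cellKey] using hl
  | succ d ih =>
    have h := ih fun t ht => hr t (by omega)
    have h' : rank d p / 2 ^ digit Lam lam d < m := (Nat.div_le_self _ _).trans_lt (hr d (by omega))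
    calc cellKey rank Lam m lam p (d + 1) < cellKey rank Lam m lam p d * m + m := by
          rw [cellKey]; omega
      _ = (cellKey rank Lam m lam p d + 1) * m := by ring
      _ ≤ D * m ^ d * m := Nat.mul_le_mul_right _ h
      _ = D * m ^ (d + 1) := by ring

theorem cellKey_succ_div {t : ℕ} (hr : rank t p < m) :
    cellKey rank Lam m lam p (t + 1) / m = cellKey rank Lam m lam p t := by
  have h' : rank t p / 2 ^ digit Lam lam t < m := (Nat.div_le_self _ _).trans_lt hr
  rw [cellKey, mul_comm, Nat.mul_add_div (by omega), Nat.div_eq_of_lt h', add_zero]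

theorem cellKey_succ_mod {t : ℕ} (hr : rank t p < m) :
    cellKey rank Lam m lam p (t + 1) % m = rank t p / 2 ^ digit Lam lam t := by
  have h' : rank t p / 2 ^ digit Lam lam t < m := (Nat.div_le_self _ _).trans_lt hr
  rw [cellKey, mul_comm, Nat.mul_add_mod, Nat.mod_eq_of_lt h']

/-- The key is a number in base `m` whose leading part is the tuple of levels. All interval indices
are below `m`, so the digits can be recovered one by one. -/
theorem eq_of_cellKey_eq {d : ℕ} (hr : ∀ t < d, rank t p < m) (hr' : ∀ t < d, rank t p' < m)
    (h : cellKey rank Lam m lam p d = cellKey rank Lam m lam' p' d) :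
    lam = lam' ∧ ∀ t < d, rank t p / 2 ^ digit Lam lam t = rank t p' / 2 ^ digit Lam lam t := by
  induction d with
  | zero => exact ⟨h, by simp⟩
  | succ d ih =>
    have h₁ := congrArg (· / m) h
    have h₂ := congrArg (· % m) h
    simp only [cellKey_succ_div (hr d (by omega)), cellKey_succ_div (hr' d (by omega))] at h₁
    simp only [cellKey_succ_mod (hr d (by omega)), cellKey_succ_mod (hr' d (by omega))] at h₂
    obtain ⟨rfl, h₃⟩ := ih (fun t ht => hr t (by omega)) (fun t ht => hr' t (by omega)) h₁
    refine ⟨rfl, fun t ht => ?_⟩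
    rcases Nat.lt_succ_iff_lt_or_eq.1 ht with ht | rfl
    exacts [h₃ t ht, h₂]

theorem cellKey_congr {d : ℕ}
    (h : ∀ t < d, rank t p / 2 ^ digit Lam lam t = rank t p' / 2 ^ digit Lam lam t) :
    cellKey rank Lam m lam p d = cellKey rank Lam m lam p' d := by
  induction d with
  | zero => rfl
  | succ d ih => rw [cellKey, cellKey, ih fun t ht => h t (by omega), h d (by omega)]

end Key

/-- The middle of the dyadic interval of length `2 ^ l` that contains `u`. -/
def mid (l u : ℕ) : ℕ := (u / 2 ^ l * 2 + 1) * 2 ^ l / 2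

/-- Take the shortest dyadic interval that contains both numbers. One level below they lie in its
two different halves, so the middle separates them. -/
theorem exists_level {u v L : ℕ} (h : u < v) (hv : v < 2 ^ L) :
    ∃ l ≤ L, u / 2 ^ l = v / 2 ^ l ∧ u < mid l u ∧ mid l u ≤ v := by
  classical
  have hex : ∃ l, u / 2 ^ l = v / 2 ^ l :=
    ⟨L, by rw [Nat.div_eq_of_lt hv, Nat.div_eq_of_lt (h.trans hv)]⟩
  have hs := Nat.find_spec hex
  have hL : Nat.find hex ≤ L :=
    Nat.find_min' hex (by rw [Nat.div_eq_of_lt hv, Nat.div_eq_of_lt (h.trans hv)])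
  rcases hn : Nat.find hex with _ | l
  -- At level `0` the intervals are single numbers, which is impossible since `u < v`.
  · rw [hn] at hs; simp at hs; omega
  · have hm := Nat.find_min hex (m := l) (by omega)
    rw [hn] at hs hL
    refine ⟨l + 1, hL, hs, ?_⟩
    have hmid : mid (l + 1) u = (u / 2 ^ (l + 1) * 2 + 1) * 2 ^ l := by
      rw [mid, pow_succ, ← mul_assoc, Nat.mul_div_cancel _ (by norm_num)]
    have hle : u / 2 ^ l ≤ v / 2 ^ l := Nat.div_le_div_right h.le
    rw [pow_succ, ← Nat.div_div_eq_div_mul, ← Nat.div_div_eq_div_mul] at hs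
    have hu : u / 2 ^ l = u / 2 ^ l / 2 * 2 := by omega
    -- The quotients at level `l` differ but have the same half, so they are consecutive with the
    -- even one first.
    have hv' : v / 2 ^ l = u / 2 ^ l / 2 * 2 + 1 := by omega
    rw [hmid, pow_succ, ← Nat.div_div_eq_div_mul]
    constructor
    · rw [← Nat.div_lt_iff_lt_mul (by positivity)]; omega
    · rw [← Nat.le_div_iff_mul_le (by positivity)]; omega


/-! ## Greedy hitting sets -/

section Greedy

variable {ι : Type*} (F : Finset ι) (pts : ι → Finset ℕ)

open Classical in
/-- The members of the family that contain `p` and are not hit by `R`. -/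
noncomputable def cov (R : Finset ℕ) (p : ℕ) : ℕ :=
  (F.filter fun f => p ∈ pts f ∧ Disjoint (pts f) R).card

open Classical in
/-- The members of the family that are not hit by `R`. -/
noncomputable def unhit (R : Finset ℕ) : ℕ := (F.filter fun f => Disjoint (pts f) R).card

open Classical in
/-- One pass over the points `0, …, p - 1`: every point in at least `θ` sets not hit yet is taken. -/
noncomputable def coverPass (θ : ℕ) (R : Finset ℕ) : ℕ → Finset ℕ
  | 0 => R
  | p + 1 => if θ ≤ cov F pts (coverPass θ R p) p then insert p (coverPass θ R p) else coverPass θ R p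

/-- The points taken in `i` passes over `m` points with thresholds `2 ^ I, 2 ^ (I - 1), …`. -/
noncomputable def greedy (m I : ℕ) : ℕ → Finset ℕ
  | 0 => ∅
  | i + 1 => coverPass F pts (2 ^ (I - i)) (greedy m I i) m

variable {F pts}

theorem cov_anti {R R' : Finset ℕ} (h : R ⊆ R') (p : ℕ) : cov F pts R' p ≤ cov F pts R p := by
  classical
  refine Finset.card_le_card fun f hf => ?_
  simp only [Finset.mem_filter] at hf ⊢
  exact ⟨hf.1, hf.2.1, hf.2.2.mono_right h⟩

theorem cov_of_mem {R : Finset ℕ} {p : ℕ} (h : p ∈ R) : cov F pts R p = 0 := by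
  classical
  rw [cov, Finset.card_eq_zero, Finset.filter_eq_empty_iff]
  rintro f - ⟨h₁, h₂⟩
  exact Finset.disjoint_left.1 h₂ h₁ h

theorem unhit_insert (R : Finset ℕ) (p : ℕ) :
    unhit F pts (insert p R) + cov F pts R p = unhit F pts R := by
  classical
  rw [unhit, cov, unhit, ← Finset.card_union_of_disjoint]
  · congr 1
    ext f
    simp only [Finset.mem_union, Finset.mem_filter, Finset.disjoint_insert_right]
    tauto
  · rw [Finset.disjoint_left]
    intro f hf hf'
    simp only [Finset.mem_filter, Finset.disjoint_insert_right] at hf hf'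
    exact hf.2.1 hf'.2.1

/-- Potential argument: a point that is taken costs `θ` and removes at least `θ` sets from those not
hit. -/
theorem card_pass_le (θ : ℕ) (R : Finset ℕ) (p : ℕ) :
    θ * (coverPass F pts θ R p).card + unhit F pts (coverPass F pts θ R p) ≤ θ * R.card + unhit F pts R := by
  induction p with
  | zero => rfl
  | succ p ih =>
    rw [coverPass]
    split_ifs with h
    · have h₁ := unhit_insert (F := F) (pts := pts) (coverPass F pts θ R p) p
      have h₂ := Finset.card_insert_le p (coverPass F pts θ R p)
      have h₃ := Nat.mul_le_mul_left θ h₂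
      rw [mul_add_one] at h₃
      omega
    · exact ih

/-- One pass suffices because coverage only decreases: a rejected point was already below `θ` when
it was visited, and a taken point has coverage `0`. -/
theorem cov_pass_lt {θ : ℕ} (hθ : 0 < θ) (R : Finset ℕ) {p q : ℕ} (hq : q < p) :
    cov F pts (coverPass F pts θ R p) q < θ := by
  induction p with
  | zero => omega
  | succ p ih =>
    rcases Nat.lt_succ_iff_lt_or_eq.1 hq with hq | rfl
    · refine lt_of_le_of_lt (cov_anti ?_ q) (ih hq)
      rw [coverPass]
      split_ifs
      exacts [Finset.subset_insert _ _, le_rfl]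
    · rw [coverPass]
      split_ifs with h
      · rwa [cov_of_mem (Finset.mem_insert_self _ _)]
      · omega

/-- Count the incidences between points and sets not hit: at least `h` for every set, at most `θ`
for every point. -/
theorem mul_unhit_le {m h θ : ℕ} {R : Finset ℕ} (hF : ∀ f ∈ F, pts f ⊆ Finset.range m ∧ h ≤ (pts f).card)
    (hc : ∀ p < m, cov F pts R p ≤ θ) : h * unhit F pts R ≤ m * θ := by
  classical
  calc h * unhit F pts R = ∑ f ∈ F.filter (fun f => Disjoint (pts f) R), h := by
        rw [Finset.sum_const, smul_eq_mul, mul_comm, unhit]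
    _ ≤ ∑ f ∈ F.filter (fun f => Disjoint (pts f) R),
          ∑ p ∈ Finset.range m, if p ∈ pts f then 1 else 0 := by
        refine Finset.sum_le_sum fun f hf => ?_
        obtain ⟨h₁, h₂⟩ := hF f (Finset.mem_filter.1 hf).1
        rw [← Finset.card_filter, Finset.filter_mem_eq_inter, Finset.inter_eq_right.2 h₁]
        exact h₂
    _ = ∑ p ∈ Finset.range m, cov F pts R p := by
        rw [Finset.sum_comm]
        refine Finset.sum_congr rfl fun p _ => ?_
        rw [← Finset.card_filter, Finset.filter_filter, cov]
        simp only [and_comm]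
    _ ≤ ∑ p ∈ Finset.range m, θ := Finset.sum_le_sum fun p hp => hc p (Finset.mem_range.1 hp)
    _ = m * θ := by simp

/-- A pass with threshold `θ` starts with at most `2 * m * θ / h` sets not hit, so it takes at most
`2 * m / h` points. It ends with at most `m * θ / h` such sets, which is the starting condition for
the threshold `θ / 2`. -/
theorem greedy_bounds {m h I : ℕ} (hF : ∀ f ∈ F, pts f ⊆ Finset.range m ∧ h ≤ (pts f).card)
    (hI : h * F.card ≤ m * 2 ^ (I + 1)) {i : ℕ} (hi : i ≤ I + 1) :
    h * unhit F pts (greedy F pts m I i) ≤ m * 2 ^ (I + 1 - i) ∧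
      h * (greedy F pts m I i).card ≤ 2 * m * i := by
  induction i with
  | zero =>
    refine ⟨le_trans (Nat.mul_le_mul_left _ ?_) hI, by simp [greedy]⟩
    exact Finset.card_le_card (Finset.filter_subset _ _)
  | succ i ih =>
    obtain ⟨h₁, h₂⟩ := ih (by omega)
    have hpos : 0 < 2 ^ (I - i) := by positivity
    refine ⟨?_, ?_⟩
    · rw [show I + 1 - (i + 1) = I - i by omega]
      exact mul_unhit_le hF fun p hp => (cov_pass_lt hpos _ hp).le
    · have h₃ := card_pass_le (F := F) (pts := pts) (2 ^ (I - i)) (greedy F pts m I i) m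
      have h₄ : 2 ^ (I + 1 - i) = 2 * 2 ^ (I - i) := by
        rw [show I + 1 - i = I - i + 1 by omega, pow_succ, mul_comm]
      rw [h₄] at h₁
      refine Nat.le_of_mul_le_mul_left ?_ hpos
      rw [greedy]
      calc 2 ^ (I - i) * (h * (coverPass F pts (2 ^ (I - i)) (greedy F pts m I i) m).card)
          = h * (2 ^ (I - i) * (coverPass F pts (2 ^ (I - i)) (greedy F pts m I i) m).card) := by ring
        _ ≤ h * (2 ^ (I - i) * (greedy F pts m I i).card + unhit F pts (greedy F pts m I i)) :=
            Nat.mul_le_mul_left _ (by omega)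
        _ = 2 ^ (I - i) * (h * (greedy F pts m I i).card) +
              h * unhit F pts (greedy F pts m I i) := by ring
        _ ≤ 2 ^ (I - i) * (2 * m * i) + m * (2 * 2 ^ (I - i)) :=
            Nat.add_le_add (Nat.mul_le_mul_left _ h₂) h₁
        _ = 2 ^ (I - i) * (2 * m * (i + 1)) := by ring

/-- The last threshold is `1`, so afterwards no point lies in a set that is not hit; sets with `h >
0` points must then all be hit. -/
theorem greedy_hits {m h I : ℕ} (hF : ∀ f ∈ F, pts f ⊆ Finset.range m ∧ h ≤ (pts f).card) (hh : 0 < h)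
    {f : ι} (hf : f ∈ F) : ∃ p ∈ greedy F pts m I (I + 1), p ∈ pts f := by
  classical
  have h₁ : h * unhit F pts (greedy F pts m I (I + 1)) ≤ m * 0 :=
    mul_unhit_le hF fun p hp => by
      have := cov_pass_lt (F := F) (pts := pts) (θ := 2 ^ (I - I)) (by simp) (greedy F pts m I I) hp
      rw [greedy]
      simp at this ⊢
      omega
  have h₂ : unhit F pts (greedy F pts m I (I + 1)) = 0 := by
    rcases mul_eq_zero.1 (Nat.le_zero.1 h₁) with h | h <;> omega
  rw [unhit, Finset.card_eq_zero, Finset.filter_eq_empty_iff] at h₂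
  have h₃ := h₂ hf
  rw [Finset.not_disjoint_iff] at h₃
  obtain ⟨p, hp, hp'⟩ := h₃
  exact ⟨p, hp', hp⟩

end Greedy


/-! ## Cells and the family of boxes -/

section Cells

variable (rank : ℕ → ℕ → ℕ) (Lam m D d T0 h : ℕ) (M : ℕ → ℕ → ℕ)

/-- Code of the cell to which the `z`-th incidence belongs: incidence `z` is the one of the point
`z / D` with the tuple of levels `z % D`. -/
def incKey (z : ℕ) : ℕ := cellKey rank Lam m (z % D) (z / D) d

/-- The number of the first `Z` incidences that belong to the cell `κ`. -/
def cellCount (Z κ : ℕ) : ℕ := Nat.count (fun z => incKey rank Lam m D d z = κ) Z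

/-- The points of the cell `κ`. -/
def cellSet (κ : ℕ) : Finset ℕ :=
  ((Finset.range (m * D)).filter fun z => incKey rank Lam m D d z = κ).image (· / D)

/-- `M κ` lists the points of the cell `κ`. -/
def CellLists : Prop :=
  ∀ z < m * D, M (incKey rank Lam m D d z) (cellCount rank Lam m D d z (incKey rank Lam m D d z)) = z / D

/-- The point `q` is between the points of `M κ` whose positions are the digits of `τ`. -/
def InBox (κ τ q : ℕ) : Prop :=
  ∀ t < d, rank t (M κ (digit T0 τ (2 * t))) ≤ rank t q ∧ rank t q ≤ rank t (M κ (digit T0 τ (2 * t + 1)))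

open Classical in
/-- The points of the cell `f.1` in the box with code `f.2`. -/
noncomputable def boxPts (f : ℕ × ℕ) : Finset ℕ :=
  (cellSet rank Lam m D d f.1).filter fun q => InBox rank d T0 M f.1 f.2 q

/-- The cell `κ` has at most `T0` points, and at least `h` of them are in the box with code `τ`. -/
def Valid (κ τ : ℕ) : Prop :=
  cellCount rank Lam m D d (m * D) κ ≤ T0 ∧ h ≤ (boxPts rank Lam m D d T0 M (κ, τ)).card

open Classical in
/-- The family of boxes that the greedy algorithm hits. -/
noncomputable def family : Finset (ℕ × ℕ) :=
  (Finset.range (D * m ^ d) ×ˢ Finset.range (T0 ^ (2 * d))).filter fun f =>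
    Valid rank Lam m D d T0 h M f.1 f.2

variable {rank Lam m D d T0 h M} (hr : ∀ t < d, ∀ p < m, rank t p < m)

theorem div_lt_of_lt_mul' {z m D : ℕ} (hz : z < m * D) : z / D < m :=
  Nat.div_lt_of_lt_mul (by rwa [mul_comm])

theorem mod_lt_of_lt_mul {z m D : ℕ} (hz : z < m * D) : z % D < D :=
  Nat.mod_lt _ (Nat.pos_of_ne_zero (by rintro rfl; simp at hz))

theorem incKey_add {lam p : ℕ} (hl : lam < D) :
    incKey rank Lam m D d (lam + D * p) = cellKey rank Lam m lam p d := by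
  rw [incKey, Nat.add_mul_mod_self_left, Nat.mod_eq_of_lt hl, Nat.add_mul_div_left _ _ (by omega),
    Nat.div_eq_of_lt hl, zero_add]

theorem add_mul_lt {lam D p m : ℕ} (hl : lam < D) (hp : p < m) : lam + D * p < m * D := by
  calc lam + D * p < D + D * p := by omega
    _ = D * (p + 1) := by ring
    _ ≤ D * m := Nat.mul_le_mul_left _ hp
    _ = m * D := mul_comm _ _

theorem mem_cellSet {κ p : ℕ} : p ∈ cellSet rank Lam m D d κ ↔
    p < m ∧ ∃ lam < D, cellKey rank Lam m lam p d = κ := by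
  simp only [cellSet, Finset.mem_image, Finset.mem_filter, Finset.mem_range]
  constructor
  · rintro ⟨z, ⟨hz, rfl⟩, rfl⟩
    exact ⟨div_lt_of_lt_mul' hz, z % D, mod_lt_of_lt_mul hz, rfl⟩
  · rintro ⟨hp, lam, hl, rfl⟩
    refine ⟨lam + D * p, ⟨add_mul_lt hl hp, incKey_add hl⟩, ?_⟩
    rw [Nat.add_mul_div_left _ _ (by omega), Nat.div_eq_of_lt hl, zero_add]

include hr

theorem incKey_lt {z : ℕ} (hz : z < m * D) : incKey rank Lam m D d z < D * m ^ d :=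
  cellKey_lt (fun t ht => hr t ht _ (div_lt_of_lt_mul' hz)) (mod_lt_of_lt_mul hz)

/-- The key contains the tuple of levels, so a point enters a given cell through one incidence only.
-/
theorem div_injOn_incKey (κ : ℕ) :
    Set.InjOn (· / D) ((Finset.range (m * D)).filter fun z => incKey rank Lam m D d z = κ : Set ℕ) := by
  intro z hz z' hz' h
  simp only [Finset.coe_filter, Finset.mem_range, Set.mem_ofPred_eq] at hz hz' h
  have := (eq_of_cellKey_eq (fun t ht => hr t ht _ (div_lt_of_lt_mul' hz.1))
    (fun t ht => hr t ht _ (div_lt_of_lt_mul' hz'.1)) (hz.2.trans hz'.2.symm)).1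
  rw [← Nat.div_add_mod z D, ← Nat.div_add_mod z' D, h, this]

/-- This is how counting along the list stored by the machine becomes counting over a finite set:
the list contains every point of the cell exactly once. -/
theorem sum_cell (hM : CellLists rank Lam m D d M) (κ : ℕ) (f : ℕ → ℕ) :
    ∑ i ∈ Finset.range (cellCount rank Lam m D d (m * D) κ), f (M κ i) =
      ∑ p ∈ cellSet rank Lam m D d κ, f p := by
  rw [cellSet, Finset.sum_image (div_injOn_incKey hr κ)]
  suffices h : ∀ Z ≤ m * D, ∑ i ∈ Finset.range (cellCount rank Lam m D d Z κ), f (M κ i) =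
      ∑ z ∈ Finset.range Z with incKey rank Lam m D d z = κ, f (z / D) from h _ le_rfl
  intro Z
  induction Z with
  | zero => simp [cellCount]
  | succ Z ih =>
    intro hZ
    rw [Finset.range_add_one, Finset.filter_insert, cellCount, Nat.count_succ]
    split_ifs with hκ
    · rw [Finset.sum_range_succ, Finset.sum_insert (by simp), add_comm]
      congr 1
      · have := hM Z (by omega)
        rw [hκ] at this
        rw [← this]; rfl
      · exact ih (by omega)
    · exact ih (by omega)

theorem card_cellSet (κ : ℕ) :
    (cellSet rank Lam m D d κ).card = cellCount rank Lam m D d (m * D) κ := by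
  rw [cellSet, Finset.card_image_of_injOn (div_injOn_incKey hr κ), cellCount, Nat.count_eq_card_filter_range]

theorem sum_cellCount {Z : ℕ} (hZ : Z ≤ m * D) :
    ∑ κ ∈ Finset.range (D * m ^ d), cellCount rank Lam m D d Z κ = Z := by
  conv_rhs => rw [← Finset.card_range Z]
  rw [Finset.card_eq_sum_card_fiberwise (f := incKey rank Lam m D d) (t := Finset.range (D * m ^ d))]
  · exact Finset.sum_congr rfl fun κ _ => by rw [cellCount, Nat.count_eq_card_filter_range]
  · intro z hz
    simp only [Finset.coe_range, Set.mem_Iio] at hz ⊢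
    exact incKey_lt hr (by omega)

/-- Markov's inequality for the incidences. It bounds the number of centres (threshold `T0 + 1`) as
well as the number of cells that contribute to the family (threshold `h`). -/
theorem card_heavy_mul_le (T : ℕ) {Z : ℕ} (hZ : Z ≤ m * D) :
    T * ((Finset.range (D * m ^ d)).filter fun κ => T ≤ cellCount rank Lam m D d Z κ).card ≤ Z := by
  calc _ = ∑ κ ∈ Finset.range (D * m ^ d) with T ≤ cellCount rank Lam m D d Z κ, T := by
        rw [Finset.sum_const, smul_eq_mul, mul_comm]
    _ ≤ ∑ κ ∈ Finset.range (D * m ^ d) with T ≤ cellCount rank Lam m D d Z κ,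
          cellCount rank Lam m D d Z κ :=
        Finset.sum_le_sum fun κ hκ => (Finset.mem_filter.1 hκ).2
    _ ≤ ∑ κ ∈ Finset.range (D * m ^ d), cellCount rank Lam m D d Z κ :=
        Finset.sum_le_sum_of_subset (Finset.filter_subset _ _)
    _ = Z := sum_cellCount hr hZ

/-- A cell with a box in the family has at least `h` points, so there are at most `m * D / h` such
cells, and each has `T0 ^ (2 * d)` codes. -/
theorem card_family_mul_le :
    h * (family rank Lam m D d T0 h M).card ≤ m * (D * T0 ^ (2 * d)) := by
  classical
  have hs : family rank Lam m D d T0 h M ⊆ ((Finset.range (D * m ^ d)).filter fun κ =>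
      h ≤ cellCount rank Lam m D d (m * D) κ) ×ˢ Finset.range (T0 ^ (2 * d)) := by
    intro f hf
    rw [family, Finset.mem_filter, Finset.mem_product] at hf
    rw [Finset.mem_product, Finset.mem_filter]
    refine ⟨⟨hf.1.1, hf.2.2.trans ?_⟩, hf.1.2⟩
    rw [← card_cellSet hr]
    exact Finset.card_le_card (Finset.filter_subset _ _)
  calc _ ≤ h * (((Finset.range (D * m ^ d)).filter fun κ =>
          h ≤ cellCount rank Lam m D d (m * D) κ).card * T0 ^ (2 * d)) := by
        refine Nat.mul_le_mul_left _ ((Finset.card_le_card hs).trans ?_)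
        rw [Finset.card_product, Finset.card_range]
    _ ≤ m * D * T0 ^ (2 * d) := by
        rw [← mul_assoc]; exact Nat.mul_le_mul_right _ (card_heavy_mul_le hr h le_rfl)
    _ = _ := by ring

-- Since `p` is in exactly one cell for each tuple of levels, the boxes around `p` are indexed by a
-- tuple and a code. Both are packed into one number `y`, which a single loop can enumerate.
open Classical in
theorem cov_family {R : Finset ℕ} {p : ℕ} (hp : p < m) :
    cov (family rank Lam m D d T0 h M) (boxPts rank Lam m D d T0 M) R p =
      ∑ y ∈ Finset.range (D * T0 ^ (2 * d)),
        if Valid rank Lam m D d T0 h M (cellKey rank Lam m (y % D) p d) (y / D) ∧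
          InBox rank d T0 M (cellKey rank Lam m (y % D) p d) (y / D) p ∧
          Disjoint (boxPts rank Lam m D d T0 M (cellKey rank Lam m (y % D) p d, y / D)) R
        then 1 else 0 := by
  rw [← Finset.card_filter, cov]
  symm
  refine Finset.card_nbij (fun y => (cellKey rank Lam m (y % D) p d, y / D)) ?_ ?_ ?_
  · intro y hy
    simp only [Finset.mem_coe, Finset.mem_filter, Finset.mem_range] at hy
    obtain ⟨hy, h₁, h₂, h₃⟩ := hy
    rw [mul_comm] at hy
    simp only [family, Finset.mem_coe, Finset.mem_filter, Finset.mem_product, Finset.mem_range, boxPts]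
    refine ⟨⟨⟨cellKey_lt (fun t ht => hr t ht p hp) (mod_lt_of_lt_mul hy), div_lt_of_lt_mul' hy⟩, h₁⟩,
      ⟨mem_cellSet.2 ⟨hp, y % D, mod_lt_of_lt_mul hy, rfl⟩, h₂⟩, h₃⟩
  · intro y hy y' hy' hyy
    simp only [Prod.mk.injEq] at hyy
    have := (eq_of_cellKey_eq (fun t ht => hr t ht p hp) (fun t ht => hr t ht p hp) hyy.1).1
    rw [← Nat.div_add_mod y D, ← Nat.div_add_mod y' D, hyy.2, this]
  · rintro ⟨κ, τ⟩ hf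
    simp only [family, Finset.mem_coe, Finset.mem_filter, Finset.mem_product, Finset.mem_range, boxPts,
      mem_cellSet] at hf
    obtain ⟨⟨⟨-, hτ⟩, hv⟩, ⟨⟨-, lam, hl, rfl⟩, hb⟩, hd⟩ := hf
    refine ⟨lam + D * τ, ?_, ?_⟩
    all_goals simp only [Finset.mem_coe, Finset.mem_filter, Finset.mem_range,
      Nat.add_mul_mod_self_left, Nat.mod_eq_of_lt hl, Nat.add_mul_div_left _ _ (Nat.zero_lt_of_lt hl),
      Nat.div_eq_of_lt hl, zero_add]
    exact ⟨(add_mul_lt hl hτ).trans_eq (mul_comm _ _), hv, hb, hd⟩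

omit hr in
open Classical in
theorem boxPts_subset {f : ℕ × ℕ} : boxPts rank Lam m D d T0 M f ⊆ Finset.range m := by
  intro q hq
  exact Finset.mem_range.2 (mem_cellSet.1 (Finset.mem_filter.1 hq).1).1

omit hr in
open Classical in
theorem family_spec : ∀ f ∈ family rank Lam m D d T0 h M,
    boxPts rank Lam m D d T0 M f ⊆ Finset.range m ∧ h ≤ (boxPts rank Lam m D d T0 M f).card :=
  fun _ hf => ⟨boxPts_subset, (Finset.mem_filter.1 hf).2.2⟩

theorem exists_index_of_mem_cellSet (hM : CellLists rank Lam m D d M) {κ p : ℕ}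
    (hp : p ∈ cellSet rank Lam m D d κ) :
    ∃ i < cellCount rank Lam m D d (m * D) κ, M κ i = p := by
  by_contra! hc
  have h₁ := sum_cell hr hM κ fun q => if q = p then 1 else 0
  rw [Finset.sum_ite_eq' , if_pos hp, Finset.sum_eq_zero] at h₁
  · simp at h₁
  · intro i hi
    rw [if_neg (hc i (Finset.mem_range.1 hi))]

end Cells

/-- If `R` hits the whole family, then a box with at least `h` of the points contains a point of `R`, or
it lies around the centre of a cell with more than `T0` points. -/
theorem exists_center_or_hit {X : ℕ → ℕ → ℝ} {rank srt : ℕ → ℕ → ℕ} {L Lam m d T0 h : ℕ}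
    {M : ℕ → ℕ → ℕ} {R : Finset ℕ} {a b : ℕ → ℝ} (hm : m = 2 ^ L) (hLam : L < Lam) (hh : 2 ≤ h)
    (hrank : ∀ t < d, ∀ p < m, rank t p = rk (X t) (Finset.range m) p)
    (hsrt : ∀ t < d, ∀ p < m, srt t (rank t p) = p)
    (hM : CellLists rank Lam m (Lam ^ d) d M)
    (hR : ∀ f ∈ family rank Lam m (Lam ^ d) d T0 h M, ∃ p ∈ R, p ∈ boxPts rank Lam m (Lam ^ d) d T0 M f)
    (S : Finset ℕ) (hS : S ⊆ Finset.range m)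
    (hSab : ∀ p ∈ S, ∀ t < d, a t ≤ X t p ∧ X t p ≤ b t) (hcard : h ≤ S.card) :
    (∃ κ < Lam ^ d * m ^ d, T0 < cellCount rank Lam m (Lam ^ d) d (m * Lam ^ d) κ ∧
      ∀ z < m * Lam ^ d, incKey rank Lam m (Lam ^ d) d z = κ →
        ∀ t < d, a t ≤ X t (srt t (mid (digit Lam (z % Lam ^ d) t) (rank t (z / Lam ^ d)))) ∧
          X t (srt t (mid (digit Lam (z % Lam ^ d) t) (rank t (z / Lam ^ d)))) ≤ b t) ∨
    ∃ p ∈ R, ∀ t < d, a t ≤ X t p ∧ X t p ≤ b t := by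
  classical
  have hr : ∀ t < d, ∀ p < m, rank t p < m := fun t ht p hp => by
    rw [hrank t ht p hp]
    exact (rk_lt_card (Finset.mem_range.2 hp)).trans_eq (Finset.card_range m)
  have hSm : ∀ p ∈ S, p < m := fun p hp => Finset.mem_range.1 (hS hp)
  have hne : S.Nonempty := Finset.card_pos.1 (by omega)
  choose lo hlo hlo' using fun t => Finset.exists_min_image S (rank t) hne
  choose hi hhi hhi' using fun t => Finset.exists_max_image S (rank t) hne
  have hbetween : ∀ t < d, ∀ p < m, rank t (lo t) ≤ rank t p → rank t p ≤ rank t (hi t) →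
      a t ≤ X t p ∧ X t p ≤ b t := by
    intro t ht p hp h₁ h₂
    rw [hrank t ht p hp, hrank t ht _ (hSm _ (hlo t))] at h₁
    rw [hrank t ht p hp, hrank t ht _ (hSm _ (hhi t))] at h₂
    exact ⟨(hSab _ (hlo t) t ht).1.trans (le_of_rk_le (hS (hlo t)) (Finset.mem_range.2 hp) h₁),
      (le_of_rk_le (Finset.mem_range.2 hp) (hS (hhi t)) h₂).trans (hSab _ (hhi t) t ht).2⟩
  -- This needs `2 ≤ h`: with one point only, the dyadic interval would have no middle that
  -- separates.
  have hlt : ∀ t < d, rank t (lo t) < rank t (hi t) := by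
    intro t ht
    obtain ⟨p, hp, q, hq, hpq⟩ := Finset.one_lt_card.1 (show 1 < S.card by omega)
    have hne : rank t p ≠ rank t q := by
      rw [hrank t ht p (hSm p hp), hrank t ht q (hSm q hq)]
      exact fun he => hpq (rk_injOn (hS hp) (hS hq) he)
    have := hlo' t p hp
    have := hlo' t q hq
    have := hhi' t p hp
    have := hhi' t q hq
    omega
  have hlev : ∀ t, ∃ l, t < d → l ≤ L ∧ rank t (lo t) / 2 ^ l = rank t (hi t) / 2 ^ l ∧
      rank t (lo t) < mid l (rank t (lo t)) ∧ mid l (rank t (lo t)) ≤ rank t (hi t) := by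
    intro t
    by_cases ht : t < d
    · obtain ⟨l, hl⟩ := exists_level (L := L) (hlt t ht) (hm ▸ hr t ht _ (hSm _ (hhi t)))
      exact ⟨l, fun _ => hl⟩
    · exact ⟨0, fun h' => absurd h' ht⟩
  choose l hl using hlev
  -- The levels are at most `L < Lam`, so they are the digits of one tuple.
  obtain ⟨lam, hlam, hdig⟩ := exists_digits Lam d l fun t ht => lt_of_le_of_lt (hl t ht).1 hLam
  have hquot : ∀ t < d, ∀ p ∈ S, rank t p / 2 ^ l t = rank t (lo t) / 2 ^ l t := by
    intro t ht p hp
    refine le_antisymm ?_ (Nat.div_le_div_right (hlo' t p hp))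
    rw [(hl t ht).2.1]
    exact Nat.div_le_div_right (hhi' t p hp)
  obtain ⟨p₀, hp₀⟩ := hne
  have hkey : ∀ p ∈ S, cellKey rank Lam m lam p d = cellKey rank Lam m lam p₀ d := fun p hp =>
    cellKey_congr fun t ht => by rw [hdig t ht, hquot t ht p hp, hquot t ht p₀ hp₀]
  have hcell : ∀ p ∈ S, p ∈ cellSet rank Lam m (Lam ^ d) d (cellKey rank Lam m lam p₀ d) :=
    fun p hp => mem_cellSet.2 ⟨hSm p hp, lam, hlam, hkey p hp⟩
  by_cases hT : T0 < cellCount rank Lam m (Lam ^ d) d (m * Lam ^ d) (cellKey rank Lam m lam p₀ d)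
  · refine .inl ⟨_, cellKey_lt (fun t ht => hr t ht p₀ (hSm p₀ hp₀)) hlam, hT, fun z hz hzk t ht => ?_⟩
    obtain ⟨h₁, h₂⟩ := eq_of_cellKey_eq (fun t ht => hr t ht _ (div_lt_of_lt_mul' hz))
      (fun t ht => hr t ht p₀ (hSm p₀ hp₀)) hzk
    have h₃ : mid (digit Lam (z % Lam ^ d) t) (rank t (z / Lam ^ d)) = mid (l t) (rank t (lo t)) := by
      have h₂ := h₂ t ht
      rw [h₁, hdig t ht] at h₂
      rw [h₁, hdig t ht, mid, mid, h₂, hquot t ht p₀ hp₀]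
    obtain ⟨h₄, h₅⟩ := (hl t ht).2.2
    -- The middle rank is at most the largest rank in `S`, hence it is the rank of a sample point,
    -- whose coordinate lies between those of two points of the box.
    have h₆ : mid (l t) (rank t (lo t)) < m := lt_of_le_of_lt h₅ (hr t ht _ (hSm _ (hhi t)))
    obtain ⟨p, hp, hpe⟩ := exists_rk_eq (X := X t) (S := Finset.range m) (by simpa using h₆)
    rw [← hrank t ht p (Finset.mem_range.1 hp)] at hpe
    rw [h₃, ← hpe, hsrt t ht p (Finset.mem_range.1 hp)]
    exact hbetween t ht p (Finset.mem_range.1 hp) (hpe ▸ h₄.le) (hpe ▸ h₅)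
  · right
    have hidx : ∀ p ∈ S, ∃ i < T0, M (cellKey rank Lam m lam p₀ d) i = p := fun p hp => by
      obtain ⟨i, hi, hip⟩ := exists_index_of_mem_cellSet hr hM (hcell p hp)
      exact ⟨i, by omega, hip⟩
    choose ilo hilo hilo' using fun t => hidx _ (hlo t)
    choose ihi hihi hihi' using fun t => hidx _ (hhi t)
    -- The code of the box spanned by `S`: even digits are the list positions of the lowest points,
    -- odd digits those of the highest.
    obtain ⟨τ, hτ, hτd⟩ := exists_digits T0 (2 * d)
      (fun s => if s % 2 = 0 then ilo (s / 2) else ihi (s / 2))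
      (fun s _ => by split_ifs; exacts [hilo _, hihi _])
    have hev : ∀ t < d, digit T0 τ (2 * t) = ilo t := fun t ht => by
      rw [hτd _ (by omega)]; simp
    have hod : ∀ t < d, digit T0 τ (2 * t + 1) = ihi t := fun t ht => by
      rw [hτd _ (by omega), if_neg (by omega)]; congr 1; omega
    have hin : ∀ q, InBox rank d T0 M (cellKey rank Lam m lam p₀ d) τ q ↔
        ∀ t < d, rank t (lo t) ≤ rank t q ∧ rank t q ≤ rank t (hi t) := fun q => by
      refine forall₂_congr fun t ht => ?_
      rw [hev t ht, hod t ht, hilo', hihi']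
    have hval : Valid rank Lam m (Lam ^ d) d T0 h M (cellKey rank Lam m lam p₀ d) τ := by
      refine ⟨by omega, hcard.trans (Finset.card_le_card fun p hp => ?_)⟩
      exact Finset.mem_filter.2 ⟨hcell p hp, (hin p).2 fun t _ => ⟨hlo' t p hp, hhi' t p hp⟩⟩
    obtain ⟨p, hpR, hp⟩ := hR (cellKey rank Lam m lam p₀ d, τ) (Finset.mem_filter.2
      ⟨Finset.mem_product.2 ⟨Finset.mem_range.2
        (cellKey_lt (fun t ht => hr t ht p₀ (hSm p₀ hp₀)) hlam), Finset.mem_range.2 hτ⟩, hval⟩)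
    have h₁ := (hin p).1 (Finset.mem_filter.1 hp).2
    exact ⟨p, hpR, fun t ht => hbetween t ht p (Finset.mem_range.1 (boxPts_subset hp)) (h₁ t ht).1
      (h₁ t ht).2⟩


/-! ## Random samples -/

open scoped ENNReal

/-- Expectation of an extended nonnegative function. -/
noncomputable def expect {α : Type*} (p : PMF α) (f : α → ℝ≥0∞) : ℝ≥0∞ := ∑' a, p a * f a

theorem expect_pure {α : Type*} (a : α) (f : α → ℝ≥0∞) : expect (PMF.pure a) f = f a := by
  rw [expect, tsum_eq_single a]
  · simp
  · intro b hb; simp [hb]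

theorem expect_bind {α β : Type*} (p : PMF α) (k : α → PMF β) (f : β → ℝ≥0∞) :
    expect (p.bind k) f = expect p fun a => expect (k a) f := by
  simp only [expect, PMF.bind_apply, ← ENNReal.tsum_mul_right, ← ENNReal.tsum_mul_left]
  rw [ENNReal.tsum_comm]
  simp only [mul_assoc]

theorem expect_map {α β : Type*} (p : PMF α) (g : α → β) (f : β → ℝ≥0∞) :
    expect (p.map g) f = expect p fun a => f (g a) := by
  rw [PMF.map, expect_bind]
  simp only [Function.comp_apply, expect_pure]

theorem expect_mul_left {α : Type*} (p : PMF α) (f : α → ℝ≥0∞) (c : ℝ≥0∞) :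
    expect p (fun a => c * f a) = c * expect p f := by
  simp only [expect, ← ENNReal.tsum_mul_left]
  congr 1; funext a; ring

theorem toOuterMeasure_mul_le_expect {α : Type*} (p : PMF α) (f : α → ℝ≥0∞) (S : Set α) (c : ℝ≥0∞)
    (h : ∀ a ∈ S, c ≤ f a) : p.toOuterMeasure S * c ≤ expect p f := by
  rw [PMF.toOuterMeasure_apply, ← ENNReal.tsum_mul_right, expect]
  refine ENNReal.tsum_le_tsum fun a => ?_
  by_cases ha : a ∈ S
  · rw [Set.indicator_of_mem ha]; exact mul_le_mul_right (h a ha) _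
  · simp [ha]

/-- The distribution of a sequence with `i` independent uniformly random elements of `{0, …, n - 1}`
followed by zeros. -/
noncomputable def samp (n : ℕ) : ℕ → PMF (ℕ → ℕ)
  | 0 => PMF.pure fun _ => 0
  | i + 1 => (samp n i).bind fun g =>
      (PMF.uniformOfFintype (Fin (n - 1 + 1))).map fun r : Fin (n - 1 + 1) => Function.update g i (r : ℕ)

theorem expect_uniform (n : ℕ) (f : Fin (n - 1 + 1) → ℝ≥0∞) :
    expect (PMF.uniformOfFintype (Fin (n - 1 + 1))) f = (∑ r, f r) / (n - 1 + 1 : ℕ) := by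
  rw [expect, tsum_fintype, ENNReal.div_eq_inv_mul, Finset.mul_sum]
  simp [PMF.uniformOfFintype_apply]

/-- Independence of the draws: the expectation of the product factorises. -/
theorem expect_samp_prod (n : ℕ) (φ : ℕ → ℝ≥0∞) (i : ℕ) :
    expect (samp n i) (fun g => ∏ j ∈ Finset.range i, φ (g j)) =
      ((∑ r : Fin (n - 1 + 1), φ r) / (n - 1 + 1 : ℕ)) ^ i := by
  induction i with
  | zero => simp [samp, expect_pure]
  | succ i ih =>
    rw [samp, expect_bind]
    simp only [expect_map]
    have h : ∀ (g : ℕ → ℕ) (r : ℕ), ∏ j ∈ Finset.range (i + 1), φ (Function.update g i r j) =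
        (∏ j ∈ Finset.range i, φ (g j)) * φ r := by
      intro g r
      rw [Finset.prod_range_succ, Function.update_self]
      congr 1
      refine Finset.prod_congr rfl fun j hj => ?_
      rw [Function.update_of_ne (Finset.mem_range.1 hj).ne]
    simp only [h, expect_mul_left]
    rw [expect_uniform n fun r => φ r, pow_succ', ← ih, ← expect_mul_left]
    simp only [mul_comm]

theorem one_sub_pow_le_half {N : ℕ} (hN : 0 < N) : (1 - 1 / (N : ℝ)) ^ N ≤ 1 / 2 := by
  have hN' : (0 : ℝ) < N := by exact_mod_cast hN
  have h1 : (1 : ℝ) ≤ N := by exact_mod_cast hN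
  calc (1 - 1 / (N : ℝ)) ^ N ≤ Real.exp (-(1 / (N : ℝ))) ^ N := by
        refine pow_le_pow_left₀ ?_ (Real.one_sub_le_exp_neg _) N
        rw [sub_nonneg, div_le_one hN']; exact h1
    _ = Real.exp (-1) := by
        rw [← Real.exp_nat_mul]; congr 1; field_simp
    _ ≤ 1 / 2 := by have := Real.exp_neg_one_lt_d9; linarith

/-- Exponential moment bound. Give a draw weight `1` in `G` and `2` outside; the mean weight is at
most `2 * (1 - 1 / (4 * E))`, while fewer than `h` hits force a product of at least `2 ^ (m - h)`.
Since `m = 4 * E * B`, Markov leaves `2 ^ h * 2 ^ (-B)`, which is `2 ^ (-3h)` for `B = 4 * h`. -/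
theorem samp_few_le {n E m h B : ℕ} (hn : 1 ≤ n) (hE : 0 < E) (hm : m = 4 * E * B) (hB : B = 4 * h)
    (G : Finset ℕ) (hG : G ⊆ Finset.range n) (hGn : n ≤ 2 * E * G.card) :
    (samp n m).toOuterMeasure {g | ((Finset.range m).filter fun j => g j ∈ G).card < h} ≤
      ENNReal.ofReal ((1 / 2) ^ (3 * h)) := by
  classical
  have hhm : h ≤ m := by rw [hm, hB]; nlinarith
  have hn' : n - 1 + 1 = n := by omega
  have hnR : (0 : ℝ) < n := by exact_mod_cast hn
  have hER : (0 : ℝ) < E := by exact_mod_cast hE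
  have hGcard : G.card ≤ n := (Finset.card_le_card hG).trans_eq (Finset.card_range n)
  set φ : ℕ → ℝ≥0∞ := fun r => if r ∈ G then 1 else 2 with hφ
  have hsum : (∑ r : Fin (n - 1 + 1), φ r) = ((2 * n - G.card : ℕ) : ℝ≥0∞) := by
    rw [Fin.sum_univ_eq_sum_range φ, hn', hφ, Finset.sum_ite, Finset.sum_const, Finset.sum_const,
      Finset.filter_mem_eq_inter, Finset.inter_eq_right.2 hG, Finset.filter_notMem_eq_sdiff,
      Finset.card_sdiff_of_subset hG, Finset.card_range]
    rw [show 2 * n - G.card = G.card + (n - G.card) * 2 by omega]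
    simp
  have havg : (∑ r : Fin (n - 1 + 1), φ r) / (n - 1 + 1 : ℕ) ≤
      ENNReal.ofReal (2 * (1 - 1 / ((4 * E : ℕ) : ℝ))) := by
    rw [hsum, hn', ← ENNReal.ofReal_natCast, ← ENNReal.ofReal_natCast n, ← ENNReal.ofReal_div_of_pos hnR]
    refine ENNReal.ofReal_le_ofReal ?_
    rw [div_le_iff₀ hnR, Nat.cast_sub (by omega)]
    have h1 : (n : ℝ) ≤ 2 * E * G.card := by exact_mod_cast hGn
    have h2 : (n : ℝ) / (2 * E) ≤ G.card := by rw [div_le_iff₀ (by positivity)]; linarith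
    have h3 : 2 * (1 - 1 / ((4 * E : ℕ) : ℝ)) * n = 2 * n - n / (2 * E) := by
      push_cast; field_simp; ring
    rw [h3]; push_cast; linarith
  have hmk := toOuterMeasure_mul_le_expect (samp n m) (fun g => ∏ j ∈ Finset.range m, φ (g j))
    {g | ((Finset.range m).filter fun j => g j ∈ G).card < h} (2 ^ (m - h)) (by
      intro g hg
      simp only [Set.mem_ofPred_eq] at hg
      simp only [hφ]
      rw [Finset.prod_ite, Finset.prod_const_one, one_mul, Finset.prod_const]
      refine pow_le_pow_right₀ (by norm_num) ?_
      have := Finset.card_filter_add_card_filter_not (s := Finset.range m) (fun j => g j ∈ G)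
      rw [Finset.card_range] at this
      omega)
  rw [expect_samp_prod] at hmk
  have h4E : 0 < 4 * E := by omega
  have hbase : (0 : ℝ) ≤ 1 - 1 / ((4 * E : ℕ) : ℝ) := by
    rw [sub_nonneg, div_le_one (by exact_mod_cast h4E)]; exact_mod_cast h4E
  have hreal : (2 * (1 - 1 / ((4 * E : ℕ) : ℝ))) ^ m ≤ (1 / 2) ^ (3 * h) * 2 ^ (m - h) := by
    have h1 : (1 - 1 / ((4 * E : ℕ) : ℝ)) ^ m ≤ (1 / 2) ^ B := by
      rw [hm, pow_mul]
      exact pow_le_pow_left₀ (pow_nonneg hbase _) (one_sub_pow_le_half h4E) _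
    have h2 : (2 : ℝ) ^ m = 2 ^ (m - h) * 2 ^ h := by rw [← pow_add]; congr 1; omega
    have h3 : (2 : ℝ) ^ h * (1 / 2) ^ B = (1 / 2) ^ (3 * h) := by
      rw [hB, show 4 * h = h + 3 * h by ring, pow_add, ← mul_assoc, ← mul_pow]; norm_num
    rw [mul_pow]
    calc (2 : ℝ) ^ m * (1 - 1 / ((4 * E : ℕ) : ℝ)) ^ m ≤ 2 ^ m * (1 / 2) ^ B := by gcongr
      _ = 2 ^ (m - h) * (2 ^ h * (1 / 2) ^ B) := by rw [h2]; ring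
      _ = (1 / 2) ^ (3 * h) * 2 ^ (m - h) := by rw [h3]; ring
  have h5 : (samp n m).toOuterMeasure {g | ((Finset.range m).filter fun j => g j ∈ G).card < h} *
      2 ^ (m - h) ≤ ENNReal.ofReal ((1 / 2) ^ (3 * h)) * 2 ^ (m - h) := by
    refine hmk.trans ((pow_le_pow_left' havg m).trans ?_)
    rw [← ENNReal.ofReal_pow (by positivity)]
    refine (ENNReal.ofReal_le_ofReal hreal).trans_eq ?_
    rw [ENNReal.ofReal_mul (by positivity), ENNReal.ofReal_pow (by norm_num : (0 : ℝ) ≤ 2)]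
    simp
  exact (ENNReal.mul_le_mul_iff_left (by simp) (by finiteness)).1 h5

/-- The points of `S` that lie in the box between `a` and `b` in the first `d` coordinates. -/
noncomputable def inside (X : ℕ → ℕ → ℝ) (d : ℕ) (S : Finset ℕ) (a b : ℕ → ℝ) : Finset ℕ :=
  open Classical in S.filter fun i => ∀ t < d, a t ≤ X t i ∧ X t i ≤ b t

/-- An initial segment of the order is cut out by a bound on the rank. So the bounds `a t` and `b t`
of a box turn into thresholds for ranks. -/
theorem mem_iff_rk_lt {X : ℕ → ℝ} {S D : Finset ℕ} (hD : D ⊆ S)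
    (h : ∀ q ∈ D, ∀ i ∈ S, i ∉ D → Prec X q i) {i : ℕ} (hi : i ∈ S) : i ∈ D ↔ rk X S i < D.card := by
  classical
  constructor
  · intro hiD
    refine Finset.card_lt_card (Finset.ssubset_iff_subset_ne.2 ⟨fun q hq => ?_, fun he => ?_⟩)
    · by_contra hqD
      rw [Finset.mem_filter] at hq
      exact Prec.irrefl X i ((h i hiD q hq.1 hqD).trans hq.2)
    · rw [← he] at hiD
      exact Prec.irrefl X i (Finset.mem_filter.1 hiD).2
  · intro hlt
    by_contra hiD
    refine absurd (Finset.card_le_card (s := D) (t := S.filter fun q => Prec X q i) fun q hq => ?_)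
      (not_le.2 hlt)
    exact Finset.mem_filter.2 ⟨hD hq, h q hq i hi hiD⟩

/-- A subset of a box with many points that comes from a small family. -/
theorem exists_grid_box (X : ℕ → ℕ → ℝ) {d n E : ℕ} (hd : 0 < d) (hE : 0 < E) (a b : ℕ → ℝ)
    (hab : n ≤ E * (inside X d (Finset.range n) a b).card) :
    ∃ α β : Fin d → Fin (4 * d * E + 2), ∃ G ⊆ inside X d (Finset.range n) a b,
      (∀ i, i ∈ G ↔ i ∈ Finset.range n ∧ ∀ t : Fin d,
        α t * (n / (4 * d * E) + 1) ≤ rk (X t) (Finset.range n) i ∧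
        rk (X t) (Finset.range n) i < β t * (n / (4 * d * E) + 1)) ∧ n ≤ 2 * E * G.card := by
  classical
  -- Grid width for the ranks: fine enough that rounding the `2d` faces inwards loses at most `n /
  -- (2E)` points, coarse enough that the number of grid lines does not depend on `n`.
  set W := n / (4 * d * E) + 1 with hW
  have hdE : 0 < 4 * d * E := by positivity
  set u : ℕ → ℕ := fun t => ((Finset.range n).filter fun i => X t i < a t).card with hu
  set v : ℕ → ℕ := fun t => ((Finset.range n).filter fun i => X t i ≤ b t).card with hv
  have hu' : ∀ t, ∀ i < n, X t i < a t ↔ rk (X t) (Finset.range n) i < u t := by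
    intro t i hi
    rw [hu, ← mem_iff_rk_lt (Finset.filter_subset _ _) _ (Finset.mem_range.2 hi)]
    · simp [hi]
    · intro q hq j hj hjD
      simp only [Finset.mem_filter, not_and, not_lt] at hq hj hjD
      exact .inl (hq.2.trans_le (hjD hj))
  have hv' : ∀ t, ∀ i < n, X t i ≤ b t ↔ rk (X t) (Finset.range n) i < v t := by
    intro t i hi
    rw [hv, ← mem_iff_rk_lt (Finset.filter_subset _ _) _ (Finset.mem_range.2 hi)]
    · simp [hi]
    · intro q hq j hj hjD
      simp only [Finset.mem_filter, not_and, not_le] at hq hj hjD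
      exact .inl (hq.2.trans_lt (hjD hj))
  have hle : ∀ D : Finset ℕ, D ⊆ Finset.range n → D.card ≤ n := fun D hD =>
    (Finset.card_le_card hD).trans_eq (Finset.card_range n)
  have hnW : n / W ≤ 4 * d * E := by
    refine (Nat.div_lt_of_lt_mul ?_).le
    rw [hW, mul_comm]
    exact Nat.lt_mul_div_succ n hdE
  have hW0 : 0 < W := Nat.succ_pos _
  have hα : ∀ t, (u t + (W - 1)) / W < 4 * d * E + 2 := by
    intro t
    have h1 : u t ≤ n := hle _ (Finset.filter_subset _ _)
    calc (u t + (W - 1)) / W ≤ (n + W) / W := Nat.div_le_div_right (by omega)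
      _ = n / W + 1 := Nat.add_div_right _ hW0
      _ < _ := by omega
  have hβ : ∀ t, v t / W < 4 * d * E + 2 := by
    intro t
    have h1 : v t ≤ n := hle _ (Finset.filter_subset _ _)
    have := Nat.div_le_div_right (c := W) h1
    omega
  have hαl : ∀ t, u t ≤ (u t + (W - 1)) / W * W ∧ (u t + (W - 1)) / W * W ≤ u t + (W - 1) := by
    intro t
    have h1 := Nat.div_add_mod (u t + (W - 1)) W
    have h2 := Nat.mod_lt (u t + (W - 1)) hW0
    rw [mul_comm] at h1
    omega
  have hβl : ∀ t, v t / W * W ≤ v t ∧ v t ≤ v t / W * W + (W - 1) := by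
    intro t
    have h1 := Nat.div_add_mod (v t) W
    have h2 := Nat.mod_lt (v t) hW0
    rw [mul_comm] at h1
    omega
  set G := (Finset.range n).filter fun i => ∀ t : Fin d,
    (u t + (W - 1)) / W * W ≤ rk (X t) (Finset.range n) i ∧
    rk (X t) (Finset.range n) i < v t / W * W with hG
  refine ⟨fun t => ⟨_, hα t⟩, fun t => ⟨_, hβ t⟩, G, ?_, ?_, ?_⟩
  · intro i hi
    simp only [hG, inside, Finset.mem_filter, Finset.mem_range] at hi ⊢
    refine ⟨hi.1, fun t ht => ?_⟩
    obtain ⟨h1, h2⟩ := hi.2 ⟨t, ht⟩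
    simp only at h1 h2
    refine ⟨?_, (hv' t i hi.1).2 (h2.trans_le (hβl t).1)⟩
    rw [← not_lt, hu' t i hi.1, not_lt]
    exact (hαl t).1.trans h1
  · intro i
    simp [hG]
  -- A point of the box outside `G` has, in some coordinate, one of the `W - 1` ranks next to one of
  -- the two faces.
  · have hcov : inside X d (Finset.range n) a b ⊆ G ∪ (Finset.range d).biUnion fun t =>
        ((Finset.range n).filter fun i =>
          rk (X t) (Finset.range n) i ∈ Finset.Ico (u t) (u t + (W - 1))) ∪
        ((Finset.range n).filter fun i =>
          rk (X t) (Finset.range n) i ∈ Finset.Ico (v t / W * W) (v t / W * W + (W - 1))) := by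
      intro i hi
      rw [Finset.mem_union]
      by_contra hcon
      rw [not_or] at hcon
      obtain ⟨h1, h2⟩ := hcon
      simp only [inside, Finset.mem_filter, Finset.mem_range] at hi
      apply h1
      simp only [hG, Finset.mem_filter, Finset.mem_range]
      refine ⟨hi.1, fun t => ?_⟩
      simp only [Finset.mem_biUnion, Finset.mem_union, Finset.mem_filter, Finset.mem_range,
        Finset.mem_Ico, not_exists, not_and, not_or] at h2
      obtain ⟨h3, h4⟩ := h2 t t.2
      have h3 := h3 hi.1
      have h4 := h4 hi.1
      have h5 := hi.2 t t.2
      have h6 : u t ≤ rk (X t) (Finset.range n) i := by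
        rw [← not_lt, ← hu' t i hi.1, not_lt]; exact h5.1
      have h7 := (hv' t i hi.1).1 h5.2
      have h8 := hαl t
      have h9 := hβl t
      omega
    have hsmall : ∀ t s : ℕ, ((Finset.range n).filter fun i =>
        rk (X t) (Finset.range n) i ∈ Finset.Ico s (s + (W - 1))).card ≤ W - 1 := by
      intro t s
      have : ((Finset.range n).filter fun i =>
        rk (X t) (Finset.range n) i ∈ Finset.Ico s (s + (W - 1))).card ≤
          (Finset.Ico s (s + (W - 1))).card := by
        refine Finset.card_le_card_of_injOn (rk (X t) (Finset.range n))
          (fun i hi => (Finset.mem_filter.1 hi).2) fun i hi j hj hij => ?_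
        exact rk_injOn (Finset.mem_filter.1 hi).1 (Finset.mem_filter.1 hj).1 hij
      simpa using this
    have hcard := (Finset.card_le_card hcov).trans (Finset.card_union_le _ _)
    have hbi := (Finset.card_biUnion_le (s := Finset.range d) (t := fun t =>
        ((Finset.range n).filter fun i =>
          rk (X t) (Finset.range n) i ∈ Finset.Ico (u t) (u t + (W - 1))) ∪
        ((Finset.range n).filter fun i =>
          rk (X t) (Finset.range n) i ∈ Finset.Ico (v t / W * W) (v t / W * W + (W - 1))))).trans
      (Finset.sum_le_card_nsmul _ _ (2 * (W - 1)) fun t _ =>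
        (Finset.card_union_le _ _).trans (by have := hsmall t (u t); have := hsmall t (v t / W * W); omega))
    rw [Finset.card_range, smul_eq_mul] at hbi
    have hW1 : 4 * d * E * (W - 1) ≤ n := by
      rw [hW, Nat.add_sub_cancel]; exact Nat.mul_div_le n _
    have h1 : (inside X d (Finset.range n) a b).card ≤ G.card + d * (2 * (W - 1)) :=
      hcard.trans (by omega)
    have h2 := Nat.mul_le_mul_left (2 * E) h1
    have h3 : 2 * E * (G.card + d * (2 * (W - 1))) = 2 * E * G.card + 4 * d * E * (W - 1) := by ring
    have h4 : 2 * E * (inside X d (Finset.range n) a b).card =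
      2 * (E * (inside X d (Finset.range n) a b).card) := by ring
    omega

/-- Every box with at least `n / E` of the `n` points has at least `h` points of the sample `g`. -/
def SampleGood (X : ℕ → ℕ → ℝ) (d n E m h : ℕ) (g : ℕ → ℕ) : Prop :=
  ∀ a b : ℕ → ℝ, n ≤ E * (inside X d (Finset.range n) a b).card →
    h ≤ (inside (fun t j => X t (g j)) d (Finset.range m) a b).card

/-- Union bound over the pairs of grid corners: each heavy box contains a grid box with at least
half of the required `n / E` points, so it is enough to sample the grid boxes well. -/
theorem samp_not_good_le (X : ℕ → ℕ → ℝ) {d n E m h B : ℕ} (hd : 0 < d) (hn : 1 ≤ n) (hE : 0 < E)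
    (hm : m = 4 * E * B) (hB : B = 4 * h) :
    (samp n m).toOuterMeasure {g | ¬ SampleGood X d n E m h g} ≤
      ENNReal.ofReal (((4 * d * E + 2 : ℕ) : ℝ) ^ (2 * d) * (1 / 2) ^ (3 * h)) := by
  classical
  set W := n / (4 * d * E) + 1
  set Gr : (Fin d → Fin (4 * d * E + 2)) × (Fin d → Fin (4 * d * E + 2)) → Finset ℕ := fun f =>
    (Finset.range n).filter fun i => ∀ t : Fin d, f.1 t * W ≤ rk (X t) (Finset.range n) i ∧
      rk (X t) (Finset.range n) i < f.2 t * W with hGr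
  set U : (Fin d → Fin (4 * d * E + 2)) × (Fin d → Fin (4 * d * E + 2)) → Set (ℕ → ℕ) := fun f =>
    {g | n ≤ 2 * E * (Gr f).card ∧ ((Finset.range m).filter fun j => g j ∈ Gr f).card < h} with hU
  have hsub : {g | ¬ SampleGood X d n E m h g} ⊆ ⋃ f, U f := by
    intro g hg
    simp only [SampleGood, Set.mem_ofPred_eq, not_forall, not_le] at hg
    obtain ⟨a, b, hab, hlt⟩ := hg
    obtain ⟨α, β, G, hG, hGe, hGc⟩ := exists_grid_box X hd hE a b hab
    have hGG : Gr (α, β) = G := by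
      ext i; rw [hGe]; simp [hGr, W]
    refine Set.mem_iUnion.2 ⟨(α, β), hGG ▸ hGc, lt_of_le_of_lt (Finset.card_le_card fun j hj => ?_) hlt⟩
    rw [hGG, Finset.mem_filter] at hj
    have := hG hj.2
    simp only [inside, Finset.mem_filter] at this ⊢
    exact ⟨hj.1, this.2⟩
  have hUle : ∀ f, (samp n m).toOuterMeasure (U f) ≤ ENNReal.ofReal ((1 / 2) ^ (3 * h)) := by
    intro f
    by_cases hf : n ≤ 2 * E * (Gr f).card
    · refine le_trans (MeasureTheory.measure_mono fun g hg => hg.2)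
        (samp_few_le hn hE hm hB (Gr f) (Finset.filter_subset _ _) hf)
    · have : U f = ∅ := by ext g; simp [hU, hf]
      simp [this]
  calc _ ≤ (samp n m).toOuterMeasure (⋃ f, U f) := MeasureTheory.measure_mono hsub
    _ ≤ ∑ f, (samp n m).toOuterMeasure (U f) := MeasureTheory.measure_iUnion_fintype_le _ _
    _ ≤ ∑ f : (Fin d → Fin (4 * d * E + 2)) × (Fin d → Fin (4 * d * E + 2)),
          ENNReal.ofReal ((1 / 2) ^ (3 * h)) := Finset.sum_le_sum fun f _ => hUle f
    _ = _ := by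
        rw [Finset.sum_const, Finset.card_univ, Fintype.card_prod, Fintype.card_fun, Fintype.card_fin,
          Fintype.card_fin, nsmul_eq_mul, ENNReal.ofReal_mul (by positivity), two_mul, pow_add,
          ← ENNReal.ofReal_natCast]
        push_cast
        rfl


/-! ### Evaluation of expressions and layout of the memory -/

namespace RealRAM

section Eval

variable {w : ℕ} {s : Store} {e f g : WExp} {a b c : ℕ}

@[simp] theorem setW_wvar (s : Store) (x v y : ℕ) :
    (s.setW x v).wvar y = if y = x then v else s.wvar y := by
  simp [Store.setW, Function.update_apply]

@[simp] theorem setW_warr (s : Store) (x v : ℕ) : (s.setW x v).warr = s.warr := rfl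

@[simp] theorem setW_rarr (s : Store) (x v : ℕ) : (s.setW x v).rarr = s.rarr := rfl

@[simp] theorem putW_wvar (s : Store) (a i v : ℕ) : (s.putW a i v).wvar = s.wvar := rfl

@[simp] theorem putW_rarr (s : Store) (a i v : ℕ) : (s.putW a i v).rarr = s.rarr := rfl

@[simp] theorem putW_warr (s : Store) (a i v b j : ℕ) :
    (s.putW a i v).warr b j = if b = a ∧ j = i then v else s.warr b j := by
  by_cases hb : b = a
  · subst hb; simp [Store.putW, Function.update_apply]
  · simp [Store.putW, hb]

theorem eval_var {x : ℕ} (h : s.wvar x = a) : (WExp.var x).eval w s = a := h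

theorem eval_const (h : a < 2 ^ w) : (WExp.const a).eval w s = a := Nat.mod_eq_of_lt h

theorem eval_add (he : e.eval w s = a) (hf : f.eval w s = b) (h : a + b < 2 ^ w) :
    (e.add f).eval w s = a + b := by
  rw [WExp.eval, he, hf, Nat.mod_eq_of_lt h]

theorem eval_mul (he : e.eval w s = a) (hf : f.eval w s = b) (h : a * b < 2 ^ w) :
    (e.mul f).eval w s = a * b := by
  rw [WExp.eval, he, hf, Nat.mod_eq_of_lt h]

theorem eval_mul_add (he : e.eval w s = a) (hf : f.eval w s = b) (hg : g.eval w s = c)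
    (h : a * b + c < 2 ^ w) : ((e.mul f).add g).eval w s = a * b + c :=
  eval_add (eval_mul he hf (by omega)) hg h

theorem eval_sub (he : e.eval w s = a) (hf : f.eval w s = b) : (e.sub f).eval w s = a - b := by
  rw [WExp.eval, he, hf]

theorem eval_div (he : e.eval w s = a) (hf : f.eval w s = b) : (e.div f).eval w s = a / b := by
  rw [WExp.eval, he, hf]

theorem eval_mod (he : e.eval w s = a) (hf : f.eval w s = b) : (e.mod f).eval w s = a % b := by
  rw [WExp.eval, he, hf]

theorem eval_get {x : ℕ} (he : e.eval w s = a) : (WExp.get x e).eval w s = s.warr x a := by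
  rw [WExp.eval, he]

end Eval

/-- The parameters that the program computes from `ε`: the sample has `m = 2 ^ L` points, `Lam` bounds
the number of levels in each coordinate and `D` the number of tuples of levels, cells with more than `T0`
points get their centre, the boxes to be hit have at least `h` points. -/
structure Params where
  (d w m L Lam D T0 h I : ℕ)
  hm : m = 2 ^ L
  hL : L < Lam
  hD : D = Lam ^ d
  hLam : 2 ^ Lam < 2 ^ w
  hw : 2 ≤ w
  sort_lt : (L + 2) * m < 2 ^ w
  mid_lt : (L + 2) * m + 2 ^ Lam < 2 ^ w
  cell_lt : D * m ^ d * (m * D) + m * D + T0 < 2 ^ w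
  box_lt : D * T0 ^ (2 * d) < 2 ^ w
  hI : D * T0 ^ (2 * d) = 2 ^ I
  I_lt : I + 1 < 2 ^ w
  T0_pos : 0 < T0

/-- The parameters are in their variables and the table of the powers of two is set up. -/
structure Env (π : Params) (s : Store) : Prop where
  m : s.wvar 6 = π.m
  L : s.wvar 7 = π.L
  Lam : s.wvar 8 = π.Lam
  D : s.wvar 9 = π.D
  T0 : s.wvar 10 = π.T0
  h : s.wvar 11 = π.h
  Y : s.wvar 12 = π.D * π.T0 ^ (2 * π.d)
  I : s.wvar 13 = π.I + 1
  Z : s.wvar 14 = π.m * π.D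
  pw : ∀ i < π.Lam, s.warr 1 i = 2 ^ i

theorem Env.frame {π : Params} {s s' : Store} {c : Cmd} (h : Env π s) (hf : Frame c s s')
    (hv : ∀ x, 6 ≤ x → x ≤ 14 → ¬ c.WV x) (ha : ¬ c.WA 1) : Env π s' := by
  constructor
  all_goals first
    | rw [hf.wv _ (hv _ (by norm_num) (by norm_num))]
    | rw [hf.wa _ ha]
  exacts [h.m, h.L, h.Lam, h.D, h.T0, h.h, h.Y, h.I, h.Z, h.pw]

theorem Env.setW {π : Params} {s : Store} (h : Env π s) {x v : ℕ} (hx : 14 < x) :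
    Env π (s.setW x v) := by
  have hne : ∀ y, y ≤ 14 → y ≠ x := fun y hy => by omega
  constructor
  all_goals first
    | rw [setW_wvar, if_neg (hne _ (by norm_num))]
    | rw [setW_warr]
  exacts [h.m, h.L, h.Lam, h.D, h.T0, h.h, h.Y, h.I, h.Z, h.pw]

/-! ## Sorting -/

/-- Coordinate `t` of the `q`-th sample point. -/
noncomputable def sampleX (s : Store) (t q : ℕ) : ℝ := s.rarr t (s.warr 0 q)

theorem sampleX_congr {s s' : Store} (h : s'.warr 0 = s.warr 0) (t : ℕ) (h' : s'.rarr t = s.rarr t) :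
    sampleX s' t = sampleX s t := by
  funext q; simp only [sampleX, h, h']

/-- Comparison of two sample points in coordinate `t`. -/
def precTest (t : ℕ) (q p : WExp) : Test :=
  .not (.and (.not (.rlt (.get t (.get 0 q)) (.get t (.get 0 p))))
    (.not (.and (.not (.rlt (.get t (.get 0 p)) (.get t (.get 0 q)))) (.wlt q p))))

theorem precTest_holds {w t : ℕ} {s : Store} {e f : WExp} {q p : ℕ} (he : e.eval w s = q)
    (hf : f.eval w s = p) : (precTest t e f).holds w s ↔ Prec (sampleX s t) q p := by
  simp only [precTest, Test.holds, RExp.eval, WExp.eval, he, hf, Prec, sampleX]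
  rcases lt_trichotomy (s.rarr t (s.warr 0 q)) (s.rarr t (s.warr 0 p)) with h | h | h
  · simp [h]
  · simp [h]
  · simp [h, h.not_gt, h.ne']

/-- Adds to variable `28` the number of the points of a sorted block that precede point `21`; variable
`36` is the address of the block. -/
def searchBody (t : ℕ) : Cmd :=
  .ite (.and (.not (.wlt (.get 1 (.var 33)) (.add (.var 28) (.get 1 (.sub (.var 33) (.var 34))))))
      (precTest t (.get (11 + 2 * t) (.add (.var 36)
        (.sub (.add (.var 28) (.get 1 (.sub (.var 33) (.var 34)))) (.const 1)))) (.var 21)))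
    (.wset 28 (.add (.var 28) (.get 1 (.sub (.var 33) (.var 34))))) .skip

def search (t : ℕ) : Cmd := .times 34 (.add (.var 33) (.const 1)) (searchBody t)

/-- Binary search with steps `2 ^ l, 2 ^ (l - 1), …, 1`. The first step is the whole length of the
block because the rank of an outside point can be any of the `2 ^ l + 1` values from `0` to `2 ^ l`.
-/
theorem runs_search (π : Params) {t l p β : ℕ} {s : Store} (hs : Env π s) (hl : l < π.L)
    (h33 : s.wvar 33 = l) (h21 : s.wvar 21 = p) (h28 : s.wvar 28 = 0)
    (h36 : s.wvar 36 = l * π.m + β * 2 ^ l) (hβ : β * 2 ^ l + 2 ^ l ≤ π.m)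
    (hA : ∀ q ∈ block l β, s.warr (11 + 2 * t) (l * π.m + sortPos (sampleX s t) l q) = q) :
    Runs π.w (search t) s ((π.L + 1) * 5 + 3)
      fun s' => s'.wvar 28 = rk (sampleX s t) (block l β) p := by
  set X := sampleX s t with hX
  have hlm : l * π.m + π.m < 2 ^ π.w := by
    have := π.sort_lt; have := Nat.mul_le_mul_right π.m (show l + 1 ≤ π.L + 2 by omega); linarith
  have hlw : l + 1 < 2 ^ π.w := by
    have := π.hLam; have := π.hL; have := Nat.lt_two_pow_self (n := π.Lam); omega
  have h1w : 1 < 2 ^ π.w := by omega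
  have h2l : 2 * 2 ^ l ≤ π.m := by
    rw [π.hm, ← pow_succ']; exact Nat.pow_le_pow_right (by norm_num) hl
  set N := rk X (block l β) p with hN
  have hNle : N ≤ 2 ^ l := by
    rw [hN, ← card_block l β]; exact rk_le_card
  refine Runs.mono (Runs.times (N := l + 1) (Tb := 2)
    (fun i s' => s'.wvar 28 ≤ N ∧ N < s'.wvar 28 + 2 ^ (l + 1 - i)) hlw ?_ ?_ ?_ ?_ ?_ le_rfl) ?_ ?_
  · simp [searchBody, Cmd.WV]
  · intro i s' v h; simpa using h
  · intro s' hf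
    refine eval_add ?_ (eval_const h1w) hlw
    rw [WExp.eval, hf.wv 33 (by simp [searchBody, Cmd.WV]), h33]
  · rw [h28]
    have : 2 ^ l < 2 ^ (l + 1) := Nat.pow_lt_pow_right (by norm_num) (by omega)
    simp; omega
  · rintro i hi s' hi' hf ⟨h₁, h₂⟩
    have hs' : Env π s' := hs.frame hf (by intro x; simp [Cmd.WV, searchBody]; omega)
      (by simp [Cmd.WA, searchBody])
    have h33' : s'.wvar 33 = l := by rw [hf.wv 33 (by simp [searchBody, Cmd.WV]), h33]
    have h21' : s'.wvar 21 = p := by rw [hf.wv 21 (by simp [searchBody, Cmd.WV]), h21]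
    have h36' : s'.wvar 36 = l * π.m + β * 2 ^ l := by
      rw [hf.wv 36 (by simp [searchBody, Cmd.WV]), h36]
    have hA' : s'.warr (11 + 2 * t) = s.warr (11 + 2 * t) := hf.wa _ (by simp [searchBody, Cmd.WA])
    have hX' : sampleX s' t = X := sampleX_congr (hf.wa _ (by simp [searchBody, Cmd.WA])) _
      (hf.ra _ (by simp [searchBody, Cmd.RA]))
    set c := s'.wvar 28 with hc
    have hpl : (2 : ℕ) ^ (l + 1 - i) = 2 ^ (l - i) + 2 ^ (l - i) := by
      rw [show l + 1 - i = l - i + 1 by omega, pow_succ]; ring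
    rw [hpl] at h₂
    have hpos : 0 < 2 ^ (l - i) := by positivity
    have hlel : 2 ^ (l - i) ≤ 2 ^ l := Nat.pow_le_pow_right (by norm_num) (by omega)
    have hhalf : (WExp.get 1 (.sub (.var 33) (.var 34))).eval π.w s' = 2 ^ (l - i) := by
      rw [eval_get (eval_sub (eval_var h33') (eval_var hi')), hs'.pw _ (by have := π.hL; omega)]
    have hsum : (WExp.add (.var 28) (.get 1 (.sub (.var 33) (.var 34)))).eval π.w s' = c + 2 ^ (l - i) :=
      eval_add (eval_var hc.symm) hhalf (by omega)
    have hpwl : (WExp.get 1 (.var 33)).eval π.w s' = 2 ^ l := by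
      rw [eval_get (eval_var h33'), hs'.pw _ (by have := π.hL; omega)]
    -- The element of rank `c + 2 ^ (l - i) - 1` precedes `p` exactly if at least `c + 2 ^ (l - i)`
    -- elements do. The first conjunct rejects probes beyond the end of the block.
    have hiff : (Test.and (.not (.wlt (.get 1 (.var 33)) (.add (.var 28) (.get 1 (.sub (.var 33) (.var 34))))))
      (precTest t (.get (11 + 2 * t) (.add (.var 36)
        (.sub (.add (.var 28) (.get 1 (.sub (.var 33) (.var 34)))) (.const 1)))) (.var 21))).holds π.w s' ↔
        c + 2 ^ (l - i) ≤ N := by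
      have hfst : (Test.not (.wlt (.get 1 (.var 33)) (.add (.var 28) (.get 1 (.sub (.var 33) (.var 34)))))).holds
          π.w s' ↔ c + 2 ^ (l - i) ≤ 2 ^ l := by
        simp only [Test.holds, hsum, hpwl, not_lt]
      by_cases hle : c + 2 ^ (l - i) ≤ 2 ^ l
      · obtain ⟨q, hq, hq₁, hq₂⟩ := exists_sortPos_eq X l β (r := c + 2 ^ (l - i) - 1) (by omega)
        have hget : (WExp.get (11 + 2 * t) (.add (.var 36)
            (.sub (.add (.var 28) (.get 1 (.sub (.var 33) (.var 34)))) (.const 1)))).eval π.w s' = q := by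
          rw [eval_get (eval_add (eval_var h36') (eval_sub hsum (eval_const h1w)) (by omega)), hA', ← hA q hq, hq₁,
            add_assoc]
        have hsnd := precTest_holds (t := t) hget (eval_var h21')
        rw [hX', prec_iff_rk_lt hq, hq₂] at hsnd
        rw [Test.holds, hfst, hsnd]
        omega
      · rw [Test.holds, hfst]
        constructor
        · rintro ⟨h, -⟩; exact absurd h hle
        · intro h; omega
    refine Runs.ite (T := 1) (fun hh => ?_) (fun hh => ?_) le_rfl
    · rw [hiff] at hh
      refine Runs.wset _ hsum le_rfl ?_
      rw [show l + 1 - (i + 1) = l - i by omega]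
      simp only [setW_wvar, if_true]
      omega
    · rw [hiff] at hh
      refine Runs.skip le_rfl ?_
      rw [show l + 1 - (i + 1) = l - i by omega]
      omega
  · have := Nat.mul_le_mul_right 5 (show l + 1 ≤ π.L + 1 by omega); omega
  · rintro s' - ⟨h₁, h₂⟩
    simp at h₂; omega

/-- Moves point `21` to its position after the merge of its block with the sibling block. -/
def mergeBody (t : ℕ) : Cmd :=
  .seq (.wset 35 (.get (10 + 2 * t) (.add (.mul (.var 33) (.var 6)) (.var 21))))
  (.seq (.wset 36 (.add (.mul (.var 33) (.var 6)) (.mul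
    (.sub (.add (.div (.var 21) (.get 1 (.var 33))) (.const 1))
      (.mul (.const 2) (.mod (.div (.var 21) (.get 1 (.var 33))) (.const 2)))) (.get 1 (.var 33)))))
  (.seq (.wset 28 (.const 0))
  (.seq (search t)
  (.seq (.wset 27 (.add (.add (.mul (.div (.div (.var 21) (.get 1 (.var 33))) (.const 2))
    (.mul (.const 2) (.get 1 (.var 33)))) (.mod (.var 35) (.get 1 (.var 33)))) (.var 28)))
  (.seq (.wput (10 + 2 * t) (.add (.mul (.add (.var 33) (.const 1)) (.var 6)) (.var 21)) (.var 27))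
  (.wput (11 + 2 * t) (.add (.mul (.add (.var 33) (.const 1)) (.var 6)) (.var 27)) (.var 21)))))))

/-- In row `l` of the arrays of coordinate `t` the first `B` points are entered, at their positions in
the sorted blocks of length `2 ^ l`. -/
def SortedAt (m t : ℕ) (X : ℕ → ℝ) (l B : ℕ) (s : Store) : Prop :=
  ∀ q < B, s.warr (10 + 2 * t) (l * m + q) = sortPos X l q ∧
    s.warr (11 + 2 * t) (l * m + sortPos X l q) = q

theorem runs_mergeBody (π : Params) {t l p : ℕ} {s : Store} (hs : Env π s) (hl : l < π.L) (hp : p < π.m)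
    (h33 : s.wvar 33 = l) (h21 : s.wvar 21 = p) (hA : SortedAt π.m t (sampleX s t) l π.m s)
    (hB : SortedAt π.m t (sampleX s t) (l + 1) p s) :
    Runs π.w (mergeBody t) s ((π.L + 1) * 5 + 3 + 12)
      fun s' => SortedAt π.m t (sampleX s t) l π.m s' ∧ SortedAt π.m t (sampleX s t) (l + 1) (p + 1) s' := by
  set X := sampleX s t with hX
  have hpm : p < 2 ^ π.L := π.hm ▸ hp
  have hlm : (l + 1) * π.m + π.m < 2 ^ π.w := by
    have := π.sort_lt; have := Nat.mul_le_mul_right π.m (show l + 2 ≤ π.L + 2 by omega); linarith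
  have hlm' : l * π.m + π.m < 2 ^ π.w := by linarith
  have hlw : l + 1 < 2 ^ π.w := by
    have := π.hLam; have := π.hL; have := Nat.lt_two_pow_self (n := π.Lam); omega
  have h2w : 2 < 2 ^ π.w := by
    calc 2 < 2 ^ 2 := by norm_num
      _ ≤ 2 ^ π.w := Nat.pow_le_pow_right (by norm_num) π.hw
  have h2l : 2 * 2 ^ l ≤ π.m := by
    rw [π.hm, ← pow_succ']; exact Nat.pow_le_pow_right (by norm_num) hl
  have hβ : sibling (p / 2 ^ l) * 2 ^ l + 2 ^ l ≤ π.m := by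
    have := Nat.mul_le_mul_right (2 ^ l) (sibling_lt hl hpm)
    rw [← pow_add, show π.L - l + l = π.L by omega, ← π.hm, Nat.succ_mul] at this
    exact this
  have hsp : ∀ r, ∀ q < π.m, r ≤ π.L → sortPos X r q < π.m := fun r q hq hr => by
    have := sortPos_lt X hr (π.hm ▸ hq); rwa [← π.hm] at this
  have hdiv : p / 2 ^ l < π.m := (Nat.div_le_self _ _).trans_lt hp
  have hpw : ∀ s : Store, Env π s → s.wvar 33 = l → (WExp.get 1 (.var 33)).eval π.w s = 2 ^ l :=
    fun s hs h => by rw [eval_get (eval_var h), hs.pw _ (by have := π.hL; omega)]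
  refine Runs.mono (T := (π.L + 1) * 5 + 3 + 12) ?_ le_rfl (fun s' _ h => h)
  refine Runs.seq_wset (T := (π.L + 1) * 5 + 3 + 10) (sortPos X l p) ?_ ?_
  · rw [eval_get (eval_mul_add (eval_var h33) (eval_var hs.m) (eval_var h21) (by omega))]
    exact (hA p hp).1
  have hs₁ := hs.setW (v := sortPos X l p) (show 14 < 35 by norm_num)
  set s₁ := s.setW 35 (sortPos X l p) with hs₁d
  refine Runs.seq_wset (T := (π.L + 1) * 5 + 3 + 8) (l * π.m + sibling (p / 2 ^ l) * 2 ^ l) ?_ ?_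
  · have h33₁ : s₁.wvar 33 = l := by simp [hs₁d, h33]
    have hdv : (WExp.div (.var 21) (.get 1 (.var 33))).eval π.w s₁ = p / 2 ^ l :=
      eval_div (eval_var (by simp [hs₁d, h21])) (hpw _ hs₁ h33₁)
    refine eval_mul_add (eval_var h33₁) (eval_var hs₁.m) (eval_mul (eval_sub (eval_add hdv
      (eval_const (by omega)) (by omega)) (eval_mul (eval_const (by omega)) (eval_mod hdv
      (eval_const (by omega))) (by omega))) (hpw _ hs₁ h33₁) ?_) ?_
    · omega
    · omega
  have hs₂ := hs₁.setW (v := l * π.m + sibling (p / 2 ^ l) * 2 ^ l) (show 14 < 36 by norm_num)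
  set s₂ := s₁.setW 36 (l * π.m + sibling (p / 2 ^ l) * 2 ^ l) with hs₂d
  refine Runs.seq_wset (T := (π.L + 1) * 5 + 3 + 6) 0 (eval_const (by omega)) ?_
  have hs₃ := hs₂.setW (v := 0) (show 14 < 28 by norm_num)
  set s₃ := s₂.setW 28 0 with hs₃d
  have hX₃ : sampleX s₃ t = X := rfl
  refine Runs.seq _ 5 (Runs.mono (runs_search π (t := t) (l := l) (p := p) (β := sibling (p / 2 ^ l)) hs₃ hl
    (by simp [hs₃d, hs₂d, hs₁d, h33]) (by simp [hs₃d, hs₂d, hs₁d, h21]) (by simp [hs₃d])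
    (by simp [hs₃d, hs₂d]) hβ ?_) le_rfl fun s₄ hf h28 => ?_) (by omega)
  · intro q hq
    have hqm : q < π.m := by
      rw [block, Finset.mem_Ico, add_one_mul] at hq; omega
    rw [hX₃]
    exact (hA q hqm).2
  have hs₄ : Env π s₄ := hs₃.frame hf (by intro x; simp [search, Cmd.WV, searchBody]; omega)
      (by simp [search, Cmd.WA, searchBody])
  have hW : ∀ a, s₄.warr a = s.warr a := fun a => hf.wa a (by simp [search, searchBody, Cmd.WA])
  have h33₄ : s₄.wvar 33 = l := by
    rw [hf.wv 33 (by simp [search, searchBody, Cmd.WV])]; simp [hs₃d, hs₂d, hs₁d, h33]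
  have h21₄ : s₄.wvar 21 = p := by
    rw [hf.wv 21 (by simp [search, searchBody, Cmd.WV])]; simp [hs₃d, hs₂d, hs₁d, h21]
  have h35₄ : s₄.wvar 35 = sortPos X l p := by
    rw [hf.wv 35 (by simp [search, searchBody, Cmd.WV])]; simp [hs₃d, hs₂d, hs₁d]
  rw [hX₃] at h28
  have hnew : p / 2 ^ l / 2 * (2 * 2 ^ l) + sortPos X l p % 2 ^ l +
      rk X (block l (sibling (p / 2 ^ l))) p = sortPos X (l + 1) p := (sortPos_succ X l p).symm
  have hlt := hsp (l + 1) p hp (by omega)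
  refine Runs.seq_wset (T := 3) (sortPos X (l + 1) p) ?_ ?_
  · rw [← hnew]
    exact eval_add (eval_mul_add (eval_div (eval_div (eval_var h21₄) (hpw _ hs₄ h33₄))
      (eval_const (by omega))) (eval_mul (eval_const (by omega)) (hpw _ hs₄ h33₄) (by omega))
      (eval_mod (eval_var h35₄) (hpw _ hs₄ h33₄)) (by omega)) (eval_var h28) (by omega)
  have hs₅ := hs₄.setW (v := sortPos X (l + 1) p) (show 14 < 27 by norm_num)
  set s₅ := s₄.setW 27 (sortPos X (l + 1) p) with hs₅d
  have h33₅ : s₅.wvar 33 = l := by simp [hs₅d, h33₄]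
  have h21₅ : s₅.wvar 21 = p := by simp [hs₅d, h21₄]
  have h27₅ : s₅.wvar 27 = sortPos X (l + 1) p := by simp [hs₅d]
  refine Runs.seq 1 1 (Runs.wput ((l + 1) * π.m + p) (sortPos X (l + 1) p)
    (eval_mul_add (eval_add (eval_var h33₅) (eval_const (by omega)) (by omega)) (eval_var hs₅.m)
      (eval_var h21₅) (by omega)) (eval_var h27₅) le_rfl ?_) le_rfl
  refine Runs.wput ((l + 1) * π.m + sortPos X (l + 1) p) p
    (eval_mul_add (eval_add (eval_var h33₅) (eval_const (by omega)) (by omega)) (eval_var hs₅.m)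
      (eval_var h27₅) (by omega)) (eval_var h21₅) le_rfl ?_
  -- The writes go to row `l + 1`. All positions are below `m`, so row `l` is untouched, and within
  -- row `l + 1` injectivity of `sortPos` protects the earlier entries.
  have hne : 10 + 2 * t ≠ 11 + 2 * t := by omega
  refine ⟨fun q hq => ?_, fun q hq => ?_⟩
  · have h₁ := hsp l q hq (by omega)
    have h₂ : l * π.m + q ≠ (l + 1) * π.m + p := by rw [add_one_mul]; omega
    have h₃ : l * π.m + sortPos X l q ≠ (l + 1) * π.m + sortPos X (l + 1) p := by rw [add_one_mul]; omega
    simp only [putW_warr, hne, hne.symm, h₂, h₃, false_and, and_false, if_false, hs₅d, setW_warr, hW]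
    exact hA q hq
  · simp only [putW_warr, hne, hne.symm, false_and, if_false, hs₅d, setW_warr, hW, true_and,
      Nat.add_left_cancel_iff, (sortPos_injective X (l + 1)).eq_iff]
    rcases Nat.lt_succ_iff_lt_or_eq.1 hq with hq | rfl
    · rw [if_neg hq.ne, if_neg hq.ne]; exact hB q hq
    · simp

/-- Sorts the sample points by coordinate `t`. -/
def sortCmd (t : ℕ) : Cmd :=
  .seq (.times 21 (.var 6) (.seq (.wput (10 + 2 * t) (.var 21) (.var 21))
    (.wput (11 + 2 * t) (.var 21) (.var 21))))
  (.times 33 (.var 7) (.times 21 (.var 6) (mergeBody t)))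

theorem runs_sortCmd (π : Params) (t : ℕ) {s : Store} (hs : Env π s) :
    Runs π.w (sortCmd t) s (π.m * 6 + 3 + (π.L * (π.m * (5 * π.L + 23) + 3 + 3) + 3) + 1)
      (SortedAt π.m t (sampleX s t) π.L π.m) := by
  set X := sampleX s t with hX
  have hmw : π.m < 2 ^ π.w := by have := π.sort_lt; nlinarith
  have hLw : π.L < 2 ^ π.w := by
    have := π.hLam; have := π.hL; have := Nat.lt_two_pow_self (n := π.Lam); omega
  have hne : 10 + 2 * t ≠ 11 + 2 * t := by omega
  refine Runs.seq _ _ (Runs.mono (Runs.times (N := π.m) (Tb := 3) (SortedAt π.m t X 0)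
    hmw ?_ ?_ ?_ ?_ ?_ le_rfl) le_rfl ?_) le_rfl
  · simp [Cmd.WV]
  · exact fun i s v h => h
  · intro s' hf
    exact eval_var ((hf.wv 6 (by simp [Cmd.WV])).trans hs.m)
  · intro q hq; omega
  · intro p hp s' h21 hf hI
    refine Runs.seq 1 1 (Runs.wput p p (eval_var h21) (eval_var h21) le_rfl ?_) le_rfl
    refine Runs.wput p p (eval_var h21) (eval_var h21) le_rfl ?_
    intro q hq
    simp only [putW_warr, hne, hne.symm, false_and, if_false, true_and, zero_mul, zero_add, sortPos_zero]
    rcases Nat.lt_succ_iff_lt_or_eq.1 hq with hq | rfl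
    · have := hI q hq
      simp only [zero_mul, zero_add, sortPos_zero] at this
      rw [if_neg hq.ne, if_neg hq.ne]; exact this
    · simp
  intro s₁ hf₁ hI₁
  have hs₁ : Env π s₁ := hs.frame hf₁ (by intro x; simp [Cmd.WV]; omega) (by simp [Cmd.WA]; omega)
  have hX₁ : sampleX s₁ t = X := sampleX_congr (hf₁.wa _ (by simp [Cmd.WA]; omega)) _
    (hf₁.ra _ (by simp [Cmd.RA]))
  refine Runs.times (N := π.L) (fun l => SortedAt π.m t X l π.m) hLw ?_ ?_ ?_ hI₁ ?_ le_rfl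
  · simp [Cmd.WV, mergeBody, search, searchBody]
  · exact fun i s v h => h
  · intro s' hf
    exact eval_var ((hf.wv 7 (by simp [Cmd.WV, mergeBody, search, searchBody])).trans hs₁.L)
  intro l hl s₂ h33 hf₂ hI₂
  have hs₂ : Env π s₂ := hs₁.frame hf₂
    (by intro x; simp [Cmd.WV, mergeBody, search, searchBody]; omega)
    (by simp [Cmd.WA, mergeBody, search, searchBody]; omega)
  have hX₂ : sampleX s₂ t = X := by
    rw [← hX₁]
    exact sampleX_congr (hf₂.wa _ (by simp [Cmd.WA, mergeBody, search, searchBody]; omega)) _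
      (hf₂.ra _ (by simp [Cmd.RA, mergeBody, search, searchBody]))
  refine Runs.mono (Runs.times (N := π.m)
    (fun p s => SortedAt π.m t X l π.m s ∧ SortedAt π.m t X (l + 1) p s) hmw ?_ ?_ ?_
    ⟨hI₂, fun q hq => by omega⟩ ?_ (Tb := (π.L + 1) * 5 + 3 + 12) le_rfl) (by ring_nf; omega)
    fun s' _ h => h.2
  · simp [Cmd.WV, mergeBody, search, searchBody]
  · exact fun i s v h => h
  · intro s' hf
    exact eval_var ((hf.wv 6 (by simp [Cmd.WV, mergeBody, search, searchBody])).trans hs₂.m)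
  intro p hp s₃ h21 hf₃ hI₃
  have hs₃ : Env π s₃ := hs₂.frame hf₃
    (by intro x; simp [Cmd.WV, mergeBody, search, searchBody]; omega)
    (by simp [Cmd.WA, mergeBody, search, searchBody]; omega)
  have hX₃ : sampleX s₃ t = X := by
    rw [← hX₂]
    exact sampleX_congr (hf₃.wa _ (by simp [Cmd.WA, mergeBody, search, searchBody]; omega)) _
      (hf₃.ra _ (by simp [Cmd.RA, mergeBody, search, searchBody]))
  have := runs_mergeBody π (t := t) hs₃ hl hp
    ((hf₃.wv 33 (by simp [Cmd.WV, mergeBody, search, searchBody])).trans h33) h21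
    (hX₃ ▸ hI₃.1) (hX₃ ▸ hI₃.2)
  rwa [hX₃] at this

end RealRAM


namespace RealRAM

/-- Sorts the sample points by each of the first `d` coordinates. -/
def sortAll (d : ℕ) : Cmd := .all sortCmd d

theorem sortAll_WV {d x : ℕ} (h : (sortAll d).WV x) : 21 ≤ x := by
  simp [sortAll, Cmd.WV_all, sortCmd, Cmd.WV, mergeBody, search, searchBody] at h
  omega

theorem sortAll_WA {d a : ℕ} (h : (sortAll d).WA a) : 10 ≤ a := by
  simp [sortAll, Cmd.WA_all, sortCmd, Cmd.WA, mergeBody, search, searchBody] at h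
  omega

theorem sortAll_RA {d a : ℕ} : ¬ (sortAll d).RA a := by
  simp [sortAll, Cmd.RA_all, sortCmd, Cmd.RA, mergeBody, search, searchBody]

theorem runs_sortAll (π : Params) {s : Store} (hs : Env π s) :
    Runs π.w (sortAll π.d) s
      (π.d * (π.m * 6 + 3 + (π.L * (π.m * (5 * π.L + 23) + 3 + 3) + 3) + 1 + 1) + 1)
      fun s' => ∀ t < π.d, SortedAt π.m t (sampleX s t) π.L π.m s' := by
  refine Runs.all (fun t s' => ∀ t' < t, SortedAt π.m t' (sampleX s t') π.L π.m s') π.d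
    (fun t ht => by omega) ?_
  intro t ht s₁ hf hI
  have hs₁ : Env π s₁ := hs.frame hf (fun x _ hx h => by have := sortAll_WV h; omega)
    (fun h => by have := sortAll_WA h; omega)
  have hX : sampleX s₁ t = sampleX s t := sampleX_congr
    (hf.wa _ (fun h => by have := sortAll_WA h; omega)) _ (hf.ra _ sortAll_RA)
  refine Runs.mono (runs_sortCmd π t hs₁) le_rfl fun s₂ hf₂ h₂ t' ht' => ?_
  rcases Nat.lt_succ_iff_lt_or_eq.1 ht' with ht' | rfl
  · have h1 := hf₂.wa (10 + 2 * t') (by simp [sortCmd, Cmd.WA, mergeBody, search, searchBody]; omega)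
    have h2 := hf₂.wa (11 + 2 * t') (by simp [sortCmd, Cmd.WA, mergeBody, search, searchBody]; omega)
    simp only [SortedAt, h1, h2]
    exact hI t' ht'
  · rwa [hX] at h₂

/-! ## Cells -/

/-- Variables `7` and `6` hold `L` and `m`: the ranks are in the last row of the sorting table. -/
def rankE (t : ℕ) (p : WExp) : WExp := .get (10 + 2 * t) (.add (.mul (.var 7) (.var 6)) p)

/-- The value of `e` divided `t` times by the value of `v`. -/
def shiftE (e v : WExp) : ℕ → WExp
  | 0 => e
  | t + 1 => .div (shiftE e v t) v

def digitE (e v : WExp) (t : ℕ) : WExp := .mod (shiftE e v t) v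

def keyE (p lam : WExp) : ℕ → WExp
  | 0 => lam
  | t + 1 => .add (.mul (keyE p lam t) (.var 6))
      (.div (rankE t p) (.get 1 (digitE lam (.var 8) t)))

/-- The parameters, the ranks and the sorted sequences are in the memory. -/
structure Ready (π : Params) (rank srt : ℕ → ℕ → ℕ) (s : Store) : Prop where
  env : Env π s
  rank_lt : ∀ t < π.d, ∀ p < π.m, rank t p < π.m
  rank : ∀ t < π.d, ∀ p < π.m, s.warr (10 + 2 * t) (π.L * π.m + p) = rank t p
  srt : ∀ t < π.d, ∀ x, s.warr (11 + 2 * t) (π.L * π.m + x) = srt t x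

theorem Ready.frame {π : Params} {rank srt : ℕ → ℕ → ℕ} {s s' : Store} {c : Cmd}
    (h : Ready π rank srt s) (hf : Frame c s s') (hv : ∀ x, 6 ≤ x → x ≤ 14 → ¬ c.WV x)
    (ha : ¬ c.WA 1) (ha' : ∀ a, 10 ≤ a → ¬ c.WA a) : Ready π rank srt s' where
  env := h.env.frame hf hv ha
  rank_lt := h.rank_lt
  rank t ht p hp := by rw [hf.wa _ (ha' _ (by omega)), h.rank t ht p hp]
  srt t ht x := by rw [hf.wa _ (ha' _ (by omega)), h.srt t ht x]

theorem Ready.setW {π : Params} {rank srt : ℕ → ℕ → ℕ} {s : Store} (h : Ready π rank srt s) {x v : ℕ}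
    (hx : 14 < x) : Ready π rank srt (s.setW x v) :=
  ⟨h.env.setW hx, h.rank_lt, h.rank, h.srt⟩

theorem eval_shiftE {w : ℕ} {s : Store} {e f : WExp} {a b : ℕ} (he : e.eval w s = a)
    (hf : f.eval w s = b) (t : ℕ) : (shiftE e f t).eval w s = a / b ^ t := by
  induction t with
  | zero => simpa [shiftE] using he
  | succ t ih => rw [shiftE, eval_div ih hf, Nat.div_div_eq_div_mul, pow_succ]

theorem eval_digitE {w : ℕ} {s : Store} {e f : WExp} {a b : ℕ} (he : e.eval w s = a)
    (hf : f.eval w s = b) (t : ℕ) : (digitE e f t).eval w s = digit b a t :=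
  eval_mod (eval_shiftE he hf t) hf

section Ready

variable {π : Params} {rank srt : ℕ → ℕ → ℕ} {s : Store} (hs : Ready π rank srt s)

include hs

theorem eval_rankE {t p : ℕ} {e : WExp} (ht : t < π.d) (hp : p < π.m) (he : e.eval π.w s = p) :
    (rankE t e).eval π.w s = rank t p := by
  rw [rankE, eval_get (eval_mul_add (eval_var hs.env.L) (eval_var hs.env.m) he ?_), hs.rank t ht p hp]
  have := π.sort_lt; rw [add_mul] at this; omega

theorem eval_levelE {lam : ℕ} {e : WExp} (he : e.eval π.w s = lam) (t : ℕ) :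
    (WExp.get 1 (digitE e (.var 8) t)).eval π.w s = 2 ^ digit π.Lam lam t := by
  rw [eval_get (eval_digitE he (eval_var hs.env.Lam) t)]
  exact hs.env.pw _ (Nat.mod_lt _ (by have := π.hL; omega))

theorem eval_keyE {p lam : ℕ} {e f : WExp} (he : e.eval π.w s = p) (hf : f.eval π.w s = lam)
    (hp : p < π.m) (hlam : lam < π.D) :
    (keyE e f π.d).eval π.w s = cellKey rank π.Lam π.m lam p π.d := by
  suffices h : ∀ t ≤ π.d, (keyE e f t).eval π.w s = cellKey rank π.Lam π.m lam p t from h _ le_rfl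
  intro t
  induction t with
  | zero => exact fun _ => hf
  | succ t ih =>
    intro ht
    refine eval_mul_add (ih (by omega)) (eval_var hs.env.m)
      (eval_div (eval_rankE hs (by omega) hp he) (eval_levelE hs hf t)) ?_
    have h := cellKey_lt (rank := rank) (Lam := π.Lam) (m := π.m) (lam := lam) (p := p) (D := π.D)
      (d := t + 1) (fun t' ht' => hs.rank_lt t' (by omega) p hp) hlam
    -- No wrap-around in the partial keys: they stay below the range of the full key.
    have h1 : π.D * π.m ^ (t + 1) ≤ π.D * π.m ^ π.d :=
      Nat.mul_le_mul_left _ (Nat.pow_le_pow_right (by omega) ht)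
    have h2 := Nat.le_mul_of_pos_right (π.D * π.m ^ π.d)
      (Nat.mul_pos (show 0 < π.m by omega) (show 0 < π.D by omega))
    have h3 := π.cell_lt
    exact h.trans_le (by omega)

end Ready

/-- Appends a point to the output. -/
def emit (d : ℕ) (e : ℕ → RExp) : Cmd :=
  .seq (.all (fun t => .rput (d + t) (.var 1) (e t)) d) (.wset 1 (.add (.var 1) (.const 1)))

/-- The point `x` is in the output. -/
def Out (d : ℕ) (s : Store) (x : ℕ → ℝ) : Prop :=
  ∃ i < s.wvar 1, ∀ t < d, s.rarr (d + t) i = x t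

theorem emit_WV {d y : ℕ} {e : ℕ → RExp} : (emit d e).WV y ↔ y = 1 := by
  simp [emit, Cmd.WV, Cmd.WV_all]

theorem emit_WA {d y : ℕ} {e : ℕ → RExp} : ¬ (emit d e).WA y := by
  simp [emit, Cmd.WA, Cmd.WA_all]

theorem emit_RA {d y : ℕ} {e : ℕ → RExp} (h : (emit d e).RA y) : d ≤ y := by
  simp only [emit, Cmd.RA, Cmd.RA_all, or_false] at h
  omega

@[simp] theorem putR_rarr (s : Store) (a i : ℕ) (v : ℝ) (b j : ℕ) :
    (s.putR a i v).rarr b j = if b = a ∧ j = i then v else s.rarr b j := by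
  by_cases hb : b = a
  · subst hb; simp [Store.putR, Function.update_apply]
  · simp [Store.putR, hb]

/-- The coordinates are written one after the other, so each expression is evaluated when some cells
of the output arrays have already changed. Hence `he` asks for the value in all stores that agree
with `s` apart from those arrays and the real variables. -/
theorem runs_emit {w d : ℕ} {e : ℕ → RExp} {s : Store} (v : ℕ → ℝ)
    (he : ∀ t < d, ∀ s' : Store, s'.wvar = s.wvar → s'.warr = s.warr →
      (∀ a < d, s'.rarr a = s.rarr a) → (e t).eval w s' = v t)
    (hw : s.wvar 1 + 1 < 2 ^ w) :
    Runs w (emit d e) s (2 * d + 3) fun s' =>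
      s'.wvar 1 = s.wvar 1 + 1 ∧ Out d s' v ∧ ∀ x, Out d s x → Out d s' x := by
  refine Runs.seq (2 * d + 1) 1 (Runs.mono (Runs.all (Tb := 1) (fun t s' =>
    (∀ t' < t, s'.rarr (d + t') (s.wvar 1) = v t') ∧
    ∀ t', ∀ i ≠ s.wvar 1, s'.rarr (d + t') i = s.rarr (d + t') i) d
    ⟨fun t' ht' => by omega, fun _ _ _ => rfl⟩ ?_) (by omega) ?_) (by omega)
  · intro t ht s' hf hI
    have hv : s'.wvar = s.wvar := funext fun x => hf.wv x (by simp [Cmd.WV_all, Cmd.WV])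
    have ha : s'.warr = s.warr := funext fun x => hf.wa x (by simp [Cmd.WA_all, Cmd.WA])
    have hr : ∀ a < d, s'.rarr a = s.rarr a := fun a ha => hf.ra a (by
      simp only [Cmd.RA_all, Cmd.RA]; omega)
    refine Runs.rput (s.wvar 1) (v t) (by rw [WExp.eval, hv]) (he t ht s' hv ha hr) le_rfl ⟨?_, ?_⟩
    · intro t' ht'
      rw [putR_rarr]
      rcases Nat.lt_succ_iff_lt_or_eq.1 ht' with ht' | rfl
      · rw [if_neg (by omega)]; exact hI.1 t' ht'
      · simp
    · intro t' i hi
      rw [putR_rarr, if_neg (by simp [hi])]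
      exact hI.2 t' i hi
  · rintro s' hf ⟨h₁, h₂⟩
    have hv : s'.wvar 1 = s.wvar 1 := hf.wv 1 (by simp [Cmd.WV_all, Cmd.WV])
    refine Runs.wset (s.wvar 1 + 1) (eval_add (eval_var hv) (eval_const (by omega)) hw) le_rfl
      ⟨by simp, ⟨s.wvar 1, by simp, h₁⟩, ?_⟩
    rintro x ⟨i, hi, hx⟩
    refine ⟨i, by simp; omega, fun t ht => ?_⟩
    rw [setW_rarr, h₂ t i hi.ne, hx t ht]

/-- Coordinate `t` of the centre of the cell of point `21` at the levels `22`. -/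
def centerE (t : ℕ) : RExp :=
  .get t (.get 0 (.get (11 + 2 * t) (.add (.mul (.var 7) (.var 6))
    (.div (.mul (.add (.mul (.div (rankE t (.var 21)) (.get 1 (digitE (.var 22) (.var 8) t))) (.const 2))
      (.const 1)) (.get 1 (digitE (.var 22) (.var 8) t))) (.const 2)))))

/-- The tuple may contain levels above `L`, where the middle can lie beyond the last rank. The value
read there is irrelevant, but address and product must not wrap around; `mid_lt` provides for this.
-/
theorem eval_centerE {π : Params} {rank srt : ℕ → ℕ → ℕ} {s : Store} (hs : Ready π rank srt s)
    {t p lam : ℕ} (ht : t < π.d) (hp : p < π.m) (h21 : s.wvar 21 = p) (h22 : s.wvar 22 = lam) :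
    (centerE t).eval π.w s = sampleX s t (srt t (mid (digit π.Lam lam t) (rank t p))) := by
  have h2w : 2 < 2 ^ π.w := by
    calc 2 < 2 ^ 2 := by norm_num
      _ ≤ 2 ^ π.w := Nat.pow_le_pow_right (by norm_num) π.hw
  have hrk := hs.rank_lt t ht p hp
  have hdl : digit π.Lam lam t < π.Lam := Nat.mod_lt _ (by have := π.hL; omega)
  have hpl : 2 ^ digit π.Lam lam t ≤ 2 ^ π.Lam := Nat.pow_le_pow_right (by norm_num) hdl.le
  have hq : rank t p / 2 ^ digit π.Lam lam t * 2 ^ digit π.Lam lam t ≤ rank t p := Nat.div_mul_le_self _ _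
  have hq' : rank t p / 2 ^ digit π.Lam lam t ≤ rank t p := Nat.div_le_self _ _
  have hmid := π.mid_lt
  have hpos : 0 < 2 ^ π.Lam := by positivity
  have hLm := Nat.zero_le (π.L * π.m)
  rw [add_mul] at hmid
  have hprod : (rank t p / 2 ^ digit π.Lam lam t * 2 + 1) * 2 ^ digit π.Lam lam t ≤
      2 * rank t p + 2 ^ π.Lam := by
    calc _ = 2 * (rank t p / 2 ^ digit π.Lam lam t * 2 ^ digit π.Lam lam t) + 2 ^ digit π.Lam lam t := by
          ring
      _ ≤ _ := by omega
  rw [centerE, RExp.eval, WExp.eval, eval_get (eval_mul_add (eval_var hs.env.L) (eval_var hs.env.m)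
    (eval_div (eval_mul (eval_add (eval_mul (eval_div (eval_rankE hs ht hp (eval_var h21))
      (eval_levelE hs (eval_var h22) t)) (eval_const h2w) (by omega)) (eval_const (by omega)) (by omega))
      (eval_levelE hs (eval_var h22) t) (by omega)) (eval_const h2w)) ?_), hs.srt t ht]
  · rfl
  · omega

/-- Enters incidence `20` into the list of its cell, and appends the centre of the cell to the output when
the cell gets more than `T0` points. -/
def cellBody (d : ℕ) : Cmd :=
  .seq (.wset 21 (.div (.var 20) (.var 9)))
  (.seq (.wset 22 (.mod (.var 20) (.var 9)))
  (.seq (.wset 23 (keyE (.var 21) (.var 22) d))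
  (.seq (.ite (.and (.not (.wlt (.get 2 (.var 23)) (.var 10))) (.not (.wlt (.var 10) (.get 2 (.var 23)))))
    (emit d centerE) .skip)
  (.seq (.wput 3 (.add (.mul (.var 23) (.var 14)) (.get 2 (.var 23))) (.var 21))
  (.wput 2 (.var 23) (.add (.get 2 (.var 23)) (.const 1)))))))

/-- The state after the first `z` incidences have been entered. -/
structure CellInv (π : Params) (rank srt : ℕ → ℕ → ℕ) (X : ℕ → ℕ → ℝ) (z : ℕ) (s : Store) : Prop where
  cnt : ∀ κ, s.warr 2 κ = cellCount rank π.Lam π.m π.D π.d z κ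
  mem : ∀ z' < z, s.warr 3 (incKey rank π.Lam π.m π.D π.d z' * (π.m * π.D) +
    cellCount rank π.Lam π.m π.D π.d z' (incKey rank π.Lam π.m π.D π.d z')) = z' / π.D
  mem_lt : ∀ x, s.warr 3 x < π.m
  out : s.wvar 1 = ((Finset.range (π.D * π.m ^ π.d)).filter fun κ =>
    π.T0 + 1 ≤ cellCount rank π.Lam π.m π.D π.d z κ).card
  center : ∀ κ, π.T0 < cellCount rank π.Lam π.m π.D π.d z κ → ∃ z' < z,
    incKey rank π.Lam π.m π.D π.d z' = κ ∧
    Out π.d s fun t => X t (srt t (mid (digit π.Lam (z' % π.D) t) (rank t (z' / π.D))))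

theorem cellBody_WV {d x : ℕ} (h : (cellBody d).WV x) : x = 1 ∨ x = 21 ∨ x = 22 ∨ x = 23 := by
  simp [cellBody, Cmd.WV, emit_WV] at h
  omega

theorem cellBody_WA {d x : ℕ} (h : (cellBody d).WA x) : x = 2 ∨ x = 3 := by
  simp [cellBody, Cmd.WA, emit_WA] at h
  omega

theorem cellBody_RA {d x : ℕ} (h : (cellBody d).RA x) : d ≤ x := by
  simp only [cellBody, Cmd.RA, or_false, false_or] at h
  exact emit_RA h

/-- A centre is written at the moment when the count of its cell passes from `T0` to `T0 + 1`, hence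
once per heavy cell. The output size therefore equals the number of heavy cells at any time. -/
theorem runs_cellBody (π : Params) {rank srt : ℕ → ℕ → ℕ} {X : ℕ → ℕ → ℝ} {z : ℕ} {s : Store}
    (hs : Ready π rank srt s) (hX : ∀ t < π.d, sampleX s t = X t) (hz : z < π.m * π.D)
    (h20 : s.wvar 20 = z) (hI : CellInv π rank srt X z s) :
    Runs π.w (cellBody π.d) s (2 * π.d + 14) (CellInv π rank srt X (z + 1)) := by
  have hD : 0 < π.D := Nat.pos_of_ne_zero (by intro h; simp [h] at hz)
  have hp : z / π.D < π.m := div_lt_of_lt_mul' hz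
  have hlam : z % π.D < π.D := Nat.mod_lt _ hD
  set κ := incKey rank π.Lam π.m π.D π.d z with hκ
  have hκlt : κ < π.D * π.m ^ π.d := incKey_lt hs.rank_lt hz
  set c := cellCount rank π.Lam π.m π.D π.d z κ with hc
  have hcz : c ≤ z := Nat.count_le _
  have hcell := π.cell_lt
  have haddr : κ * (π.m * π.D) + c < 2 ^ π.w := by
    have := Nat.mul_le_mul_right (π.m * π.D) hκlt.le
    omega
  have hKw : π.D * π.m ^ π.d < 2 ^ π.w := by
    have := Nat.le_mul_of_pos_right (π.D * π.m ^ π.d) (show 0 < π.m * π.D by omega)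
    omega
  have hκw : κ < 2 ^ π.w := by omega
  have hcount : ∀ κ', cellCount rank π.Lam π.m π.D π.d (z + 1) κ' =
      if κ' = κ then c + 1 else cellCount rank π.Lam π.m π.D π.d z κ' := by
    intro κ'
    rw [cellCount, Nat.count_succ]
    by_cases h : κ' = κ
    · subst h; simp [hκ, hc, cellCount]
    · rw [if_neg h, if_neg (fun h' => h (h'.symm.trans hκ.symm))]; rfl
  refine Runs.mono (T := 2 * π.d + 14) ?_ le_rfl (fun _ _ h => h)
  refine Runs.seq_wset (T := 2 * π.d + 12) (z / π.D) (eval_div (eval_var h20) (eval_var hs.env.D)) ?_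
  have hs₁ := hs.setW (v := z / π.D) (show 14 < 21 by norm_num)
  refine Runs.seq_wset (T := 2 * π.d + 10) (z % π.D) (eval_mod (eval_var (by simp [h20]))
    (eval_var hs₁.env.D)) ?_
  have hs₂ := hs₁.setW (v := z % π.D) (show 14 < 22 by norm_num)
  refine Runs.seq_wset (T := 2 * π.d + 8) κ (eval_keyE hs₂ (eval_var (by simp)) (eval_var (by simp))
    hp hlam) ?_
  have hs₃ := hs₂.setW (v := κ) (show 14 < 23 by norm_num)
  set s₃ := ((s.setW 21 (z / π.D)).setW 22 (z % π.D)).setW 23 κ with hs₃d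
  have h21₃ : s₃.wvar 21 = z / π.D := by simp [hs₃d]
  have h22₃ : s₃.wvar 22 = z % π.D := by simp [hs₃d]
  have h23₃ : s₃.wvar 23 = κ := by simp [hs₃d]
  have h1₃ : s₃.wvar 1 = s.wvar 1 := by simp [hs₃d]
  have hOut₃ : ∀ x, Out π.d s x → Out π.d s₃ x := by
    rintro x ⟨i, hi, h⟩; exact ⟨i, by rw [h1₃]; exact hi, h⟩
  have hcnt₃ : (WExp.get 2 (.var 23)).eval π.w s₃ = c := by
    rw [eval_get (eval_var h23₃)]; exact hI.cnt κ
  have hcnt₃' : s₃.warr 2 (s₃.wvar 23) = c := hcnt₃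
  -- Each incidence gets its own number within its cell, so the new entry overwrites no earlier one.
  have hmono : ∀ z', z' < z → incKey rank π.Lam π.m π.D π.d z' = κ →
      cellCount rank π.Lam π.m π.D π.d z' κ < c := fun z' hz' h' =>
    Nat.count_strict_mono (p := fun z => incKey rank π.Lam π.m π.D π.d z = κ) h' hz'
  refine Runs.seq (2 * π.d + 4) 3 (T := 2 * π.d + 8) (Runs.mono (T := 2 * π.d + 4) (Q := fun s' =>
      s'.wvar 1 = ((Finset.range (π.D * π.m ^ π.d)).filter fun κ' =>
        π.T0 + 1 ≤ cellCount rank π.Lam π.m π.D π.d (z + 1) κ').card ∧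
      ∀ κ', π.T0 < cellCount rank π.Lam π.m π.D π.d (z + 1) κ' → ∃ z' < z + 1,
        incKey rank π.Lam π.m π.D π.d z' = κ' ∧
        Out π.d s' fun t => X t (srt t (mid (digit π.Lam (z' % π.D) t) (rank t (z' / π.D))))) ?_ le_rfl
      ?_) (by omega)
  · refine Runs.ite (T := 2 * π.d + 3) (fun hh => ?_) (fun hh => ?_) le_rfl
    · simp only [Test.holds, hcnt₃', WExp.eval, hs₃.env.T0, not_lt] at hh
      have hcT : c = π.T0 := le_antisymm hh.2 hh.1
      refine Runs.mono (runs_emit (fun t => X t (srt t (mid (digit π.Lam (z % π.D) t) (rank t (z / π.D)))))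
        ?_ ?_) le_rfl ?_
      · intro t ht s' hv ha hr
        have hs' : Ready π rank srt s' := by
          obtain ⟨h1, h2, h3, h4⟩ := hs₃
          refine ⟨?_, h2, by rwa [ha], by rwa [ha]⟩
          obtain ⟨h1, h2, h3, h4, h5, h6, h7, h8, h9, h10⟩ := h1
          constructor <;> first | rw [hv] | rw [ha]
          all_goals assumption
        rw [eval_centerE hs' ht hp (by rw [hv, h21₃]) (by rw [hv, h22₃]), ← hX t ht,
          sampleX_congr (s := s) (by rw [ha]; rfl) t (by rw [hr t ht]; rfl)]
      · rw [h1₃, hI.out]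
        have : ((Finset.range (π.D * π.m ^ π.d)).filter fun κ' =>
            π.T0 + 1 ≤ cellCount rank π.Lam π.m π.D π.d z κ').card < (Finset.range (π.D * π.m ^ π.d)).card := by
          refine Finset.card_lt_card (Finset.filter_ssubset.2 ⟨κ, Finset.mem_range.2 hκlt, ?_⟩)
          omega
        rw [Finset.card_range] at this
        omega
      · rintro s' hf' ⟨h1, h2, h3⟩
        refine ⟨?_, fun κ' hκ' => ?_⟩
        · rw [h1, h1₃, hI.out, ← Finset.card_insert_of_notMem (a := κ)]
          · congr 1
            ext κ'
            simp only [Finset.mem_insert, Finset.mem_filter, Finset.mem_range, hcount]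
            by_cases h : κ' = κ
            · subst h; simp [hκlt, hcT]
            · simp [h]
          · simp only [Finset.mem_filter, not_and]; omega
        · rw [hcount] at hκ'
          split_ifs at hκ' with h
          · exact ⟨z, by omega, h.symm, h2⟩
          · obtain ⟨z', hz', h4, h5⟩ := hI.center κ' hκ'
            exact ⟨z', by omega, h4, h3 _ (hOut₃ _ h5)⟩
    · have hcT : c ≠ π.T0 := by
        rintro h
        exact hh (by simp only [Test.holds, hcnt₃', WExp.eval, hs₃.env.T0]; omega)
      refine Runs.skip (by omega) ⟨?_, fun κ' hκ' => ?_⟩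
      · rw [h1₃, hI.out]
        congr 1
        ext κ'
        simp only [Finset.mem_filter, hcount]
        by_cases h : κ' = κ
        · rw [h, if_pos rfl, ← hc]
          constructor <;> rintro ⟨h1, h2⟩ <;> exact ⟨h1, by omega⟩
        · simp [h]
      · rw [hcount] at hκ'
        have : π.T0 < cellCount rank π.Lam π.m π.D π.d z κ' := by
          split_ifs at hκ' with h
          · subst h; omega
          · exact hκ'
        obtain ⟨z', hz', h4, h5⟩ := hI.center κ' this
        exact ⟨z', by omega, h4, hOut₃ _ h5⟩
  · rintro s₄ hf ⟨hout, hcen⟩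
    have hs₄ := hs₃.frame hf (by intro x; simp [Cmd.WV, emit_WV]; omega) (by simp [Cmd.WA, emit_WA])
      (by simp [Cmd.WA, emit_WA])
    have ha₄ : ∀ a, s₄.warr a = s.warr a := fun a => hf.wa a (by simp [Cmd.WA, emit_WA])
    have h21₄ : s₄.wvar 21 = z / π.D := by rw [hf.wv 21 (by simp [Cmd.WV, emit_WV]), h21₃]
    have h23₄ : s₄.wvar 23 = κ := by rw [hf.wv 23 (by simp [Cmd.WV, emit_WV]), h23₃]
    have hcnt₄ : (WExp.get 2 (.var 23)).eval π.w s₄ = c := by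
      rw [eval_get (eval_var h23₄), ha₄]; exact hI.cnt κ
    refine Runs.seq 1 1 (Runs.wput (κ * (π.m * π.D) + c) (z / π.D) (eval_mul_add (eval_var h23₄)
      (eval_var hs₄.env.Z) hcnt₄ haddr) (eval_var h21₄) le_rfl ?_) le_rfl
    refine Runs.wput κ (c + 1) (eval_var h23₄) (eval_add ?_ (eval_const ?_) ?_) le_rfl ?_
    · rw [WExp.eval, WExp.eval, putW_wvar, putW_warr, if_neg (by simp), h23₄, ha₄]; exact hI.cnt κ
    · have := π.hw
      calc 1 < 2 ^ 2 := by norm_num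
        _ ≤ 2 ^ π.w := Nat.pow_le_pow_right (by norm_num) π.hw
    · omega
    · refine ⟨fun κ' => ?_, fun z' hz' => ?_, fun x => ?_, hout, fun κ' hκ' => hcen κ' hκ'⟩
      · rw [putW_warr, hcount]
        by_cases h : κ' = κ
        · simp [h]
        · simp [h, ha₄, hI.cnt]
      · rw [putW_warr, if_neg (by simp), putW_warr]
        rcases Nat.lt_succ_iff_lt_or_eq.1 hz' with hz' | rfl
        · rw [if_neg, ha₄]
          · exact hI.mem z' hz'
          -- Counts are below `m * D`, so equal addresses mean equal cells and then equal counts,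
          -- which contradicts `hmono`.
          · rintro ⟨-, h⟩
            set κ' := incKey rank π.Lam π.m π.D π.d z' with hκ'
            have h1 : cellCount rank π.Lam π.m π.D π.d z' κ' ≤ z' := Nat.count_le _
            have h2 := congrArg (· / (π.m * π.D)) h
            simp only [mul_comm _ (π.m * π.D), Nat.mul_add_div (show 0 < π.m * π.D by omega),
              Nat.div_eq_of_lt (show cellCount rank π.Lam π.m π.D π.d z' κ' < π.m * π.D by omega),
              Nat.div_eq_of_lt (show c < π.m * π.D by omega), add_zero] at h2
            have h3 := hmono z' hz' h2
            rw [h2] at h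
            omega
        · simp [← hκ, ← hc]
      · rw [putW_warr, if_neg (by simp), putW_warr, ha₄]
        split_ifs
        exacts [hp, hI.mem_lt x]

end RealRAM


namespace RealRAM

/-- Enters all incidences into the lists of their cells. -/
def cellsCmd (d : ℕ) : Cmd := .times 20 (.var 14) (cellBody d)

theorem cellsCmd_WV {d x : ℕ} (h : (cellsCmd d).WV x) : x = 1 ∨ 20 ≤ x := by
  simp only [cellsCmd, Cmd.WV_times] at h
  rcases h with h | h
  · omega
  · have := cellBody_WV h; omega

theorem cellsCmd_WA {d x : ℕ} (h : (cellsCmd d).WA x) : x = 2 ∨ x = 3 :=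
  cellBody_WA (by simpa only [cellsCmd, Cmd.WA_times] using h)

theorem cellsCmd_RA {d x : ℕ} (h : (cellsCmd d).RA x) : d ≤ x :=
  cellBody_RA (by simpa only [cellsCmd, Cmd.RA_times] using h)

/-- The initial zeros are used as empty lists and counts: clearing the arrays would take far too
long. -/
theorem runs_cellsCmd (π : Params) {rank srt : ℕ → ℕ → ℕ} {s : Store}
    (hs : Ready π rank srt s) (h2 : ∀ κ, s.warr 2 κ = 0) (h3 : ∀ x, s.warr 3 x = 0) (h1 : s.wvar 1 = 0) :
    Runs π.w (cellsCmd π.d) s (π.m * π.D * (2 * π.d + 14 + 3) + 3)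
      (CellInv π rank srt (sampleX s) (π.m * π.D)) := by
  refine Runs.times (CellInv π rank srt (sampleX s)) ?_ ?_ ?_ ?_ ?_ ?_ le_rfl
  · have := π.cell_lt; omega
  · intro h; have := cellBody_WV h; omega
  · intro z s' v hI
    refine ⟨hI.cnt, hI.mem, hI.mem_lt, by simpa using hI.out, fun κ hκ => ?_⟩
    obtain ⟨z', hz', h, i, hi, h'⟩ := hI.center κ hκ
    exact ⟨z', hz', h, i, by simpa using hi, h'⟩
  · intro s' hf
    exact eval_var ((hf.wv 14 (fun h => by have := cellsCmd_WV h; omega)).trans hs.env.Z)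
  · refine ⟨fun κ => by simp [h2, cellCount], fun z' hz' => by omega, fun x => ?_, ?_, fun κ hκ => ?_⟩
    · rw [h3, π.hm]; positivity
    · simp [h1, cellCount]
    · simp [cellCount] at hκ
  · intro z hz s' h20 hf hI
    refine runs_cellBody π (hs.frame hf (fun x _ _ h => by have := cellsCmd_WV h; omega)
      (fun h => by have := cellsCmd_WA h; omega) (fun a _ h => by have := cellsCmd_WA h; omega))
      (fun t ht => ?_) hz h20 hI
    exact sampleX_congr (hf.wa _ fun h => by have := cellsCmd_WA h; omega) _
      (hf.ra _ fun h => by have := cellsCmd_RA h; omega)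

/-! ## The greedy algorithm -/

/-- Everything that the greedy algorithm reads but does not change. -/
structure Cells (π : Params) (rank srt : ℕ → ℕ → ℕ) (X : ℕ → ℕ → ℝ) (M : ℕ → ℕ → ℕ) (s : Store) :
    Prop where
  ready : Ready π rank srt s
  X_eq : ∀ t < π.d, sampleX s t = X t
  cnt : ∀ κ, s.warr 2 κ = cellCount rank π.Lam π.m π.D π.d (π.m * π.D) κ
  mem : ∀ κ i, s.warr 3 (κ * (π.m * π.D) + i) = M κ i
  lists : CellLists rank π.Lam π.m π.D π.d M
  mem_lt : ∀ κ i, M κ i < π.m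

theorem Cells.frame {π : Params} {rank srt : ℕ → ℕ → ℕ} {X : ℕ → ℕ → ℝ} {M : ℕ → ℕ → ℕ} {s s' : Store}
    {c : Cmd} (h : Cells π rank srt X M s) (hf : Frame c s s') (hv : ∀ x, c.WV x → x = 1 ∨ 20 ≤ x)
    (ha : ∀ a, c.WA a → a = 4) (hr : ∀ a, c.RA a → π.d ≤ a) : Cells π rank srt X M s' where
  ready := h.ready.frame hf (fun x _ _ h => by have := hv x h; omega)
    (fun h => by have := ha _ h; omega) (fun a _ h => by have := ha _ h; omega)
  X_eq t ht := by
    rw [← h.X_eq t ht]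
    exact sampleX_congr (hf.wa _ fun h => by have := ha _ h; omega) _
      (hf.ra _ fun h => by have := hr _ h; omega)
  cnt κ := by rw [hf.wa _ fun h => by have := ha _ h; omega, h.cnt]
  mem κ i := by rw [hf.wa _ fun h => by have := ha _ h; omega, h.mem]
  lists := h.lists
  mem_lt := h.mem_lt

theorem Cells.setW {π : Params} {rank srt : ℕ → ℕ → ℕ} {X : ℕ → ℕ → ℝ} {M : ℕ → ℕ → ℕ} {s : Store}
    (h : Cells π rank srt X M s) {x v : ℕ} (hx : 14 < x) : Cells π rank srt X M (s.setW x v) :=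
  ⟨h.ready.setW hx, h.X_eq, h.cnt, h.mem, h.lists, h.mem_lt⟩

def cornerE (i : ℕ) : WExp := .get 3 (.add (.mul (.var 23) (.var 14)) (digitE (.var 25) (.var 10) i))

/-- The point `q` is in the box with code `25` of the cell `23`. -/
def inBoxT (q : WExp) : ℕ → Test
  | 0 => .not (.wlt (.const 0) (.const 0))
  | t + 1 => .and (inBoxT q t) (.and (.not (.wlt (rankE t q) (rankE t (cornerE (2 * t)))))
      (.not (.wlt (rankE t (cornerE (2 * t + 1))) (rankE t q))))

def innerBody (d : ℕ) : Cmd :=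
  .seq (.wset 27 (.get 3 (.add (.mul (.var 23) (.var 14)) (.var 26))))
  (.ite (inBoxT (.var 27) d)
    (.seq (.wset 28 (.add (.var 28) (.const 1))) (.wset 29 (.add (.var 29) (.get 4 (.var 27))))) .skip)

/-- Counts the points of the cell `23` in the box with code `25`, and those among them that have been
taken. -/
def inner (d : ℕ) : Cmd := .times 26 (.get 2 (.var 23)) (innerBody d)

/-- Increases variable `30` if the box with code `24` is to be hit and contains point `21`. -/
def boxBody (d : ℕ) : Cmd :=
  .seq (.wset 22 (.mod (.var 24) (.var 9)))
  (.seq (.wset 25 (.div (.var 24) (.var 9)))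
  (.seq (.wset 23 (keyE (.var 21) (.var 22) d))
  (.seq (.wset 28 (.const 0))
  (.seq (.wset 29 (.const 0))
  (.ite (.wlt (.var 10) (.get 2 (.var 23))) .skip
    (.seq (inner d)
    (.ite (.and (inBoxT (.var 21) d) (.and (.not (.wlt (.var 28) (.var 11)))
        (.not (.wlt (.const 0) (.var 29)))))
      (.wset 30 (.add (.var 30) (.const 1))) .skip)))))))

/-- Takes point `21` if it is in at least `31` of the boxes that are still to be hit. -/
def pointBody (d : ℕ) : Cmd :=
  .seq (.wset 30 (.const 0))
  (.seq (.times 24 (.var 12) (boxBody d))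
  (.ite (.wlt (.var 30) (.var 31)) .skip
    (.seq (.wput 4 (.var 21) (.const 1)) (emit d fun t => .get t (.get 0 (.var 21))))))

def greedyCmd (d : ℕ) : Cmd :=
  .seq (.wset 31 (.var 12))
  (.times 32 (.var 13) (.seq (.times 21 (.var 6) (pointBody d)) (.wset 31 (.div (.var 31) (.const 2)))))

section Greedy

variable {π : Params} {rank srt : ℕ → ℕ → ℕ} {X : ℕ → ℕ → ℝ} {M : ℕ → ℕ → ℕ} {s : Store}

theorem two_lt (π : Params) : 2 < 2 ^ π.w := by
  calc 2 < 2 ^ 2 := by norm_num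
    _ ≤ 2 ^ π.w := Nat.pow_le_pow_right (by norm_num) π.hw

/-- A digit of the code may point behind the end of the list of the cell. The entry found there is
still below `m`, so the comparison makes sense; such codes only add harmless boxes to the
candidates. -/
theorem inBoxT_holds (hs : Cells π rank srt X M s) {κ τ q : ℕ} {e : WExp} (h23 : s.wvar 23 = κ)
    (h25 : s.wvar 25 = τ) (hκ : κ < π.D * π.m ^ π.d) (he : e.eval π.w s = q) (hq : q < π.m) :
    (inBoxT e π.d).holds π.w s ↔ InBox rank π.d π.T0 M κ τ q := by
  have hcorner : ∀ i, (cornerE i).eval π.w s = M κ (digit π.T0 τ i) := by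
    intro i
    have h1 : digit π.T0 τ i < π.T0 := Nat.mod_lt _ π.T0_pos
    have h2 := Nat.mul_le_mul_right (π.m * π.D) hκ.le
    have h3 := π.cell_lt
    rw [cornerE, eval_get (eval_mul_add (eval_var h23) (eval_var hs.ready.env.Z)
      (eval_digitE (eval_var h25) (eval_var hs.ready.env.T0) i) (by omega)), hs.mem]
  suffices h : ∀ d ≤ π.d, (inBoxT e d).holds π.w s ↔ InBox rank d π.T0 M κ τ q from h _ le_rfl
  intro d
  induction d with
  | zero => intro _; simp [inBoxT, Test.holds, WExp.eval, InBox]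
  | succ d ih =>
    intro hd
    simp only [inBoxT, Test.holds, ih (by omega), eval_rankE hs.ready (t := d) (by omega) hq he,
      eval_rankE hs.ready (t := d) (by omega) (hs.mem_lt _ _) (hcorner _), not_lt]
    simp only [InBox, Nat.lt_succ_iff_lt_or_eq, or_imp, forall_and, forall_eq]
    tauto

-- Variable `28` counts the points of the box and variable `29` the taken ones among them; so
-- validity and "not hit yet" are recomputed at each use and need no storage.
open Classical in
theorem runs_inner (hs : Cells π rank srt X M s) {κ τ : ℕ} {R : Finset ℕ} (h23 : s.wvar 23 = κ)
    (h25 : s.wvar 25 = τ) (hκ : κ < π.D * π.m ^ π.d) (h28 : s.wvar 28 = 0) (h29 : s.wvar 29 = 0)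
    (hR : ∀ q, s.warr 4 q = if q ∈ R then 1 else 0)
    (hT : cellCount rank π.Lam π.m π.D π.d (π.m * π.D) κ ≤ π.T0) :
    Runs π.w (inner π.d) s (π.T0 * (7 + 3) + 3) fun s' =>
      s'.wvar 28 = (boxPts rank π.Lam π.m π.D π.d π.T0 M (κ, τ)).card ∧
      (s'.wvar 29 = 0 ↔ Disjoint (boxPts rank π.Lam π.m π.D π.d π.T0 M (κ, τ)) R) := by
  have hcell := π.cell_lt
  have hWV : ∀ x, (inner π.d).WV x → x = 26 ∨ x = 27 ∨ x = 28 ∨ x = 29 := by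
    intro x hx; simp [inner, innerBody, Cmd.WV] at hx; omega
  have hWA : ∀ x, ¬ (inner π.d).WA x := by
    intro x hx; simp [inner, innerBody, Cmd.WA] at hx
  have hRA : ∀ x, ¬ (inner π.d).RA x := by
    intro x hx; simp [inner, innerBody, Cmd.RA] at hx
  set B := InBox rank π.d π.T0 M κ τ with hB
  set f : ℕ → ℕ := fun q => if B q then 1 else 0 with hf
  set g : ℕ → ℕ := fun q => if B q ∧ q ∈ R then 1 else 0 with hg
  have hle : ∀ (φ : ℕ → ℕ), (∀ q, φ q ≤ 1) → ∀ i, ∑ i' ∈ Finset.range i, φ (M κ i') ≤ i := by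
    intro φ hφ i
    calc _ ≤ ∑ i' ∈ Finset.range i, 1 := Finset.sum_le_sum fun i' _ => hφ _
      _ = i := by simp
  have hfle : ∀ q, f q ≤ 1 := fun q => by simp only [hf]; split_ifs <;> simp
  have hgle : ∀ q, g q ≤ 1 := fun q => by simp only [hg]; split_ifs <;> simp
  refine Runs.mono (Runs.times (N := cellCount rank π.Lam π.m π.D π.d (π.m * π.D) κ) (Tb := 7)
    (fun i s' => s'.wvar 28 = ∑ i' ∈ Finset.range i, f (M κ i') ∧
      s'.wvar 29 = ∑ i' ∈ Finset.range i, g (M κ i')) (by omega) ?_ ?_ ?_ ?_ ?_ le_rfl) ?_ ?_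
  · simp [innerBody, Cmd.WV]
  · intro i s' v h; simpa using h
  · intro s' hf'
    rw [eval_get (eval_var ((hf'.wv 23 fun h => by have := hWV _ h; omega).trans h23)),
      hf'.wa 2 (hWA _), hs.cnt]
  · simp [h28, h29]
  · rintro i hi s₁ h26 hf₁ ⟨h28₁, h29₁⟩
    have hs₁ := hs.frame hf₁ (fun x h => by have := hWV _ h; omega) (fun x h => absurd h (hWA x))
      (fun x h => absurd h (hRA x))
    have h23₁ : s₁.wvar 23 = κ := (hf₁.wv 23 fun h => by have := hWV _ h; omega).trans h23
    have h25₁ : s₁.wvar 25 = τ := (hf₁.wv 25 fun h => by have := hWV _ h; omega).trans h25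
    have hR₁ : ∀ q, s₁.warr 4 q = if q ∈ R then 1 else 0 := by rw [hf₁.wa 4 (hWA _)]; exact hR
    have h1 := Nat.mul_le_mul_right (π.m * π.D) hκ.le
    have h2 := hle f hfle i
    have h3 := hle g hgle i
    have h2w := two_lt π
    refine Runs.mono (T := 7) ?_ le_rfl fun _ _ h => h
    refine Runs.seq_wset (T := 5) (M κ i) ?_ ?_
    · rw [eval_get (eval_mul_add (eval_var h23₁) (eval_var hs₁.ready.env.Z) (eval_var h26) (by omega)),
        hs₁.mem]
    have hs₂ := hs₁.setW (v := M κ i) (show 14 < 27 by norm_num)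
    have hiff := inBoxT_holds hs₂ (e := .var 27) (q := M κ i) (τ := τ) (by simpa using h23₁)
      (by simpa using h25₁) hκ (eval_var (by simp)) (hs.mem_lt κ i)
    refine Runs.ite (T := 4) (fun hh => ?_) (fun hh => ?_) (by omega)
    · have hb : B (M κ i) := hiff.1 hh
      refine Runs.mono (T := 3) ?_ (by omega) fun _ _ h => h
      refine Runs.seq_wset (T := 1) (∑ i' ∈ Finset.range i, f (M κ i') + 1)
        (eval_add (eval_var (by simpa using h28₁)) (eval_const (by omega)) (by omega)) ?_
      refine Runs.wset (∑ i' ∈ Finset.range i, g (M κ i') + g (M κ i))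
        (eval_add (eval_var (by simpa using h29₁)) ?_ ?_) le_rfl ?_
      · rw [eval_get (eval_var (a := M κ i) (by simp)), setW_warr, setW_warr, hR₁]
        simp [hg, hb]
      · have := hgle (M κ i); omega
      · refine ⟨?_, ?_⟩
        · rw [setW_wvar, if_neg (by norm_num), setW_wvar, if_pos rfl, Finset.sum_range_succ,
            show f (M κ i) = 1 from if_pos hb]
        · rw [setW_wvar, if_pos rfl, Finset.sum_range_succ]
    · have hb : ¬ B (M κ i) := fun h => hh (hiff.2 h)
      refine Runs.skip (by omega) ⟨?_, ?_⟩
      · rw [setW_wvar, if_neg (by norm_num), h28₁, Finset.sum_range_succ,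
          show f (M κ i) = 0 from if_neg hb, add_zero]
      · rw [setW_wvar, if_neg (by norm_num), h29₁, Finset.sum_range_succ,
          show g (M κ i) = 0 from if_neg fun h => hb h.1, add_zero]
  · have := Nat.mul_le_mul_right (7 + 3) hT; omega
  · rintro s' - ⟨h1, h2⟩
    rw [h1, h2, sum_cell hs.ready.rank_lt hs.lists, sum_cell hs.ready.rank_lt hs.lists]
    constructor
    · rw [boxPts, Finset.card_filter]
    · rw [Finset.sum_eq_zero_iff, Finset.disjoint_left]
      simp only [hg, boxPts, Finset.mem_filter, ite_eq_right_iff, one_ne_zero, imp_false, not_and, and_imp]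
      rfl

-- Cells with more than `T0` points are skipped before the inner loop: their boxes are not valid,
-- and this keeps the time in `O(T0)`.
open Classical in
theorem runs_boxBody (hs : Cells π rank srt X M s) {p y c : ℕ} {R : Finset ℕ} (h21 : s.wvar 21 = p)
    (hp : p < π.m) (h24 : s.wvar 24 = y) (hy : y < π.D * π.T0 ^ (2 * π.d)) (h30 : s.wvar 30 = c)
    (hc : c + 1 < 2 ^ π.w) (hR : ∀ q, s.warr 4 q = if q ∈ R then 1 else 0) :
    Runs π.w (boxBody π.d) s (π.T0 * 10 + 20) fun s' =>
      s'.wvar 30 = c + if Valid rank π.Lam π.m π.D π.d π.T0 π.h M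
          (cellKey rank π.Lam π.m (y % π.D) p π.d) (y / π.D) ∧
        InBox rank π.d π.T0 M (cellKey rank π.Lam π.m (y % π.D) p π.d) (y / π.D) p ∧
        Disjoint (boxPts rank π.Lam π.m π.D π.d π.T0 M
          (cellKey rank π.Lam π.m (y % π.D) p π.d, y / π.D)) R
      then 1 else 0 := by
  have hlam : y % π.D < π.D := Nat.mod_lt _ (Nat.pos_of_ne_zero (by intro h; simp [h] at hy))
  set κ := cellKey rank π.Lam π.m (y % π.D) p π.d with hκ
  set τ := y / π.D with hτ
  have hκlt : κ < π.D * π.m ^ π.d := cellKey_lt (fun t ht => hs.ready.rank_lt t ht p hp) hlam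
  have h2w := two_lt π
  refine Runs.mono (T := π.T0 * 10 + 18) ?_ (by omega) fun _ _ h => h
  refine Runs.seq_wset (T := π.T0 * 10 + 16) (y % π.D) (eval_mod (eval_var h24) (eval_var hs.ready.env.D)) ?_
  have hs₁ := hs.setW (v := y % π.D) (show 14 < 22 by norm_num)
  refine Runs.seq_wset (T := π.T0 * 10 + 14) τ (eval_div (eval_var (by simpa using h24))
    (eval_var hs₁.ready.env.D)) ?_
  have hs₂ := hs₁.setW (v := τ) (show 14 < 25 by norm_num)
  refine Runs.seq_wset (T := π.T0 * 10 + 12) κ (eval_keyE hs₂.ready (eval_var (by simpa using h21))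
    (eval_var (by simp)) hp hlam) ?_
  have hs₃ := hs₂.setW (v := κ) (show 14 < 23 by norm_num)
  refine Runs.seq_wset (T := π.T0 * 10 + 10) 0 (eval_const (by omega)) ?_
  have hs₄ := hs₃.setW (v := 0) (show 14 < 28 by norm_num)
  refine Runs.seq_wset (T := π.T0 * 10 + 8) 0 (eval_const (by omega)) ?_
  have hs₅ := hs₄.setW (v := 0) (show 14 < 29 by norm_num)
  set s₅ := ((((s.setW 22 (y % π.D)).setW 25 τ).setW 23 κ).setW 28 0).setW 29 0 with hs₅d
  have h21₅ : s₅.wvar 21 = p := by simp [hs₅d, h21]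
  have h23₅ : s₅.wvar 23 = κ := by simp [hs₅d]
  have h25₅ : s₅.wvar 25 = τ := by simp [hs₅d]
  have h30₅ : s₅.wvar 30 = c := by simp [hs₅d, h30]
  have hcnt : (WExp.get 2 (.var 23)).eval π.w s₅ = cellCount rank π.Lam π.m π.D π.d (π.m * π.D) κ := by
    rw [eval_get (eval_var h23₅), hs₅.cnt]
  have hT0 : (WExp.var 10).eval π.w s₅ = π.T0 := hs₅.ready.env.T0
  refine Runs.ite (T := π.T0 * 10 + 7) (fun hh => ?_) (fun hh => ?_) le_rfl
  · rw [Test.holds, hcnt, hT0] at hh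
    refine Runs.skip (by omega) ?_
    rw [if_neg (fun h => by have := h.1.1; omega), h30₅, add_zero]
  · rw [Test.holds, hcnt, hT0, not_lt] at hh
    refine Runs.seq (π.T0 * (7 + 3) + 3) 2 (Runs.mono (runs_inner hs₅ h23₅ h25₅ hκlt (by simp [hs₅d])
      (by simp [hs₅d]) hR hh) le_rfl ?_) (by omega)
    rintro s₆ hf ⟨h28, h29⟩
    have hWV : ∀ x, (inner π.d).WV x → x = 26 ∨ x = 27 ∨ x = 28 ∨ x = 29 := by
      intro x hx; simp [inner, innerBody, Cmd.WV] at hx; omega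
    have hs₆ := hs₅.frame hf (fun x h => by have := hWV _ h; omega)
      (fun x h => by simp [inner, innerBody, Cmd.WA] at h)
      (fun x h => by simp [inner, innerBody, Cmd.RA] at h)
    have h21₆ : s₆.wvar 21 = p := (hf.wv 21 fun h => by have := hWV _ h; omega).trans h21₅
    have h23₆ : s₆.wvar 23 = κ := (hf.wv 23 fun h => by have := hWV _ h; omega).trans h23₅
    have h25₆ : s₆.wvar 25 = τ := (hf.wv 25 fun h => by have := hWV _ h; omega).trans h25₅
    have h30₆ : s₆.wvar 30 = c := (hf.wv 30 fun h => by have := hWV _ h; omega).trans h30₅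
    have hiff : (Test.and (inBoxT (.var 21) π.d) (.and (.not (.wlt (.var 28) (.var 11)))
        (.not (.wlt (.const 0) (.var 29))))).holds π.w s₆ ↔
        Valid rank π.Lam π.m π.D π.d π.T0 π.h M κ τ ∧ InBox rank π.d π.T0 M κ τ p ∧
          Disjoint (boxPts rank π.Lam π.m π.D π.d π.T0 M (κ, τ)) R := by
      rw [Test.holds, inBoxT_holds hs₆ h23₆ h25₆ hκlt (eval_var h21₆) hp]
      simp only [Test.holds, WExp.eval, Nat.zero_mod, h28, hs₆.ready.env.h, not_lt, Nat.le_zero, h29, Valid]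
      tauto
    refine Runs.ite (T := 1) (fun h => ?_) (fun h => ?_) le_rfl
    · rw [hiff] at h
      refine Runs.wset (c + 1) (eval_add (eval_var h30₆) (eval_const (by omega)) hc) le_rfl ?_
      rw [if_pos h]; simp
    · rw [hiff] at h
      refine Runs.skip le_rfl ?_
      rw [if_neg h, h30₆, add_zero]

/-- Since the store `s₀` the points in `R` have been taken and appended to the output. -/
structure Taken (π : Params) (X : ℕ → ℕ → ℝ) (s₀ : Store) (R : Finset ℕ) (s : Store) : Prop where
  flag : ∀ q, s.warr 4 q = if q ∈ R then 1 else 0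
  size : s.wvar 1 = s₀.wvar 1 + R.card
  out : ∀ p ∈ R, Out π.d s fun t => X t p
  old : ∀ x, Out π.d s₀ x → Out π.d s x

theorem Taken.setW {s₀ : Store} {R : Finset ℕ} (h : Taken π X s₀ R s) {x v : ℕ} (hx : 1 < x) :
    Taken π X s₀ R (s.setW x v) := by
  have h1 : (s.setW x v).wvar 1 = s.wvar 1 := by simp; omega
  refine ⟨h.flag, by rw [h1, h.size], fun p hp => ?_, fun y hy => ?_⟩
  · obtain ⟨i, hi, h'⟩ := h.out p hp; exact ⟨i, by rw [h1]; exact hi, h'⟩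
  · obtain ⟨i, hi, h'⟩ := h.old y hy; exact ⟨i, by rw [h1]; exact hi, h'⟩

theorem boxBody_WV {d x : ℕ} (h : (boxBody d).WV x) : 22 ≤ x ∧ x ≤ 30 ∧ x ≠ 24 := by
  simp [boxBody, inner, innerBody, Cmd.WV] at h; omega

theorem boxBody_WA {d x : ℕ} : ¬ (boxBody d).WA x := by
  simp [boxBody, inner, innerBody, Cmd.WA]

theorem boxBody_RA {d x : ℕ} : ¬ (boxBody d).RA x := by
  simp [boxBody, inner, innerBody, Cmd.RA]

theorem pointBody_WV {d x : ℕ} (h : (pointBody d).WV x) : x = 1 ∨ 22 ≤ x ∧ x ≤ 30 := by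
  simp only [pointBody, Cmd.WV, Cmd.WV_times, emit_WV, false_or] at h
  rcases h with h | (h | h) | h
  · omega
  · omega
  · have := boxBody_WV h; omega
  · omega

theorem pointBody_WA {d x : ℕ} (h : (pointBody d).WA x) : x = 4 := by
  simp only [pointBody, Cmd.WA, Cmd.WA_times, emit_WA, boxBody_WA] at h
  tauto

theorem pointBody_RA {d x : ℕ} (h : (pointBody d).RA x) : d ≤ x := by
  simp only [pointBody, Cmd.RA, Cmd.RA_times, boxBody_RA, false_or] at h
  exact emit_RA h

/-- The time that `pointBody` takes. -/
def pointTime (π : Params) : ℕ := π.D * π.T0 ^ (2 * π.d) * (π.T0 * 10 + 23) + 2 * π.d + 15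

theorem runs_pointBody (hs : Cells π rank srt X M s) {p θ : ℕ} {R : Finset ℕ} {s₀ : Store}
    (h21 : s.wvar 21 = p) (hp : p < π.m) (h31 : s.wvar 31 = θ) (hθ : 0 < θ) (hR : Taken π X s₀ R s)
    (hRm : R ⊆ Finset.range π.m) (hs₀ : s₀.wvar 1 ≤ π.D * π.m ^ π.d) :
    Runs π.w (pointBody π.d) s (pointTime π)
      (Taken π X s₀ (if θ ≤ cov (family rank π.Lam π.m π.D π.d π.T0 π.h M)
        (boxPts rank π.Lam π.m π.D π.d π.T0 M) R p then insert p R else R)) := by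
  classical
  have h2w := two_lt π
  have hcell := π.cell_lt
  set F := family rank π.Lam π.m π.D π.d π.T0 π.h M with hF
  set B := boxPts rank π.Lam π.m π.D π.d π.T0 M with hB
  set φ : ℕ → ℕ := fun y => if Valid rank π.Lam π.m π.D π.d π.T0 π.h M
          (cellKey rank π.Lam π.m (y % π.D) p π.d) (y / π.D) ∧
        InBox rank π.d π.T0 M (cellKey rank π.Lam π.m (y % π.D) p π.d) (y / π.D) p ∧
        Disjoint (boxPts rank π.Lam π.m π.D π.d π.T0 M
          (cellKey rank π.Lam π.m (y % π.D) p π.d, y / π.D)) R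
      then 1 else 0 with hφ
  have hφle : ∀ y, ∑ y' ∈ Finset.range y, φ y' ≤ y := fun y => by
    calc _ ≤ ∑ y' ∈ Finset.range y, 1 :=
          Finset.sum_le_sum fun y' _ => by simp only [hφ]; split_ifs <;> simp
      _ = y := by simp
  refine Runs.mono (T := π.D * π.T0 ^ (2 * π.d) * (π.T0 * 10 + 20 + 3) + 3 + (2 * π.d + 9) + 2) ?_
    (by rw [pointTime, show π.T0 * 10 + 20 + 3 = π.T0 * 10 + 23 from rfl]; omega) fun _ _ h => h
  refine Runs.seq_wset (T := π.D * π.T0 ^ (2 * π.d) * (π.T0 * 10 + 20 + 3) + 3 + (2 * π.d + 9)) 0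
    (eval_const (by omega)) ?_
  have hs₁ := hs.setW (v := 0) (show 14 < 30 by norm_num)
  have hR₁ := hR.setW (v := 0) (show 1 < 30 by norm_num)
  set s₁ := s.setW 30 0 with hs₁d
  have h21₁ : s₁.wvar 21 = p := by simp [hs₁d, h21]
  have h31₁ : s₁.wvar 31 = θ := by simp [hs₁d, h31]
  refine Runs.seq (π.D * π.T0 ^ (2 * π.d) * (π.T0 * 10 + 20 + 3) + 3) (2 * π.d + 8)
    (Runs.mono (Runs.times (N := π.D * π.T0 ^ (2 * π.d)) (Tb := π.T0 * 10 + 20)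
      (fun y s' => s'.wvar 30 = ∑ y' ∈ Finset.range y, φ y') π.box_lt ?_ ?_ ?_ ?_ ?_ le_rfl) le_rfl ?_)
    (by omega)
  · intro h; have := boxBody_WV h; omega
  · intro i s' v h; simpa using h
  · intro s' hf
    refine eval_var ((hf.wv 12 ?_).trans hs₁.ready.env.Y)
    intro h; rw [Cmd.WV_times] at h; rcases h with h | h
    · omega
    · have := boxBody_WV h; omega
  · simp [hs₁d]
  · intro y hy s₂ h24 hf h30
    have hWV : ∀ x, (Cmd.times 24 (.var 12) (boxBody π.d)).WV x → 22 ≤ x ∧ x ≤ 30 := by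
      intro x h; rw [Cmd.WV_times] at h; rcases h with h | h
      · omega
      · have := boxBody_WV h; omega
    have hs₂ := hs₁.frame hf (fun x h => by have := hWV x h; omega)
      (fun x h => by rw [Cmd.WA_times] at h; exact absurd h boxBody_WA)
      (fun x h => by rw [Cmd.RA_times] at h; exact absurd h boxBody_RA)
    have hbox := π.box_lt
    have hle := hφle y
    refine Runs.mono (runs_boxBody (R := R) hs₂ ((hf.wv 21 fun h => by have := hWV _ h; omega).trans h21₁)
      hp h24 hy h30 (by omega) ?_) le_rfl ?_
    · rw [hf.wa 4 (by rw [Cmd.WA_times]; exact boxBody_WA)]; exact hR₁.flag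
    · intro s' _ h
      rw [h, Finset.sum_range_succ]
  · intro s₂ hf h30
    have hWV : ∀ x, (Cmd.times 24 (.var 12) (boxBody π.d)).WV x → 22 ≤ x ∧ x ≤ 30 := by
      intro x h; rw [Cmd.WV_times] at h; rcases h with h | h
      · omega
      · have := boxBody_WV h; omega
    have hs₂ := hs₁.frame hf (fun x h => by have := hWV x h; omega)
      (fun x h => by rw [Cmd.WA_times] at h; exact absurd h boxBody_WA)
      (fun x h => by rw [Cmd.RA_times] at h; exact absurd h boxBody_RA)
    rw [← cov_family hs.ready.rank_lt hp, ← hF, ← hB] at h30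
    have h21₂ : s₂.wvar 21 = p := (hf.wv 21 fun h => by have := hWV _ h; omega).trans h21₁
    have h31₂ : s₂.wvar 31 = θ := (hf.wv 31 fun h => by have := hWV _ h; omega).trans h31₁
    have h1₂ : s₂.wvar 1 = s₁.wvar 1 := hf.wv 1 fun h => by have := hWV _ h; omega
    have ha₂ : s₂.warr 4 = s₁.warr 4 := hf.wa 4 (by rw [Cmd.WA_times]; exact boxBody_WA)
    have hr₂ : ∀ a, s₂.rarr a = s₁.rarr a := fun a => hf.ra a (by rw [Cmd.RA_times]; exact boxBody_RA)
    have hOut₂ : ∀ x, Out π.d s₁ x → Out π.d s₂ x := by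
      rintro x ⟨i, hi, h⟩; exact ⟨i, by rw [h1₂]; exact hi, by simpa only [hr₂] using h⟩
    refine Runs.ite (T := 2 * π.d + 5) (fun hh => ?_) (fun hh => ?_) (by omega)
    · simp only [Test.holds, WExp.eval, h30, h31₂] at hh
      rw [if_neg (by omega)]
      exact Runs.skip (by omega) ⟨by rw [ha₂]; exact hR₁.flag, by rw [h1₂, hR₁.size],
        fun p hp => hOut₂ _ (hR₁.out p hp), fun x hx => hOut₂ _ (hR₁.old x hx)⟩
    · simp only [Test.holds, WExp.eval, h30, h31₂, not_lt] at hh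
      rw [if_pos hh]
      -- A taken point has coverage `0`, below the positive threshold, so no point is written twice
      -- and the output grows exactly with `R`.
      have hpR : p ∉ R := fun h => by rw [cov_of_mem h] at hh; omega
      have hcard : (insert p R).card ≤ π.m := by
        refine (Finset.card_le_card (Finset.insert_subset (Finset.mem_range.2 hp) hRm)).trans_eq ?_
        exact Finset.card_range _
      rw [Finset.card_insert_of_notMem hpR] at hcard
      have hsize : s₂.wvar 1 = s₀.wvar 1 + R.card := by rw [h1₂, hR₁.size]
      refine Runs.seq 1 (2 * π.d + 3) (Runs.wput p 1 (eval_var h21₂) (eval_const (by omega)) le_rfl ?_)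
        (by omega)
      set s₃ := s₂.putW 4 p 1 with hs₃d
      refine Runs.mono (runs_emit (fun t => X t p) ?_ ?_) le_rfl ?_
      · intro t ht s' hv ha hr
        rw [RExp.eval, WExp.eval, WExp.eval, hv, ha, hr t ht, ← hs₂.X_eq t ht, sampleX, hs₃d, putW_wvar,
          h21₂, putW_warr, if_neg (by simp), putW_rarr]
      · rw [hs₃d, putW_wvar, hsize]
        have hD : 0 < π.D := by
          rw [π.hD]; exact Nat.pow_pos (by have := π.hL; omega)
        have h1 : π.m ≤ π.m * π.D := Nat.le_mul_of_pos_right _ hD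
        have h2 := Nat.le_mul_of_pos_right (π.D * π.m ^ π.d) (show 0 < π.m * π.D by omega)
        have := π.T0_pos
        omega
      · rintro s₄ hf₄ ⟨h4, h5, h6⟩
        refine ⟨fun q => ?_, ?_, fun q hq => ?_, fun x hx => h6 x (hOut₂ x (hR₁.old x hx))⟩
        · rw [hf₄.wa 4 emit_WA, hs₃d, putW_warr, ha₂]
          by_cases hq : q = p
          · simp [hq]
          · simp [hq, hR₁.flag]
        · rw [h4, hs₃d, putW_wvar, hsize, Finset.card_insert_of_notMem hpR, add_assoc]
        · rcases Finset.mem_insert.1 hq with rfl | hq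
          · exact h5
          · exact h6 _ (hOut₂ _ (hR₁.out q hq))

theorem coverPass_subset {ι : Type*} {F : Finset ι} {pts : ι → Finset ℕ} {θ m : ℕ} {R : Finset ℕ}
    (hR : R ⊆ Finset.range m) {p : ℕ} (hp : p ≤ m) : coverPass F pts θ R p ⊆ Finset.range m := by
  induction p with
  | zero => exact hR
  | succ p ih =>
    rw [coverPass]
    split_ifs
    · exact Finset.insert_subset (Finset.mem_range.2 hp) (ih (by omega))
    · exact ih (by omega)

theorem greedy_subset {ι : Type*} {F : Finset ι} {pts : ι → Finset ℕ} {m I i : ℕ} :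
    greedy F pts m I i ⊆ Finset.range m := by
  induction i with
  | zero => simp [greedy]
  | succ i ih => exact coverPass_subset ih le_rfl

/-- The threshold variable starts at `D * T0 ^ (2 * d)`, which is a power of two, so halving it runs
through the thresholds of `greedy` exactly. -/
theorem runs_greedyCmd (hs : Cells π rank srt X M s) (h4 : ∀ q, s.warr 4 q = 0)
    (h1 : s.wvar 1 ≤ π.D * π.m ^ π.d) :
    Runs π.w (greedyCmd π.d) s ((π.I + 1) * (π.m * (pointTime π + 3) + 8) + 5)
      (Taken π X s (greedy (family rank π.Lam π.m π.D π.d π.T0 π.h M)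
        (boxPts rank π.Lam π.m π.D π.d π.T0 M) π.m π.I (π.I + 1))) := by
  have hT0 : Taken π X s ∅ s := ⟨by simpa using h4, by simp, by simp, fun _ h => h⟩
  refine Runs.mono (T := (π.I + 1) * (π.m * (pointTime π + 3) + 3 + 2 + 3) + 3 + 2) ?_ (le_of_eq (by ring)) fun _ _ h => h
  refine Runs.seq_wset (T := (π.I + 1) * (π.m * (pointTime π + 3) + 3 + 2 + 3) + 3)
    (π.D * π.T0 ^ (2 * π.d)) (eval_var hs.ready.env.Y) ?_
  have hs₁ := hs.setW (v := π.D * π.T0 ^ (2 * π.d)) (show 14 < 31 by norm_num)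
  have hT₁ := hT0.setW (v := π.D * π.T0 ^ (2 * π.d)) (show 1 < 31 by norm_num)
  set F := family rank π.Lam π.m π.D π.d π.T0 π.h M
  set B := boxPts rank π.Lam π.m π.D π.d π.T0 M
  set s₁ := s.setW 31 (π.D * π.T0 ^ (2 * π.d)) with hs₁d
  have h31₁ : s₁.wvar 31 = π.D * π.T0 ^ (2 * π.d) := by simp [hs₁d]
  have hWV₀ : ∀ x, (Cmd.times 21 (.var 6) (pointBody π.d)).WV x → x = 1 ∨ 21 ≤ x ∧ x ≤ 30 := by
    intro x h
    simp only [Cmd.WV_times] at h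
    rcases h with h | h
    · omega
    · have := pointBody_WV h; omega
  have hWA₀ : ∀ x, (Cmd.times 21 (.var 6) (pointBody π.d)).WA x → x = 4 := by
    intro x h; rw [Cmd.WA_times] at h; exact pointBody_WA h
  have hRA₀ : ∀ x, (Cmd.times 21 (.var 6) (pointBody π.d)).RA x → π.d ≤ x := by
    intro x h; rw [Cmd.RA_times] at h; exact pointBody_RA h
  have hWV : ∀ x, (Cmd.times 32 (.var 13) (.seq (.times 21 (.var 6) (pointBody π.d))
      (.wset 31 (.div (.var 31) (.const 2))))).WV x → x = 1 ∨ 20 ≤ x := by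
    intro x h
    rw [Cmd.WV_times, Cmd.WV] at h
    rcases h with h | h | h
    · omega
    · have := hWV₀ x h; omega
    · rw [Cmd.WV] at h; omega
  have hWA : ∀ x, (Cmd.times 32 (.var 13) (.seq (.times 21 (.var 6) (pointBody π.d))
      (.wset 31 (.div (.var 31) (.const 2))))).WA x → x = 4 := by
    intro x h
    rw [Cmd.WA_times, Cmd.WA] at h
    rcases h with h | h
    · exact hWA₀ x h
    · exact h.elim
  have hRA : ∀ x, (Cmd.times 32 (.var 13) (.seq (.times 21 (.var 6) (pointBody π.d))
      (.wset 31 (.div (.var 31) (.const 2))))).RA x → π.d ≤ x := by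
    intro x h
    rw [Cmd.RA_times, Cmd.RA] at h
    rcases h with h | h
    · exact hRA₀ x h
    · exact h.elim
  refine Runs.mono (Runs.times (N := π.I + 1) (Tb := π.m * (pointTime π + 3) + 3 + 2)
    (fun i s' => Taken π X s (greedy F B π.m π.I i) s' ∧ s'.wvar 31 = π.D * π.T0 ^ (2 * π.d) / 2 ^ i)
    π.I_lt ?_ ?_ ?_ ⟨hT₁, by simp [h31₁]⟩ ?_ le_rfl) le_rfl fun _ _ h => h.1
  · rw [Cmd.WV]
    rintro (h | h)
    · have := hWV₀ _ h; omega
    · rw [Cmd.WV] at h; omega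
  · rintro i s' v ⟨h, h'⟩
    exact ⟨h.setW (by norm_num), by simpa using h'⟩
  · intro s' hf
    exact eval_var ((hf.wv 13 fun h => by have := hWV _ h; omega).trans hs₁.ready.env.I)
  rintro i hi s₂ h32 hf ⟨hT₂, h31₂⟩
  have hs₂ := hs₁.frame hf hWV hWA hRA
  have hθ : π.D * π.T0 ^ (2 * π.d) / 2 ^ i = 2 ^ (π.I - i) := by
    rw [π.hI, Nat.pow_div (by omega) (by norm_num)]
  rw [hθ] at h31₂
  have hmw : π.m < 2 ^ π.w := by have := π.sort_lt; nlinarith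
  refine Runs.seq (π.m * (pointTime π + 3) + 3) 1 (Runs.mono (Runs.times (N := π.m) (Tb := pointTime π)
    (fun p s' => Taken π X s (coverPass F B (2 ^ (π.I - i)) (greedy F B π.m π.I i) p) s')
    hmw ?_ ?_ ?_ hT₂ ?_ le_rfl) le_rfl ?_) le_rfl
  · intro h; have := pointBody_WV h; omega
  · intro i s' v h; exact h.setW (by norm_num)
  · intro s' hf'
    exact eval_var ((hf'.wv 6 fun h => by have := hWV₀ _ h; omega).trans hs₂.ready.env.m)
  · intro p hp s₃ h21 hf' hT₃
    have hs₃ := hs₂.frame hf' (fun x h => by have := hWV₀ x h; omega) hWA₀ hRA₀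
    exact runs_pointBody hs₃ h21 hp ((hf'.wv 31 fun h => by have := hWV₀ _ h; omega).trans h31₂)
      (by positivity) hT₃ (coverPass_subset greedy_subset hp.le) h1
  · intro s₃ hf' hT₃
    have h31₃ : s₃.wvar 31 = 2 ^ (π.I - i) :=
      (hf'.wv 31 fun h => by have := hWV₀ _ h; omega).trans h31₂
    refine Runs.wset (2 ^ (π.I - i) / 2) (eval_div (eval_var h31₃) (eval_const (two_lt π))) le_rfl ?_
    refine ⟨hT₃.setW (by norm_num), ?_⟩
    rw [setW_wvar, if_pos rfl, ← hθ, Nat.div_div_eq_div_mul, pow_succ]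

end Greedy

end RealRAM


namespace RealRAM

/-! ## The parameters -/

/-- A word size that suffices for all numbers that the program computes. -/
def wordBound (d a k j : ℕ) : ℕ :=
  3 * (k + a + 4 + j) + 2 ^ (a + 6 + j) + d * (k + a + 4 + j) + 3 * (d * (a + 6 + j)) + (a + j) +
    (d * (a + 6 + j) + 2 * d * (a + j + d * (a + 6 + j))) + 10

/-- The parameters for `ε` about `2 ^ (-k)`, where `j` is about `log k`. -/
def params (d a k j w : ℕ) (hkj : k ≤ 2 ^ j) (hw : wordBound d a k j ≤ w) : Params where
  d := d
  w := w
  m := 2 ^ (k + a + 4 + j)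
  L := k + a + 4 + j
  Lam := 2 ^ (a + 6 + j)
  D := 2 ^ (d * (a + 6 + j))
  T0 := 2 ^ (a + j + d * (a + 6 + j))
  h := 2 ^ (a + j)
  I := d * (a + 6 + j) + 2 * d * (a + j + d * (a + 6 + j))
  hm := rfl
  -- `2 ^ (a + 6 + j)` exceeds `k + a + 4 + j` because `k ≤ 2 ^ j`. A power of two is taken so that
  -- `D` and `T0` are powers of two as well.
  hL := by
    have h1 : a < 2 ^ a := Nat.lt_two_pow_self
    have h2 : j < 2 ^ j := Nat.lt_two_pow_self
    have h3 : 1 ≤ 2 ^ a := Nat.one_le_two_pow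
    have h4 : 1 ≤ 2 ^ j := Nat.one_le_two_pow
    have h5 : 2 ^ (a + 6 + j) = 64 * (2 ^ a * 2 ^ j) := by rw [pow_add, pow_add]; ring
    rw [h5]
    nlinarith
  hD := by rw [← pow_mul, mul_comm]
  hLam := Nat.pow_lt_pow_right (by norm_num) (by have hp := Nat.one_le_two_pow (n := a + 6 + j); unfold wordBound at hw; omega)
  hw := by have hp := Nat.one_le_two_pow (n := a + 6 + j); unfold wordBound at hw; omega
  sort_lt := by
    have h1 : k + a + 4 + j + 2 < 2 ^ (k + a + 4 + j + 2) := Nat.lt_two_pow_self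
    calc (k + a + 4 + j + 2) * 2 ^ (k + a + 4 + j)
        < 2 ^ (k + a + 4 + j + 2) * 2 ^ (k + a + 4 + j) := Nat.mul_lt_mul_of_pos_right h1 (by positivity)
      _ = 2 ^ (k + a + 4 + j + 2 + (k + a + 4 + j)) := (pow_add _ _ _).symm
      _ ≤ 2 ^ w := Nat.pow_le_pow_right (by norm_num) (by have hp := Nat.one_le_two_pow (n := a + 6 + j); unfold wordBound at hw; omega)
  mid_lt := by
    have h1 : k + a + 4 + j + 2 < 2 ^ (k + a + 4 + j + 2) := Nat.lt_two_pow_self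
    calc (k + a + 4 + j + 2) * 2 ^ (k + a + 4 + j) + 2 ^ 2 ^ (a + 6 + j)
        < 2 ^ (k + a + 4 + j + 2) * 2 ^ (k + a + 4 + j) + 2 ^ 2 ^ (a + 6 + j) :=
          Nat.add_lt_add_right (Nat.mul_lt_mul_of_pos_right h1 (by positivity)) _
      _ = 2 ^ (k + a + 4 + j + 2 + (k + a + 4 + j)) + 2 ^ 2 ^ (a + 6 + j) := by rw [← pow_add]
      _ ≤ 2 ^ (w - 1) + 2 ^ (w - 1) := by
          gcongr <;> (have hp := Nat.one_le_two_pow (n := a + 6 + j); unfold wordBound at hw; omega)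
      _ = 2 ^ w := by
          rw [← two_mul, ← pow_succ']; congr 1; have hp := Nat.one_le_two_pow (n := a + 6 + j); unfold wordBound at hw; omega
  cell_lt := by
    calc _ = 2 ^ (d * (a + 6 + j) + (k + a + 4 + j) * d + (k + a + 4 + j + d * (a + 6 + j))) +
          2 ^ (k + a + 4 + j + d * (a + 6 + j)) + 2 ^ (a + j + d * (a + 6 + j)) := by
          simp only [pow_add, pow_mul]
      _ < 2 ^ (w - 2) + 2 ^ (w - 2) + 2 ^ (w - 1) := by
          have hc := mul_comm (k + a + 4 + j) d
          gcongr <;> (have hp := Nat.one_le_two_pow (n := a + 6 + j); unfold wordBound at hw; omega)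
      _ = 2 ^ w := by
          rw [← two_mul, ← pow_succ', ← show w - 1 = w - 2 + 1 by have hp := Nat.one_le_two_pow (n := a + 6 + j); unfold wordBound at hw; omega, ← two_mul,
            ← pow_succ']
          congr 1; have hp := Nat.one_le_two_pow (n := a + 6 + j); unfold wordBound at hw; omega
  box_lt := by
    rw [← pow_mul, ← pow_add]
    have hc := mul_comm (a + j + d * (a + 6 + j)) (2 * d)
    exact Nat.pow_lt_pow_right (by norm_num) (by have hp := Nat.one_le_two_pow (n := a + 6 + j); unfold wordBound at hw; omega)
  hI := by rw [← pow_mul, ← pow_add, mul_comm (a + j + d * (a + 6 + j))]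
  I_lt := by
    have : w < 2 ^ w := Nat.lt_two_pow_self
    have hp := Nat.one_le_two_pow (n := a + 6 + j); unfold wordBound at hw; omega
  T0_pos := by positivity

/-- Doubles `x`, starting with `1`, as long as `b` holds, and counts the steps in `y`. -/
def double (b : Test) (x y : ℕ) : Cmd :=
  .seq (.wset x (.const 1)) (.seq (.wset y (.const 0))
    (.loop b (.seq (.wset x (.mul (.var x) (.const 2))) (.wset y (.add (.var y) (.const 1))))))

/-- With `N < w` the doubled number never wraps around. The test may read anything except the two
variables that change. -/
theorem runs_double {w N x y : ℕ} {b : Test} {s : Store} (hxy : x ≠ y) (hN : N < w) (hw : 2 ≤ w)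
    (hb : ∀ i, ∀ s' : Store, s'.wvar x = 2 ^ i → (∀ z, z ≠ x → z ≠ y → s'.wvar z = s.wvar z) →
      s'.rvar = s.rvar → (b.holds w s' ↔ i < N)) :
    Runs w (double b x y) s (N * 4 + 5) fun s' => s'.wvar x = 2 ^ N ∧ s'.wvar y = N := by
  have h2w : 2 < 2 ^ w := lt_of_lt_of_le (by norm_num : 2 < 2 ^ 2) (Nat.pow_le_pow_right (by norm_num) hw)
  have hww : w < 2 ^ w := Nat.lt_two_pow_self
  have key : ∀ r i, i + r = N → ∀ s' : Store, s'.wvar x = 2 ^ i → s'.wvar y = i →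
      (∀ z, z ≠ x → z ≠ y → s'.wvar z = s.wvar z) → s'.rvar = s.rvar →
      Runs w (.loop b (.seq (.wset x (.mul (.var x) (.const 2))) (.wset y (.add (.var y) (.const 1))))) s'
        (r * 4 + 1) fun s' => s'.wvar x = 2 ^ N ∧ s'.wvar y = N := by
    intro r
    induction r with
    | zero =>
      intro i hi s' hx hy hz hr
      obtain rfl : i = N := by omega
      exact Runs.loop_zero (by rw [hb i s' hx hz hr]; omega) le_rfl ⟨hx, hy⟩
    | succ r ih =>
      intro i hi s' hx hy hz hr
      refine Runs.mono (Runs.loop_succ (T₁ := 3) (T₂ := r * 4 + 1) ((hb i s' hx hz hr).2 (by omega)) ?_)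
        (by omega) fun _ _ h => h
      refine Runs.seq_wset (T := 1) (2 ^ (i + 1)) ?_ ?_
      · rw [pow_succ]
        refine eval_mul (eval_var hx) (eval_const h2w) ?_
        rw [← pow_succ]; exact Nat.pow_lt_pow_right (by norm_num) (by omega)
      refine Runs.wset (i + 1) (eval_add (eval_var (by simp [hxy.symm, hy])) (eval_const (by omega))
        (by omega)) le_rfl ?_
      refine ih (i + 1) (by omega) _ (by simp [hxy]) (by simp) (fun z hzx hzy => ?_) hr
      simp [hzx, hzy, hz z hzx hzy]
  refine Runs.mono (T := N * 4 + 1 + 2 + 2) ?_ le_rfl fun _ _ h => h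
  refine Runs.seq_wset (T := N * 4 + 1 + 2) 1 (eval_const (by omega)) ?_
  refine Runs.seq_wset (T := N * 4 + 1) 0 (eval_const (by omega)) ?_
  refine key N 0 (by omega) _ (by simp [hxy]) (by simp) (fun z hzx hzy => ?_) rfl
  simp [hzx, hzy]

/-- The `t`-th power of the value of `e`. -/
def powE (e : WExp) : ℕ → WExp
  | 0 => .const 1
  | t + 1 => .mul (powE e t) e

theorem eval_powE {w x t : ℕ} {e : WExp} {s : Store} (he : e.eval w s = x) (hx : 0 < x)
    (ht : x ^ t < 2 ^ w) : (powE e t).eval w s = x ^ t := by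
  induction t with
  | zero => exact eval_const (by simpa using ht)
  | succ t ih =>
    exact eval_mul (ih ((Nat.pow_le_pow_right hx (by omega)).trans_lt ht)) he ht

/-- Sets up the table of the powers of two. -/
def powTable : Cmd :=
  .seq (.wset 21 (.const 1))
    (.times 20 (.var 8) (.seq (.wput 1 (.var 20) (.var 21)) (.wset 21 (.mul (.var 21) (.const 2)))))

theorem runs_powTable {w Lam : ℕ} {s : Store} (hL : Lam < w) (hw : 2 ≤ w) (h8 : s.wvar 8 = Lam) :
    Runs w powTable s (Lam * 6 + 5) fun s' => ∀ i < Lam, s'.warr 1 i = 2 ^ i := by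
  have h2w : 2 < 2 ^ w := lt_of_lt_of_le (by norm_num : 2 < 2 ^ 2) (Nat.pow_le_pow_right (by norm_num) hw)
  have hww : w < 2 ^ w := Nat.lt_two_pow_self
  refine Runs.mono (T := Lam * 6 + 3 + 2) ?_ le_rfl fun _ _ h => h
  refine Runs.seq_wset (T := Lam * 6 + 3) 1 (eval_const (by omega)) ?_
  refine Runs.mono (Runs.times (N := Lam) (Tb := 3) (fun i s' => s'.wvar 21 = 2 ^ i ∧
    ∀ i' < i, s'.warr 1 i' = 2 ^ i') (by omega) (by simp [Cmd.WV]) ?_ ?_ (by simp) ?_ le_rfl) le_rfl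
    fun _ _ h => h.2
  · intro i s' v h; simpa using h
  · intro s' hf
    exact eval_var ((hf.wv 8 (by simp [Cmd.WV])).trans (by simpa using h8))
  · rintro i hi s' h20 - ⟨h21, hI⟩
    refine Runs.seq 1 1 (Runs.wput i (2 ^ i) (eval_var h20) (eval_var h21) le_rfl ?_) le_rfl
    refine Runs.wset (2 ^ (i + 1)) ?_ le_rfl ⟨by simp, fun i' hi' => ?_⟩
    · rw [pow_succ]
      refine eval_mul (eval_var (by simpa using h21)) (eval_const h2w) ?_
      rw [← pow_succ]; exact Nat.pow_lt_pow_right (by norm_num) (by omega)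
    · rcases Nat.lt_succ_iff_lt_or_eq.1 hi' with hi' | rfl
      · simp [hi'.ne, hI i' hi']
      · simp

/-- Computes the parameters. -/
def setup (d a : ℕ) : Cmd :=
  .seq (double (.rlt (.mul (.ofWord (.var 4)) (.var 0)) (.ofWord (.const 1))) 4 2)
  (.seq (double (.wlt (.var 5) (.var 2)) 5 3)
  (.seq (.wset 6 (.mul (.mul (.var 4) (.const (2 ^ (a + 4)))) (.var 5)))
  (.seq (.wset 7 (.add (.add (.var 2) (.const (a + 4))) (.var 3)))
  (.seq (.wset 8 (.mul (.const (2 ^ (a + 6))) (.var 5)))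
  (.seq (.wset 9 (powE (.var 8) d))
  (.seq (.wset 11 (.mul (.const (2 ^ a)) (.var 5)))
  (.seq (.wset 10 (.mul (.var 11) (.var 9)))
  (.seq (.wset 12 (.mul (.var 9) (powE (.var 10) (2 * d))))
  (.seq (.wset 13 (.add (.mul (.const (d + 2 * d * (1 + d))) (.var 3))
    (.const (d * (a + 6) + 2 * d * (a + d * (a + 6)) + 1))))
  (.seq (.wset 14 (.mul (.var 6) (.var 9)))
  powTable))))))))))

/-- A real cannot be rounded to a word, but `2 ^ i * ε` can be compared with `1`; so `k` is found by
doubling, and then `j` in the same way from `k`. -/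
theorem runs_setup {d a k j w : ℕ} {ε : ℝ} {s : Store} (hkj : k ≤ 2 ^ j) (hw : wordBound d a k j ≤ w)
    (hε : s.rvar 0 = ε) (hk : ∀ i : ℕ, (2 : ℝ) ^ i * ε < 1 ↔ i < k) (hj : ∀ i : ℕ, 2 ^ i < k ↔ i < j) :
    Runs w (setup d a) s (k * 4 + j * 4 + 2 ^ (a + 6 + j) * 6 + 35) (Env (params d a k j w hkj hw)) := by
  have hw2 : 2 ≤ w := (params d a k j w hkj hw).hw
  have hlt : ∀ e : ℕ, e + 10 ≤ wordBound d a k j → 2 ^ e < 2 ^ w := fun e he =>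
    Nat.pow_lt_pow_right (by norm_num) (by omega)
  have hww : w < 2 ^ w := Nat.lt_two_pow_self
  set T := 2 ^ (a + 6 + j) * 6 + 5 with hT
  refine Runs.seq (k * 4 + 5) (j * 4 + 5 + (T + 18) + 1) (Runs.mono (runs_double (N := k) (by norm_num)
    (by have hp := Nat.one_le_two_pow (n := a + 6 + j); unfold wordBound at hw; omega) hw2 ?_) le_rfl ?_) (by omega)
  · intro i s' hx hz hr
    rw [← hk i, Test.holds, RExp.eval, RExp.eval, RExp.eval, RExp.eval, eval_var hx, hr, hε,
      eval_const (by omega)]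
    push_cast; rfl
  rintro s₁ - ⟨h4, h2⟩
  refine Runs.seq (j * 4 + 5) (T + 18) (Runs.mono (runs_double (N := j) (by norm_num)
    (by have hp := Nat.one_le_two_pow (n := a + 6 + j); unfold wordBound at hw; omega) hw2 ?_) le_rfl ?_) (by omega)
  · intro i s' hx hz hr
    rw [← hj i, Test.holds, WExp.eval, WExp.eval, hx, hz 2 (by norm_num) (by norm_num), h2]
  rintro s₂ hf ⟨h5, h3⟩
  have h4 : s₂.wvar 4 = 2 ^ k := (hf.wv 4 (by simp [double, Cmd.WV])).trans h4
  have h2 : s₂.wvar 2 = k := (hf.wv 2 (by simp [double, Cmd.WV])).trans h2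
  clear hf
  have hdL : 0 ≤ d * (k + a + 4 + j) := Nat.zero_le _
  have hca : 2 ^ (a + 4) < 2 ^ w := hlt _ (by have hp := Nat.one_le_two_pow (n := a + 6 + j); unfold wordBound; omega)
  have hca' : 2 ^ (a + 6) < 2 ^ w := hlt _ (by have hp := Nat.one_le_two_pow (n := a + 6 + j); unfold wordBound; omega)
  have hca'' : 2 ^ a < 2 ^ w := hlt _ (by have hp := Nat.one_le_two_pow (n := a + 6 + j); unfold wordBound; omega)
  refine Runs.seq_wset (T := T + 16) (2 ^ (k + a + 4 + j)) ?_ ?_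
  · rw [show 2 ^ (k + a + 4 + j) = 2 ^ k * 2 ^ (a + 4) * 2 ^ j by simp only [pow_add]; ring]
    refine eval_mul (eval_mul (eval_var h4) (eval_const hca) ?_) (eval_var h5) ?_
    · rw [← pow_add]; exact hlt _ (by have hp := Nat.one_le_two_pow (n := a + 6 + j); unfold wordBound; omega)
    · rw [← pow_add, ← pow_add]; exact hlt _ (by have hp := Nat.one_le_two_pow (n := a + 6 + j); unfold wordBound; omega)
  refine Runs.seq_wset (T := T + 14) (k + a + 4 + j) ?_ ?_
  · rw [add_assoc k a 4]
    refine eval_add (eval_add (eval_var (by simpa using h2)) (eval_const ?_) ?_) (eval_var (by simpa using h3)) ?_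
    all_goals have hp := Nat.one_le_two_pow (n := a + 6 + j); unfold wordBound at hw; omega
  refine Runs.seq_wset (T := T + 12) (2 ^ (a + 6 + j)) ?_ ?_
  · rw [pow_add 2 (a + 6) j]
    refine eval_mul (eval_const hca') (eval_var (by simpa using h5)) ?_
    rw [← pow_add]; exact hlt _ (by have hp := Nat.one_le_two_pow (n := a + 6 + j); unfold wordBound; omega)
  refine Runs.seq_wset (T := T + 10) (2 ^ (d * (a + 6 + j))) ?_ ?_
  · rw [mul_comm d, pow_mul]
    refine eval_powE (eval_var (by simp)) (by positivity) ?_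
    rw [← pow_mul, mul_comm]; exact hlt _ (by have hp := Nat.one_le_two_pow (n := a + 6 + j); unfold wordBound; omega)
  refine Runs.seq_wset (T := T + 8) (2 ^ (a + j)) ?_ ?_
  · rw [pow_add 2 a j]
    refine eval_mul (eval_const hca'') (eval_var (by simpa using h5)) ?_
    rw [← pow_add]; exact hlt _ (by have hp := Nat.one_le_two_pow (n := a + 6 + j); unfold wordBound; omega)
  refine Runs.seq_wset (T := T + 6) (2 ^ (a + j + d * (a + 6 + j))) ?_ ?_
  · rw [pow_add _ (a + j)]
    refine eval_mul (eval_var (by simp)) (eval_var (by simp)) ?_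
    rw [← pow_add]; exact hlt _ (by have hp := Nat.one_le_two_pow (n := a + 6 + j); unfold wordBound; omega)
  refine Runs.seq_wset (T := T + 4) (2 ^ (d * (a + 6 + j)) * (2 ^ (a + j + d * (a + 6 + j))) ^ (2 * d)) ?_ ?_
  · have hb := (params d a k j w hkj hw).box_lt
    refine eval_mul (eval_var (by simp)) (eval_powE (eval_var (by simp)) (by positivity) ?_) hb
    refine lt_of_le_of_lt ?_ hb
    exact Nat.le_mul_of_pos_left _ (Nat.two_pow_pos _)
  refine Runs.seq_wset (T := T + 2) (d * (a + 6 + j) + 2 * d * (a + j + d * (a + 6 + j)) + 1) ?_ ?_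
  · have hb := (params d a k j w hkj hw).I_lt
    -- For fixed `d` and `a` the number of passes is linear in `j`, so it is computed from two
    -- constants.
    have he : (d + 2 * d * (1 + d)) * j + (d * (a + 6) + 2 * d * (a + d * (a + 6)) + 1) =
        d * (a + 6 + j) + 2 * d * (a + j + d * (a + 6 + j)) + 1 := by ring
    have hc : d + 2 * d * (1 + d) ≤ d * (a + 6 + j) + 2 * d * (a + j + d * (a + 6 + j)) + 1 := by
      have h1 := Nat.le_mul_of_pos_right d (show 0 < a + 6 + j by omega)
      have h2 := Nat.mul_le_mul_left d (show 3 ≤ a + 6 + j by omega)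
      have h3 := Nat.mul_le_mul_left (2 * d) (show d ≤ a + j + d * (a + 6 + j) by omega)
      have h4 : 2 * d * (1 + d) = 2 * d + 2 * d * d := by ring
      omega
    change d * (a + 6 + j) + 2 * d * (a + j + d * (a + 6 + j)) + 1 < 2 ^ w at hb
    rw [← he] at hb hc ⊢
    exact eval_mul_add (eval_const (by omega)) (eval_var (by simpa using h3)) (eval_const (by omega)) hb
  refine Runs.seq_wset (T := T) (2 ^ (k + a + 4 + j) * 2 ^ (d * (a + 6 + j))) ?_ ?_
  · refine eval_mul (eval_var (by simp)) (eval_var (by simp)) ?_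
    rw [← pow_add]; exact hlt _ (by have hp := Nat.one_le_two_pow (n := a + 6 + j); unfold wordBound; omega)
  refine Runs.mono (runs_powTable (Lam := 2 ^ (a + 6 + j)) (by have hp := Nat.one_le_two_pow (n := a + 6 + j); unfold wordBound at hw; omega) hw2 (by simp))
    le_rfl fun s' hf hp => ?_
  have hv : ∀ x, x ≤ 14 → ¬ powTable.WV x := by
    intro x hx; simp [powTable, Cmd.WV]; omega
  constructor
  case pw => exact hp
  all_goals rw [hf.wv _ (hv _ (by norm_num))]; simp [params]

end RealRAM


namespace RealRAM

/-! ## Sampling -/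

/-- Draws a random point for each of the sample points. -/
def sampleCmd : Cmd :=
  .seq (.wset 35 (.const 0))
    (.times 20 (.var 6) (.seq (.rand 35 (.var 0)) (.seq (.wput 0 (.var 20) (.var 35)) (.wset 35 (.const 0)))))

/-- The store after `i` points `g` have been drawn. -/
def sampled (s : Store) (i : ℕ) (g : ℕ → ℕ) : Store where
  wvar := Function.update (Function.update s.wvar 35 0) 20 i
  rvar := s.rvar
  warr := Function.update s.warr 0 g
  rarr := s.rarr

theorem step_rand {w n x : ℕ} {e : WExp} {s : Store} (he : e.eval w s = n) (k : List Cmd) :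
    step w (.rand x e :: k, s) = (PMF.uniformOfFintype (Fin (n - 1 + 1))).map
      fun r : Fin (n - 1 + 1) => (k, s.setW x (r : ℕ)) := by
  subst he
  exact PMF.map_comp (fun r : Fin (e.eval w s - 1 + 1) => (r : ℕ)) _ fun r => (k, s.setW x r)

/-- Variable `35` is reset to `0` after each draw, so the store depends on the history only through
the sequence `g`. The eight steps are the loop test, three sequencings, the draw, the write, the
reset and the increment. -/
theorem run_sample_iteration {w n m i : ℕ} {s : Store} (h0 : s.wvar 0 = n) (h6 : s.wvar 6 = m)
    (hm : m < 2 ^ w) (hi : i < m) (g : ℕ → ℕ) (k : List Cmd) (b : Cmd)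
    (hb : b = .seq (.rand 35 (.var 0)) (.seq (.wput 0 (.var 20) (.var 35)) (.wset 35 (.const 0)))) :
    run w 8 (.loop (.wlt (.var 20) (.var 6)) (.seq b (.wset 20 (.add (.var 20) (.const 1)))) :: k, sampled s i g) =
      (PMF.uniformOfFintype (Fin (n - 1 + 1))).map fun r : Fin (n - 1 + 1) =>
        (.loop (.wlt (.var 20) (.var 6)) (.seq b (.wset 20 (.add (.var 20) (.const 1)))) :: k,
          sampled s (i + 1) (Function.update g i (r : ℕ))) := by
  set l : Cmd := .loop (.wlt (.var 20) (.var 6)) (.seq b (.wset 20 (.add (.var 20) (.const 1)))) with hl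
  have h20 : (sampled s i g).wvar 20 = i := by simp [sampled]
  have hv0 : (sampled s i g).wvar 0 = n := by simp [sampled, h0]
  have hv6 : (sampled s i g).wvar 6 = m := by simp [sampled, h6]
  rw [hl, run_succ_of_step (c' := (.seq b (.wset 20 (.add (.var 20) (.const 1))) :: l :: k, sampled s i g))
    (by simp [step, Test.holds, WExp.eval, h20, hv6, hi, hl]), ← hl]
  rw [run_succ_of_step (c' := (b :: .wset 20 (.add (.var 20) (.const 1)) :: l :: k, sampled s i g)) rfl]
  rw [hb, run_succ_of_step rfl]
  rw [run, step_rand (eval_var hv0), PMF.bind_map, PMF.map]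
  congr 1
  funext r
  simp only [Function.comp_apply]
  rw [run_succ_of_step rfl, run_succ_of_step rfl, run_succ_of_step rfl, run_one_of_step rfl]
  congr 2
  have hi1 : (i + 1) % 2 ^ w = i + 1 := Nat.mod_eq_of_lt (by omega)
  simp only [sampled, Store.setW, Store.putW, WExp.eval, Store.mk.injEq, true_and, and_true]
  refine ⟨?_, ?_⟩
  · funext x
    simp only [Function.update_apply]
    by_cases hx : x = 20
    · subst hx; simp [hi1]
    · by_cases hx' : x = 35 <;> simp [hx, hx']
  · simp

theorem run_sampleCmd {w n m : ℕ} {s : Store} (h0 : s.wvar 0 = n) (h6 : s.wvar 6 = m)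
    (hm : m < 2 ^ w) (hs : s.warr 0 = fun _ => 0) (k : List Cmd) :
    run w (m * 8 + 5) (sampleCmd :: k, s) = (samp n m).map fun g => (k, sampled s m g) := by
  set b : Cmd := .seq (.rand 35 (.var 0)) (.seq (.wput 0 (.var 20) (.var 35)) (.wset 35 (.const 0))) with hb
  set l : Cmd := .loop (.wlt (.var 20) (.var 6)) (.seq b (.wset 20 (.add (.var 20) (.const 1)))) with hl
  have key : ∀ i ≤ m, run w (i * 8) (l :: k, sampled s 0 fun _ => 0) =
      (samp n i).map fun g => (l :: k, sampled s i g) := by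
    intro i
    induction i with
    | zero => intro _; rw [zero_mul, run, samp, PMF.pure_map]
    | succ i ih =>
      intro hi
      rw [add_one_mul, run_add, ih (by omega), PMF.bind_map, samp, PMF.map_bind]
      congr 1
      funext g
      rw [Function.comp_apply, hl, run_sample_iteration h0 h6 hm (by omega) g k b hb, PMF.map_comp]
      rfl
  have hstart : run w 4 (sampleCmd :: k, s) = PMF.pure (l :: k, sampled s 0 fun _ => 0) := by
    rw [sampleCmd, run_succ_of_step rfl, run_succ_of_step rfl, Cmd.times, run_succ_of_step rfl, ← hb,
      ← hl, run_one_of_step rfl]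
    congr 2
    simp [sampled, Store.setW, WExp.eval, ← hs]
  rw [show m * 8 + 5 = 4 + (m * 8 + 1) by ring, run_add_of_run hstart, run_add, key m le_rfl, PMF.bind_map,
    PMF.map]
  congr 1
  funext g
  exact run_one_of_step (by simp [step, hl, Test.holds, WExp.eval, sampled, h6])

theorem Env.sampled {π : Params} {s : Store} (h : Env π s) (i : ℕ) (g : ℕ → ℕ) :
    Env π (sampled s i g) := by
  constructor
  case pw => intro i hi; simpa [RealRAM.sampled] using h.pw i hi
  all_goals simp only [RealRAM.sampled]; rw [Function.update_of_ne (by norm_num), Function.update_of_ne (by norm_num)]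
  exacts [h.m, h.L, h.Lam, h.D, h.T0, h.h, h.Y, h.I, h.Z]

end RealRAM


namespace RealRAM

/-! ## The deterministic part -/

/-- The part of the program that works on the sample. -/
def netCmd (d : ℕ) : Cmd := .seq (sortAll d) (.seq (cellsCmd d) (greedyCmd d))

/-- The time that `netCmd` takes. -/
def netTime (π : Params) : ℕ :=
  π.d * (π.m * 6 + 3 + (π.L * (π.m * (5 * π.L + 23) + 3 + 3) + 3) + 1 + 1) + 1 +
    (π.m * π.D * (2 * π.d + 14 + 3) + 3 + ((π.I + 1) * (π.m * (pointTime π + 3) + 8) + 5) + 1) + 1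

/-- The output has at most `m / h` centres and `2 * m * (I + 1) / h` greedy points; a box with `h`
sample points contains one of the former or one of the latter. -/
theorem runs_netCmd (π : Params) {s : Store} (hs : Env π s) (h1 : s.wvar 1 = 0)
    (h2 : ∀ κ, s.warr 2 κ = 0) (h3 : ∀ x, s.warr 3 x = 0) (h4 : ∀ q, s.warr 4 q = 0)
    (hT : π.T0 = π.h * π.D) (hh : 2 ≤ π.h) :
    Runs π.w (netCmd π.d) s (netTime π) fun s' =>
      π.h * s'.wvar 1 ≤ π.m * (2 * π.I + 3) ∧
      ∀ a b : ℕ → ℝ, π.h ≤ (inside (sampleX s) π.d (Finset.range π.m) a b).card →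
        ∃ x, Out π.d s' x ∧ ∀ t < π.d, a t ≤ x t ∧ x t ≤ b t := by
  have hD : 0 < π.D := by
    rw [π.hD]; exact Nat.pow_pos (by have := π.hL; omega)
  refine Runs.seq _ _ (Runs.mono (runs_sortAll π hs) le_rfl ?_) le_rfl
  intro s₁ hf₁ hsort
  have hs₁ : Env π s₁ := hs.frame hf₁ (fun x _ hx h => by have := sortAll_WV h; omega)
    (fun h => by have := sortAll_WA h; omega)
  have hX₁ : ∀ t, sampleX s₁ t = sampleX s t := fun t => sampleX_congr
    (hf₁.wa _ (fun h => by have := sortAll_WA h; omega)) _ (hf₁.ra _ sortAll_RA)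
  have ha₁ : ∀ a, a < 10 → s₁.warr a = s.warr a := fun a ha =>
    hf₁.wa _ (fun h => by have := sortAll_WA h; omega)
  have h1₁ : s₁.wvar 1 = 0 := (hf₁.wv 1 fun h => by have := sortAll_WV h; omega).trans h1
  set rank : ℕ → ℕ → ℕ := fun t p => rk (sampleX s t) (Finset.range π.m) p with hrank
  set srt : ℕ → ℕ → ℕ := fun t x => s₁.warr (11 + 2 * t) (π.L * π.m + x) with hsrt
  have hrk : ∀ t, ∀ p < π.m, sortPos (sampleX s t) π.L p = rank t p := fun t p hp => by
    have := sortPos_eq_rk (sampleX s t) (π.hm ▸ hp)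
    rwa [← π.hm] at this
  have hready : Ready π rank srt s₁ := by
    refine ⟨hs₁, fun t _ p hp => ?_, fun t ht p hp => ?_, fun t _ x => rfl⟩
    · exact (rk_lt_card (Finset.mem_range.2 hp)).trans_eq (Finset.card_range _)
    · rw [(hsort t ht p hp).1, hrk t p hp]
  have hsr : ∀ t < π.d, ∀ p < π.m, srt t (rank t p) = p := fun t ht p hp => by
    rw [← hrk t p hp]; exact (hsort t ht p hp).2
  refine Runs.seq _ _ (Runs.mono (runs_cellsCmd π hready (by rw [ha₁ 2 (by norm_num)]; exact h2)
    (by rw [ha₁ 3 (by norm_num)]; exact h3) h1₁) le_rfl ?_) le_rfl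
  intro s₂ hf₂ hI
  have hXe : sampleX s₁ = sampleX s := funext hX₁
  rw [hXe] at hI
  set M : ℕ → ℕ → ℕ := fun κ i => s₂.warr 3 (κ * (π.m * π.D) + i) with hM
  have hlists : CellLists rank π.Lam π.m π.D π.d M := hI.mem
  have hcells : Cells π rank srt (sampleX s) M s₂ := by
    refine ⟨hready.frame hf₂ (fun x _ _ h => by have := cellsCmd_WV h; omega)
      (fun h => by have := cellsCmd_WA h; omega) (fun a _ h => by have := cellsCmd_WA h; omega),
      fun t ht => ?_, hI.cnt, fun _ _ => rfl, hlists, fun _ _ => hI.mem_lt _⟩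
    rw [← hX₁ t]
    exact sampleX_congr (hf₂.wa _ fun h => by have := cellsCmd_WA h; omega) _
      (hf₂.ra _ fun h => by have := cellsCmd_RA h; omega)
  have hcount := card_heavy_mul_le (rank := rank) (Lam := π.Lam) (m := π.m) (D := π.D) (d := π.d)
    hready.rank_lt (π.T0 + 1) (le_refl (π.m * π.D))
  rw [← hI.out] at hcount
  -- Here the choice `T0 = h * D` matters: it cancels the factor `D` in the number `m * D` of
  -- incidences.
  have hsize : π.h * s₂.wvar 1 ≤ π.m := by
    refine Nat.le_of_mul_le_mul_right (c := π.D) ?_ hD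
    calc π.h * s₂.wvar 1 * π.D = π.h * π.D * s₂.wvar 1 := by ring
      _ ≤ (π.T0 + 1) * s₂.wvar 1 := Nat.mul_le_mul_right _ (by omega)
      _ ≤ _ := hcount
  have hout : s₂.wvar 1 ≤ π.D * π.m ^ π.d := by
    rw [hI.out]; exact (Finset.card_filter_le _ _).trans_eq (Finset.card_range _)
  refine Runs.mono (runs_greedyCmd hcells (fun q => ?_) hout) le_rfl ?_
  · rw [hf₂.wa 4 fun h => by have := cellsCmd_WA h; omega, ha₁ 4 (by norm_num), h4]
  intro s₃ _ hR
  set F := family rank π.Lam π.m π.D π.d π.T0 π.h M with hF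
  set B := boxPts rank π.Lam π.m π.D π.d π.T0 M with hB
  have hspec : ∀ f ∈ F, B f ⊆ Finset.range π.m ∧ π.h ≤ (B f).card := family_spec
  have hFc : π.h * F.card ≤ π.m * 2 ^ (π.I + 1) := by
    refine (card_family_mul_le hready.rank_lt).trans (Nat.mul_le_mul_left _ ?_)
    rw [π.hI]; exact Nat.pow_le_pow_right (by norm_num) (by omega)
  refine ⟨?_, fun a b hab => ?_⟩
  · have h := (greedy_bounds hspec hFc (i := π.I + 1) le_rfl).2
    rw [hR.size, mul_add]
    calc _ ≤ π.m + 2 * π.m * (π.I + 1) := add_le_add hsize h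
      _ = _ := by ring
  · have hnet := exists_center_or_hit (X := sampleX s) (rank := rank) (srt := srt) (d := π.d) (T0 := π.T0)
      (M := M) (R := greedy F B π.m π.I (π.I + 1)) (a := a) (b := b) π.hm π.hL hh (fun _ _ _ _ => rfl) hsr
      (by rw [← π.hD]; exact hlists)
      (by rw [← π.hD]; exact fun f hf => greedy_hits hspec (by omega) hf) _
      (Finset.filter_subset _ _) (fun p hp => (Finset.mem_filter.1 hp).2) hab
    rw [← π.hD] at hnet
    rcases hnet with ⟨κ, -, hκ, hz⟩ | ⟨p, hp, h⟩
    · obtain ⟨z, hz', hκz, ho⟩ := hI.center κ hκ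
      exact ⟨_, hR.old _ ho, hz z hz' hκz⟩
    · exact ⟨_, hR.out p hp, h⟩

/-- The program. -/
def netProg (d a : ℕ) : Cmd := .seq (setup d a) (.seq sampleCmd (netCmd d))

theorem setup_WV {d a x : ℕ} (h : (setup d a).WV x) : 2 ≤ x ∧ x ≤ 21 := by
  simp [setup, double, powTable, Cmd.WV] at h
  omega

theorem setup_WA {d a x : ℕ} (h : (setup d a).WA x) : x = 1 := by
  simpa [setup, double, powTable, Cmd.WA] using h

theorem setup_RA {d a x : ℕ} : ¬ (setup d a).RA x := by
  simp [setup, double, powTable, Cmd.RA]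

end RealRAM


/-! ### The whole program, and from samples to weak nets -/

namespace RealRAM

/-- After a bounded number of steps the program has halted, and its output depends only on the sample. -/
theorem run_netProg {d a k j w n : ℕ} {P : Fin n → Fin d → ℝ} {ε : ℝ} (hkj : k ≤ 2 ^ j)
    (hw : wordBound d a k j ≤ w) (ha : 1 ≤ a) (hk : ∀ i : ℕ, (2 : ℝ) ^ i * ε < 1 ↔ i < k)
    (hj : ∀ i : ℕ, 2 ^ i < k ↔ i < j) :
    ∃ T ≤ k * 4 + j * 4 + 2 ^ (a + 6 + j) * 6 + 42 + 2 ^ (k + a + 4 + j) * 8 +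
        netTime (params d a k j w hkj hw),
      ∃ out : (ℕ → ℕ) → Store,
        run w T ([netProg d a], input P ε) = (samp n (2 ^ (k + a + 4 + j))).map (fun g => ([], out g)) ∧
        ∀ g, 2 ^ (a + j) * (out g).wvar 1 ≤ 2 ^ (k + a + 4 + j) *
            (2 * (d * (a + 6 + j) + 2 * d * (a + j + d * (a + 6 + j))) + 3) ∧
          ∀ α β : ℕ → ℝ, 2 ^ (a + j) ≤ (inside (fun t i => (input P ε).rarr t (g i)) d
              (Finset.range (2 ^ (k + a + 4 + j))) α β).card →
            ∃ x, Out d (out g) x ∧ ∀ t < d, α t ≤ x t ∧ x t ≤ β t := by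
  set π := params d a k j w hkj hw with hπ
  set s := input P ε with hs
  obtain ⟨t₁, ht₁, s₁, hs₁, hr₁⟩ := runs_setup (d := d) (a := a) (s := s) hkj hw (by simp [hs, input]) hk hj
  have hf := frame_of_run (hr₁ [])
  have hv : ∀ x, x = 0 ∨ x = 1 → s₁.wvar x = s.wvar x := fun x hx =>
    hf.wv x fun h => by have := setup_WV h; omega
  have hwa : ∀ b, b ≠ 1 → s₁.warr b = fun _ => 0 := fun b hb =>
    hf.wa b fun h => hb (setup_WA h)
  have hm : π.m < 2 ^ w := by have := π.sort_lt; exact lt_of_le_of_lt (Nat.le_mul_of_pos_left _ (by omega)) this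
  have hsamp := run_sampleCmd (n := n) (m := π.m) (s := s₁) (by rw [hv 0 (.inl rfl)]; simp [hs, input]) hs₁.m
    hm (hwa 0 (by norm_num)) [netCmd d]
  have hnet : ∀ g, Runs w (netCmd d) (sampled s₁ π.m g) (netTime π) fun s' =>
      π.h * s'.wvar 1 ≤ π.m * (2 * π.I + 3) ∧
      ∀ α β : ℕ → ℝ, π.h ≤ (inside (sampleX (sampled s₁ π.m g)) π.d (Finset.range π.m) α β).card →
        ∃ x, Out π.d s' x ∧ ∀ t < π.d, α t ≤ x t ∧ x t ≤ β t := by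
    intro g
    refine runs_netCmd π (hs₁.sampled _ g) ?_ ?_ ?_ ?_ (pow_add _ _ _) ?_
    · simp [sampled, hv 1 (.inr rfl), hs, input]
    · simp [sampled, hwa 2]
    · simp [sampled, hwa 3]
    · simp [sampled, hwa 4]
    · exact le_self_pow₀ one_le_two (by omega)
  choose t ht out hout hrun using hnet
  refine ⟨1 + (t₁ + (1 + (π.m * 8 + 5 + netTime π))), ?_, out, ?_, fun g => ⟨(hout g).1, fun α β h => ?_⟩⟩
  · have : π.m = 2 ^ (k + a + 4 + j) := rfl
    omega
  · rw [netProg, run_one_add_of_step rfl, run_add_of_run (hr₁ _), run_one_add_of_step rfl, run_add, hsamp,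
      PMF.bind_map, PMF.map]
    congr 1
    funext g
    -- The last part takes a different time for each sample. Since a halted configuration does not
    -- change, all runs are padded to the common time `netTime`.
    rw [Function.comp_apply, show netTime π = t g + (netTime π - t g) from
      (Nat.add_sub_cancel' (ht g)).symm, run_add_of_run (hrun g []), run_halted]
    rfl
  · refine (hout g).2 α β ?_
    have : sampleX (sampled s₁ π.m g) = fun t i => s.rarr t (g i) := by
      funext t i
      simp [sampleX, sampled, hf.ra t setup_RA]
    rw [this]
    exact h

/-- From `1 ≤ 2 ^ k * ε`, a box with `ε n` points has at least `n / 2 ^ k`, so it contains `h`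
sample points and hence an output point. Coordinates beyond `d` get the value `0` and play no role.
-/
theorem isWeakNet_of_sampleGood {d n k m h : ℕ} {P : Fin n → Fin d → ℝ} {ε : ℝ} {g : ℕ → ℕ} {s : Store}
    (hE : 1 ≤ 2 ^ k * ε) (hg : SampleGood (input P ε).rarr d n (2 ^ k) m h g)
    (hs : ∀ α β : ℕ → ℝ, h ≤ (inside (fun t i => (input P ε).rarr t (g i)) d (Finset.range m) α β).card →
      ∃ x, Out d s x ∧ ∀ t < d, α t ≤ x t ∧ x t ≤ β t) : IsWeakNet P ε (output d s) := by
  intro a b hab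
  set α : ℕ → ℝ := fun t => if ht : t < d then a ⟨t, ht⟩ else 0 with hα
  set β : ℕ → ℝ := fun t => if ht : t < d then b ⟨t, ht⟩ else 0 with hβ
  have hcard : {i : Fin n | P i ∈ Box a b}.ncard =
      (inside (input P ε).rarr d (Finset.range n) α β).card := by
    rw [← Set.ncard_image_of_injective _ Fin.val_injective, ← Set.ncard_coe_finset]
    congr 1
    ext i
    simp only [Set.mem_image, Set.mem_ofPred_eq, inside, Finset.mem_coe, Finset.mem_filter, Finset.mem_range, Box]
    constructor
    · rintro ⟨i, hi, rfl⟩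
      refine ⟨i.2, fun t ht => ?_⟩
      simpa [hα, hβ, ht, input] using hi ⟨t, ht⟩
    · rintro ⟨hi, h⟩
      refine ⟨⟨i, hi⟩, fun t => ?_, rfl⟩
      simpa [hα, hβ, hi, input] using h t t.2
  rw [hcard] at hab
  have hn : n ≤ 2 ^ k * (inside (input P ε).rarr d (Finset.range n) α β).card := by
    have h1 : (n : ℝ) ≤ 2 ^ k * ((inside (input P ε).rarr d (Finset.range n) α β).card : ℝ) := by
      calc (n : ℝ) ≤ 2 ^ k * ε * n := le_mul_of_one_le_left (Nat.cast_nonneg n) hE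
        _ = 2 ^ k * (ε * n) := by ring
        _ ≤ _ := by gcongr
    exact_mod_cast h1
  obtain ⟨x, ⟨i, hi, hx⟩, hbox⟩ := hs α β (hg α β hn)
  refine ⟨fun t => x t, ⟨i, hi, fun t => (hx t t.2).symm⟩, fun t => ?_⟩
  simpa [hα, hβ] using hbox t t.2

/-! ## The size of the parameters -/

/-- `f k j` is at most a constant times `(2 ^ k) ^ e * (2 ^ j) ^ p` for `k ≤ 2 ^ j`. -/
def Grows (p e : ℕ) (f : ℕ → ℕ → ℕ) : Prop :=
  ∃ K, ∀ k j, k ≤ 2 ^ j → f k j ≤ K * ((2 ^ k) ^ e * (2 ^ j) ^ p)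

section Grows

variable {p q e e' : ℕ} {f g : ℕ → ℕ → ℕ}

theorem Grows.mono (h : Grows p e f) (hp : p ≤ q) (he : e ≤ e') : Grows q e' f := by
  obtain ⟨K, hK⟩ := h
  refine ⟨K, fun k j hkj => (hK k j hkj).trans ?_⟩
  have h1 : 1 ≤ 2 ^ k := Nat.one_le_two_pow
  have h2 : 1 ≤ 2 ^ j := Nat.one_le_two_pow
  gcongr

theorem Grows.add (h : Grows p e f) (h' : Grows p e g) : Grows p e fun k j => f k j + g k j := by
  obtain ⟨K, hK⟩ := h
  obtain ⟨K', hK'⟩ := h'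
  refine ⟨K + K', fun k j hkj => ?_⟩
  rw [add_mul]
  exact add_le_add (hK k j hkj) (hK' k j hkj)

theorem Grows.mul (h : Grows p e f) (h' : Grows q e' g) : Grows (p + q) (e + e') fun k j => f k j * g k j := by
  obtain ⟨K, hK⟩ := h
  obtain ⟨K', hK'⟩ := h'
  refine ⟨K * K', fun k j hkj => (Nat.mul_le_mul (hK k j hkj) (hK' k j hkj)).trans_eq ?_⟩
  rw [pow_add, pow_add]; ring

theorem Grows.pow (h : Grows p e f) (t : ℕ) : Grows (p * t) (e * t) fun k j => f k j ^ t := by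
  obtain ⟨K, hK⟩ := h
  refine ⟨K ^ t, fun k j hkj => (Nat.pow_le_pow_left (hK k j hkj) t).trans_eq ?_⟩
  simp only [mul_pow, ← pow_mul, mul_assoc]

theorem Grows.const (c : ℕ) : Grows p e fun _ _ => c :=
  Grows.mono (p := 0) (e := 0) ⟨c, fun k j _ => by simp⟩ (Nat.zero_le _) (Nat.zero_le _)

theorem grows_left : Grows 1 0 fun k _ => k := ⟨1, fun k j hkj => by simpa using hkj⟩

theorem grows_right : Grows 1 0 fun _ j => j := ⟨1, fun k j _ => by simpa using Nat.lt_two_pow_self.le⟩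

theorem grows_two_pow_left : Grows 0 1 fun k _ => 2 ^ k := ⟨1, fun k j hkj => by simp⟩

theorem grows_two_pow_right : Grows 1 0 fun _ j => 2 ^ j := ⟨1, fun k j _ => by simp⟩

end Grows

/-- The greedy part dominates: testing a point costs `D * T0 ^ (2 * d) * T0`, of degree `2d² + 4d +
1` in `2 ^ j`. The number of points and the number of passes each add one to the degree. -/
theorem exists_time_bound (d a : ℕ) (hd : 1 ≤ d) : ∃ K : ℕ, ∀ k j w (hkj : k ≤ 2 ^ j)
    (hw : wordBound d a k j ≤ w),
    k * 4 + j * 4 + 2 ^ (a + 6 + j) * 6 + 42 + 2 ^ (k + a + 4 + j) * 8 + netTime (params d a k j w hkj hw) ≤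
      K * (2 ^ k * (2 ^ j) ^ (9 * d ^ 2)) := by
  have hp : 2 * d ^ 2 + 4 * d + 3 ≤ 9 * d ^ 2 := by nlinarith
  have hm : Grows 1 1 fun k j => 2 ^ (k + a + 4 + j) := by
    have h := (grows_two_pow_left.mul (Grows.const (p := 0) (e := 0) (2 ^ (a + 4)))).mul grows_two_pow_right
    simpa only [← pow_add, ← add_assoc] using h
  have hL : Grows 1 0 fun k j => k + a + 4 + j := ((grows_left.add (.const a)).add (.const 4)).add grows_right
  have hLam : Grows 1 0 fun _ j => 2 ^ (a + 6 + j) := by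
    have h := (Grows.const (p := 0) (e := 0) (2 ^ (a + 6))).mul grows_two_pow_right
    simpa only [← pow_add, ← add_assoc] using h
  have hD : Grows d 0 fun _ j => 2 ^ (d * (a + 6 + j)) := by
    have h := hLam.pow d
    simpa only [← pow_mul, one_mul, zero_mul, mul_comm _ d, mul_one, mul_zero] using h
  have hh : Grows 1 0 fun _ j => 2 ^ (a + j) := by
    have h := (Grows.const (p := 0) (e := 0) (2 ^ a)).mul grows_two_pow_right
    simpa only [← pow_add] using h
  have hT0 : Grows (1 + d) 0 fun _ j => 2 ^ (a + j + d * (a + 6 + j)) := by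
    simpa only [← pow_add] using hh.mul hD
  have hY : Grows (d + (1 + d) * (2 * d)) 0 fun _ j =>
      2 ^ (d * (a + 6 + j)) * (2 ^ (a + j + d * (a + 6 + j))) ^ (2 * d) := by
    simpa only [zero_mul, add_zero] using hD.mul (hT0.pow (2 * d))
  have hl : Grows 1 0 fun _ j => a + 6 + j := (Grows.const (a + 6)).add grows_right
  have hdl : Grows 1 0 fun _ j => d * (a + 6 + j) := by
    simpa using (Grows.const (p := 0) (e := 0) d).mul hl
  have hI : Grows 1 0 fun _ j => d * (a + 6 + j) + 2 * d * (a + j + d * (a + 6 + j)) + 1 := by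
    refine (hdl.add ?_).add (.const 1)
    simpa using (Grows.const (p := 0) (e := 0) (2 * d)).mul (((Grows.const a).add grows_right).add hdl)
  have hP : Grows (2 * d ^ 2 + 4 * d + 1) 0 fun _ j =>
      2 ^ (d * (a + 6 + j)) * (2 ^ (a + j + d * (a + 6 + j))) ^ (2 * d) *
        (2 ^ (a + j + d * (a + 6 + j)) * 10 + 23) + 2 * d + 15 := by
    refine ((Grows.mono (hY.mul ((hT0.mul (.const (p := 0) (e := 0) 10)).add (.const 23))) ?_ le_rfl).add
      (.const _)).add (.const _)
    apply le_of_eq; ring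
  have hG : Grows (2 * d ^ 2 + 4 * d + 3) 1 fun k j =>
      (d * (a + 6 + j) + 2 * d * (a + j + d * (a + 6 + j)) + 1) * (2 ^ (k + a + 4 + j) *
        (2 ^ (d * (a + 6 + j)) * (2 ^ (a + j + d * (a + 6 + j))) ^ (2 * d) *
          (2 ^ (a + j + d * (a + 6 + j)) * 10 + 23) + 2 * d + 15 + 3) + 8) := by
    refine Grows.mono (hI.mul (e' := 1) (Grows.add (p := 2 * d ^ 2 + 4 * d + 2) (Grows.mono (hm.mul
      (hP.add (.const 3))) ?_ le_rfl) (.const 8))) ?_ ?_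
    all_goals omega
  have hC : Grows (1 + d) 1 fun k j => 2 ^ (k + a + 4 + j) * 2 ^ (d * (a + 6 + j)) * (2 * d + 14 + 3) := by
    simpa using (hm.mul hD).mul (Grows.const (p := 0) (e := 0) (2 * d + 14 + 3))
  have hS : Grows 3 1 fun k j => d * (2 ^ (k + a + 4 + j) * 6 + 3 + ((k + a + 4 + j) *
      (2 ^ (k + a + 4 + j) * (5 * (k + a + 4 + j) + 23) + 3 + 3) + 3) + 1 + 1) := by
    have h5 : Grows 1 0 fun k j => 5 * (k + a + 4 + j) + 23 := by
      simpa using ((Grows.const (p := 0) (e := 0) 5).mul hL).add (.const 23)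
    have h6 : Grows 3 1 fun k j => (k + a + 4 + j) *
        (2 ^ (k + a + 4 + j) * (5 * (k + a + 4 + j) + 23) + 3 + 3) :=
      Grows.mono (hL.mul (((hm.mul h5).add (.const 3)).add (.const 3))) (by norm_num) (by norm_num)
    have h7 : Grows 3 1 fun k j => 2 ^ (k + a + 4 + j) * 6 :=
      Grows.mono (hm.mul (.const (p := 0) (e := 0) 6)) (by norm_num) (by norm_num)
    simpa using (Grows.const (p := 0) (e := 0) d).mul
      ((((h7.add (.const 3)).add (h6.add (.const 3))).add (.const 1)).add (.const 1))
  have hmono : ∀ {p e : ℕ} {f : ℕ → ℕ → ℕ}, Grows p e f → p ≤ 2 * d ^ 2 + 4 * d + 3 → e ≤ 1 →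
      Grows (9 * d ^ 2) 1 f := fun h h1 h2 => h.mono (h1.trans hp) h2
  have hd2 : 0 ≤ d ^ 2 := Nat.zero_le _
  have h4 : Grows 1 0 fun k _ => k * 4 := grows_left.mul (.const (p := 0) (e := 0) 4)
  have h4' : Grows 1 0 fun _ j => j * 4 := grows_right.mul (.const (p := 0) (e := 0) 4)
  have h6 : Grows 1 0 fun _ j => 2 ^ (a + 6 + j) * 6 := hLam.mul (.const (p := 0) (e := 0) 6)
  have h8 : Grows 1 1 fun k j => 2 ^ (k + a + 4 + j) * 8 := hm.mul (.const (p := 0) (e := 0) 8)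
  obtain ⟨K, hK⟩ := (((((hmono h4 (by omega) (by omega)).add (hmono h4' (by omega) (by omega))).add
    (hmono h6 (by omega) (by omega))).add (.const 42)).add (hmono h8 (by omega) (by omega))).add
    ((((hmono hS (by omega) le_rfl).add (.const 1)).add ((((hmono hC (by omega) le_rfl).add (.const 3)).add
      ((hmono hG le_rfl le_rfl).add (.const 5))).add (.const 1))).add (.const 1))
  refine ⟨K, fun k j w hkj hw => ?_⟩
  have := hK k j hkj
  rw [pow_one] at this
  exact this

/-- All exponents are linear in `k` and `j`. The only exponential term, the one for the table of
powers, is controlled by `2 ^ j ≤ 2 * k`. -/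
theorem exists_wordBound_le (d a : ℕ) : ∃ c : ℕ, ∀ k j, 1 ≤ k → j ≤ k → 2 ^ j ≤ 2 * k →
    wordBound d a k j ≤ c * k := by
  refine ⟨3 * (a + 6) + 2 ^ (a + 7) + d * (a + 6) + 3 * (d * (a + 7)) + (a + 1) +
    (d * (a + 7) + 2 * d * (a + 1 + d * (a + 7))) + 10, fun k j hk hj hjk => ?_⟩
  have ha : a ≤ a * k := Nat.le_mul_of_pos_right _ hk
  have h1 : k + a + 4 + j ≤ (a + 6) * k := by linarith
  have h2 : a + 6 + j ≤ (a + 7) * k := by linarith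
  have h3 : a + j ≤ (a + 1) * k := by linarith
  have h4 : 2 ^ (a + 6 + j) ≤ 2 ^ (a + 7) * k := by
    calc 2 ^ (a + 6 + j) = 2 ^ (a + 6) * 2 ^ j := pow_add _ _ _
      _ ≤ 2 ^ (a + 6) * (2 * k) := Nat.mul_le_mul_left _ hjk
      _ = 2 ^ (a + 7) * k := by rw [show a + 7 = a + 6 + 1 from rfl, pow_succ 2 (a + 6)]; ring
  have h5 : d * (k + a + 4 + j) ≤ d * (a + 6) * k := by rw [mul_assoc]; exact Nat.mul_le_mul_left _ h1
  have h6 : d * (a + 6 + j) ≤ d * (a + 7) * k := by rw [mul_assoc]; exact Nat.mul_le_mul_left _ h2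
  have h7 : 2 * d * (a + j + d * (a + 6 + j)) ≤ 2 * d * (a + 1 + d * (a + 7)) * k := by
    rw [mul_assoc (2 * d)]; exact Nat.mul_le_mul_left _ (by linarith)
  unfold wordBound
  linarith

end RealRAM


namespace RealRAM

/-! ## Estimates -/

/-- The least `k` with `1 ≤ 2 ^ k * ε`. -/
theorem exists_scale {ε : ℝ} (hε : 0 < ε) (hε1 : ε < 1) :
    ∃ k : ℕ, 1 ≤ k ∧ (∀ i : ℕ, (2 : ℝ) ^ i * ε < 1 ↔ i < k) ∧ (2 : ℝ) ^ k ≤ 2 * ε⁻¹ ∧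
      (k : ℝ) ≤ 3 * max 1 (Real.log ε⁻¹) := by
  classical
  have hex : ∃ k : ℕ, 1 ≤ (2 : ℝ) ^ k * ε := by
    obtain ⟨k, hk⟩ := pow_unbounded_of_one_lt ε⁻¹ (one_lt_two (α := ℝ))
    exact ⟨k, by rw [← inv_mul_cancel₀ hε.ne']; gcongr⟩
  have hmin : ∀ i < Nat.find hex, (2 : ℝ) ^ i * ε < 1 := fun i hi => not_le.1 (Nat.find_min hex hi)
  have hspec := Nat.find_spec hex
  set k := Nat.find hex
  have hk1 : 1 ≤ k := by
    by_contra h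
    rw [show k = 0 by omega, pow_zero, one_mul] at hspec
    linarith
  have hlt : (2 : ℝ) ^ (k - 1) < ε⁻¹ := by
    rw [← one_div, lt_div_iff₀ hε]; exact hmin _ (by omega)
  refine ⟨k, hk1, fun i => ⟨fun h => ?_, hmin i⟩, ?_, ?_⟩
  · by_contra hi
    have : (2 : ℝ) ^ k * ε ≤ 2 ^ i * ε := by
      gcongr
      · norm_num
      · omega
    linarith
  · rw [show k = k - 1 + 1 by omega, pow_succ]; linarith
  · have h1 : ((k - 1 : ℕ) : ℝ) * Real.log 2 ≤ Real.log ε⁻¹ := by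
      rw [← Real.log_pow]; exact Real.log_le_log (by positivity) hlt.le
    rw [Nat.cast_sub hk1] at h1
    have h2 := Real.log_two_gt_d9
    have h3 := le_max_left 1 (Real.log ε⁻¹)
    have h4 := le_max_right 1 (Real.log ε⁻¹)
    have h5 : (1 : ℝ) ≤ k := by exact_mod_cast hk1
    push_cast at h1
    nlinarith

/-- The least `j` with `k ≤ 2 ^ j`. -/
theorem exists_log_scale {k : ℕ} (hk : 1 ≤ k) : ∃ j : ℕ, k ≤ 2 ^ j ∧ (∀ i : ℕ, 2 ^ i < k ↔ i < j) ∧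
    j ≤ k ∧ 2 ^ j ≤ 2 * k := by
  have hex : ∃ j : ℕ, k ≤ 2 ^ j := ⟨k, Nat.lt_two_pow_self.le⟩
  have hmin : ∀ i < Nat.find hex, 2 ^ i < k := fun i hi => not_le.1 (Nat.find_min hex hi)
  have hspec := Nat.find_spec hex
  have hle : Nat.find hex ≤ k := Nat.find_min' hex Nat.lt_two_pow_self.le
  set j := Nat.find hex
  refine ⟨j, hspec, fun i => ⟨fun h => ?_, hmin i⟩, hle, ?_⟩
  · by_contra hi
    have : 2 ^ j ≤ 2 ^ i := Nat.pow_le_pow_right (by norm_num) (by omega)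
    omega
  · rcases Nat.eq_zero_or_pos j with h | h
    · rw [h, pow_zero]; omega
    · have := hmin (j - 1) (by omega)
      rw [show j = j - 1 + 1 by omega, pow_succ]; omega

theorem log_scale_le {k j : ℕ} {x : ℝ} (hk : 1 ≤ k) (hx : (k : ℝ) ≤ 3 * max 1 x) (hj : 2 ^ j ≤ 2 * k) :
    (j : ℝ) + 1 ≤ 7 * max 1 (Real.log x) := by
  have h1 : (2 : ℝ) ^ j ≤ 2 * k := by exact_mod_cast hj
  have hk0 : (0 : ℝ) < k := by exact_mod_cast hk
  have h2 : (j : ℝ) * Real.log 2 ≤ Real.log 2 + Real.log k := by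
    rw [← Real.log_pow, ← Real.log_mul (by norm_num) hk0.ne']
    exact Real.log_le_log (by positivity) h1
  have hmax : (0 : ℝ) < max 1 x := lt_max_of_lt_left one_pos
  have h3 : Real.log k ≤ Real.log 3 + Real.log (max 1 x) := by
    rw [← Real.log_mul (by norm_num) hmax.ne']
    exact Real.log_le_log hk0 hx
  have h4 : Real.log 3 ≤ 3 - 1 := Real.log_le_sub_one_of_pos (by norm_num)
  have h5 : Real.log (max 1 x) ≤ max 1 (Real.log x) := by
    rcases le_total x 1 with h | h
    · rw [max_eq_left h, Real.log_one]; exact le_max_of_le_left zero_le_one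
    · rw [max_eq_right h]; exact le_max_right _ _
  have h6 := Real.log_two_gt_d9
  have h7 := le_max_left 1 (Real.log x)
  have h8 := Real.log_two_lt_d9
  nlinarith

/-- With `n ≥ 1` and `ε⁻¹ > 1` one has `2 ^ k ≤ 2 * ε⁻¹ ≤ (n + ε⁻¹) ^ 2`, which is why the exponent
is doubled. -/
theorem mul_le_word {n k c w : ℕ} {ε : ℝ} (hn : 1 ≤ n) (hε : 0 < ε) (hε1 : ε < 1)
    (hk : (2 : ℝ) ^ k ≤ 2 * ε⁻¹) (hw : ((n : ℝ) + ε⁻¹) ^ (2 * c) ≤ 2 ^ w) : c * k ≤ w := by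
  have h1 : (1 : ℝ) < ε⁻¹ := (one_lt_inv₀ hε).2 hε1
  have h2 : (1 : ℝ) ≤ n := by exact_mod_cast hn
  have h3 : (2 : ℝ) ^ k ≤ ((n : ℝ) + ε⁻¹) ^ 2 := by nlinarith
  have h4 : (2 : ℝ) ^ (c * k) ≤ 2 ^ w := by
    calc (2 : ℝ) ^ (c * k) = (2 ^ k) ^ c := by rw [mul_comm, pow_mul]
      _ ≤ (((n : ℝ) + ε⁻¹) ^ 2) ^ c := by gcongr
      _ ≤ _ := by rw [← pow_mul]; exact hw
  exact (pow_le_pow_iff_right₀ (one_lt_two (α := ℝ))).1 h4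

/-- The base of the union bound is at most `2 ^ (k * (4 * d + 3))`, and `2 ^ (-2k) ≤ ε / 2`. So the
exponent must pay `a * k` with `a = 2 * d * (4 * d + 3) + 2 * q`, and `2 ^ (a + j) ≥ a * k` does. -/
theorem failure_le {d q k j : ℕ} {ε : ℝ} (hk1 : 1 ≤ k) (hkj : k ≤ 2 ^ j) (hk : 1 ≤ 2 ^ k * ε) (hε : 0 < ε) :
    ((4 * d * 2 ^ k + 2 : ℕ) : ℝ) ^ (2 * d) * (1 / 2) ^ (3 * 2 ^ (2 * d * (4 * d + 3) + 2 * q + j)) ≤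
      (ε / 2) ^ q := by
  set a := 2 * d * (4 * d + 3) + 2 * q with ha
  have h1 : 4 * d * 2 ^ k + 2 ≤ 2 ^ (k * (4 * d + 3)) := by
    have h2 : 4 * d + 2 < 2 ^ (4 * d + 2) := Nat.lt_two_pow_self
    have h3 : 1 ≤ 2 ^ k := Nat.one_le_two_pow
    calc 4 * d * 2 ^ k + 2 ≤ (4 * d + 2) * 2 ^ k := by rw [add_mul]; omega
      _ ≤ 2 ^ (4 * d + 2) * 2 ^ k := Nat.mul_le_mul_right _ h2.le
      _ = 2 ^ (4 * d + 2 + k) := (pow_add _ _ _).symm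
      _ ≤ _ := Nat.pow_le_pow_right (by norm_num) (by nlinarith)
  have h2 : ((4 * d * 2 ^ k + 2 : ℕ) : ℝ) ≤ 2 ^ (k * (4 * d + 3)) := by exact_mod_cast h1
  have h3 : (1 / 2 : ℝ) ^ (2 * k) ≤ ε / 2 := by
    have h4 : (1 / 2 : ℝ) ^ k ≤ ε := by
      rw [one_div, inv_pow, inv_le_iff_one_le_mul₀ (by positivity), mul_comm]; exact hk
    have h5 : (1 / 2 : ℝ) ^ k ≤ 1 / 2 := by
      simpa using pow_le_pow_of_le_one (by norm_num : (0 : ℝ) ≤ 1 / 2) (by norm_num) hk1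
    have h6 : (0 : ℝ) ≤ (1 / 2) ^ k := by positivity
    rw [two_mul, pow_add]; nlinarith
  have hexp : k * (4 * d + 3) * (2 * d) + 2 * k * q ≤ 3 * 2 ^ (a + j) := by
    have h4 : a < 2 ^ a := Nat.lt_two_pow_self
    calc k * (4 * d + 3) * (2 * d) + 2 * k * q = a * k := by rw [ha]; ring
      _ ≤ 2 ^ a * 2 ^ j := Nat.mul_le_mul h4.le hkj
      _ = 2 ^ (a + j) := (pow_add _ _ _).symm
      _ ≤ _ := by omega
  calc _ ≤ ((2 : ℝ) ^ (k * (4 * d + 3))) ^ (2 * d) *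
        (1 / 2) ^ (k * (4 * d + 3) * (2 * d) + 2 * k * q) := by
        refine mul_le_mul (by gcongr) (pow_le_pow_of_le_one (by norm_num) (by norm_num) hexp)
          (by positivity) (by positivity)
    _ = ((1 / 2 : ℝ) ^ (2 * k)) ^ q := by
        rw [← pow_mul, pow_add, ← mul_assoc, ← mul_pow, ← pow_mul]; norm_num
    _ ≤ _ := by gcongr

theorem le_toOuterMeasure_of_compl {α : Type*} (p : PMF α) {S : Set α} {x y : ℝ} (hy : 0 ≤ y) (hxy : y ≤ x)
    (h : p.toOuterMeasure Sᶜ ≤ ENNReal.ofReal y) : ENNReal.ofReal (1 - x) ≤ p.toOuterMeasure S := by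
  have h1 : p.toOuterMeasure Set.univ = 1 := (PMF.toOuterMeasure_apply_eq_one_iff _ _).2 (Set.subset_univ _)
  have h2 : (1 : ENNReal) ≤ p.toOuterMeasure S + ENNReal.ofReal y := by
    rw [← h1, ← Set.union_compl_self S]
    exact (MeasureTheory.measure_union_le _ _).trans (by gcongr)
  calc ENNReal.ofReal (1 - x) ≤ ENNReal.ofReal (1 - y) := ENNReal.ofReal_le_ofReal (by linarith)
    _ = 1 - ENNReal.ofReal y := by rw [ENNReal.ofReal_sub _ hy, ENNReal.ofReal_one]
    _ ≤ _ := tsub_le_iff_right.2 h2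

end RealRAM

/-! ### The theorem -/

theorem mainTheorem8 :
    ∃ C : ℕ, ∀ d : ℕ, 1 ≤ d → ∀ q : ℕ, ∃ (prog : RealRAM.Cmd) (c K : ℕ),
      ∀ (n : ℕ) (P : Fin n → Fin d → ℝ) (ε : ℝ) (w : ℕ),
        1 ≤ n → 0 < ε → ε < 1 → ((n : ℝ) + ε⁻¹) ^ c ≤ (2 : ℝ) ^ w →
        ∃ T : ℕ,
          (T : ℝ) ≤ (K : ℝ) * ((n : ℝ) + ε⁻¹ * (max 1 (Real.log ε⁻¹)) ^ (C * d ^ 2)) ∧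
          (∀ z ∈ (RealRAM.run w T ([prog], RealRAM.input P ε)).support,
            z.1 = [] ∧
            (RealRAM.outputSize z.2 : ℝ) ≤
              (K : ℝ) * (ε⁻¹ * max 1 (Real.log (Real.log ε⁻¹)))) ∧
          ENNReal.ofReal (1 - (ε / 2) ^ q) ≤
            (RealRAM.run w T ([prog], RealRAM.input P ε)).toOuterMeasure
              {z | IsWeakNet P ε (RealRAM.output d z.2)} := by
  refine ⟨9, fun d hd q => ?_⟩
  set a := 2 * d * (4 * d + 3) + 2 * q with ha
  obtain ⟨c, hc⟩ := RealRAM.exists_wordBound_le d a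
  obtain ⟨K, hK⟩ := RealRAM.exists_time_bound d a hd
  have ha1 : 1 ≤ a := by
    have : 1 ≤ d * d := Nat.mul_pos hd hd
    nlinarith
  -- Chosen so that `2 * I + 3 ≤ b * (j + 1)`; the size bound becomes `16 * 2 ^ k * b * (j + 1)`.
  obtain ⟨b, hb⟩ : ∃ b, b = 2 * (d * (a + 6) + 2 * d * (a + 1 + d * (a + 6))) + 3 := ⟨_, rfl⟩
  refine ⟨RealRAM.netProg d a, 2 * c, K * 2 * 6 ^ (9 * d ^ 2) + 16 * 2 * 7 * b,
    fun n P ε w hn hε hε1 hw => ?_⟩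
  obtain ⟨k, hk1, hk, hkε, hklog⟩ := RealRAM.exists_scale hε hε1
  obtain ⟨j, hkj, hj, hjk, hjk2⟩ := RealRAM.exists_log_scale hk1
  have hwb : RealRAM.wordBound d a k j ≤ w :=
    (hc k j hk1 hjk hjk2).trans (RealRAM.mul_le_word hn hε hε1 hkε hw)
  have hkE : 1 ≤ (2 : ℝ) ^ k * ε := not_lt.1 fun h => lt_irrefl k ((hk k).1 h)
  obtain ⟨T, hT, out, hrun, hout⟩ := RealRAM.run_netProg (P := P) hkj hwb ha1 hk hj
  have hε0 : (0 : ℝ) < ε⁻¹ := inv_pos.2 hε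
  set Λ := max 1 (Real.log ε⁻¹) with hΛ
  have hΛ1 : 1 ≤ Λ := le_max_left _ _
  set Λ' := max 1 (Real.log (Real.log ε⁻¹)) with hΛ'
  have hΛ'1 : 1 ≤ Λ' := le_max_left _ _
  refine ⟨T, ?_, ?_, ?_⟩
  · have h1 : (T : ℝ) ≤ K * (2 ^ k * (2 ^ j) ^ (9 * d ^ 2)) := by
      exact_mod_cast hT.trans (hK k j w hkj hwb)
    -- From `2 ^ j ≤ 2 * k` and `k ≤ 3 * Λ`; this turns powers of `2 ^ j` into powers of the
    -- logarithm.
    have h2 : (2 : ℝ) ^ j ≤ 6 * Λ := by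
      have : (2 : ℝ) ^ j ≤ 2 * k := by exact_mod_cast hjk2
      linarith
    calc (T : ℝ) ≤ K * (2 ^ k * (2 ^ j) ^ (9 * d ^ 2)) := h1
      _ ≤ K * (2 * ε⁻¹ * (6 * Λ) ^ (9 * d ^ 2)) := by gcongr
      _ = K * 2 * 6 ^ (9 * d ^ 2) * (ε⁻¹ * Λ ^ (9 * d ^ 2)) := by rw [mul_pow]; ring
      _ ≤ _ := by
        push_cast
        refine mul_le_mul ?_ ?_ (by positivity) (by positivity)
        · exact le_add_of_nonneg_right (by positivity)
        · exact le_add_of_nonneg_left (by positivity)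
  · intro z hz
    rw [hrun, PMF.support_map] at hz
    obtain ⟨g, -, rfl⟩ := hz
    refine ⟨rfl, ?_⟩
    have h1 : (out g).wvar 1 ≤ 16 * 2 ^ k * (b * (j + 1)) := by
      refine le_of_mul_le_mul_left ((hout g).1.trans ?_) (Nat.two_pow_pos (a + j))
      have h2 : 2 ^ (k + a + 4 + j) = 2 ^ (a + j) * (16 * 2 ^ k) := by
        simp only [pow_add]; ring
      rw [h2, mul_assoc]
      refine Nat.mul_le_mul_left _ (Nat.mul_le_mul_left _ ?_)
      have h3 : 2 * (d * (a + 6 + j) + 2 * d * (a + j + d * (a + 6 + j))) + 3 +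
          (2 * (d * (a + 5) + 2 * d * (a + d * (a + 5))) + 3) * j + 4 * d = b * (j + 1) := by
        rw [hb]; ring
      omega
    have h4 := RealRAM.log_scale_le hk1 hklog hjk2
    calc ((RealRAM.outputSize (out g) : ℕ) : ℝ) ≤ 16 * 2 ^ k * (b * (j + 1)) := by exact_mod_cast h1
      _ ≤ 16 * (2 * ε⁻¹) * (b * (7 * Λ')) := by gcongr
      _ = (16 * 2 * 7 * b) * (ε⁻¹ * Λ') := by ring
      _ ≤ _ := by
        have h5 : (0 : ℝ) ≤ K * 2 * 6 ^ (9 * d ^ 2) * (ε⁻¹ * Λ') := by positivity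
        rw [Nat.cast_add, add_mul]
        push_cast
        linarith
  · rw [hrun, PMF.toOuterMeasure_map_apply]
    refine RealRAM.le_toOuterMeasure_of_compl _ (y := ((4 * d * 2 ^ k + 2 : ℕ) : ℝ) ^ (2 * d) *
      (1 / 2) ^ (3 * 2 ^ (a + j))) (by positivity) (RealRAM.failure_le hk1 hkj hkE hε) ?_
    -- The output is a function of the sample, so failure is an event about `samp`, contained in the
    -- event that the sample is not good.
    refine le_trans (MeasureTheory.measure_mono fun g hg => ?_) (samp_not_good_le (RealRAM.input P ε).rarr
      (n := n) (E := 2 ^ k) (m := 2 ^ (k + a + 4 + j)) (h := 2 ^ (a + j)) (B := 4 * 2 ^ (a + j)) hd hn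
      (by positivity) (by simp only [pow_add]; ring) rfl)
    exact fun hgood => hg (RealRAM.isWeakNet_of_sampleGood hkE hgood (hout g).2)
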